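/- **Expressions.** Expressions of MATLANG + eigen are given by $e ::= M \mid \mathsf{let}\ M=e_1\ \mathsf{in}\ e_2 \mid e^* \mid \mathbf 1(e) \mid \mathsf{diag}(e) \mid e_1\cdot e_2 \mid \mathsf{apply}[f](e_1,\dots,e_n) \mid \mathsf{eigen}(e)$, where $M$ is a matrix variable and $f$ is a symbol for a function $f:\mathbf C^n\to\mathbf C$. A size term is a size symbol or $1$; a type is $s_1\times s_2$ with size terms $s_1,s_2$; a schema $\mathcal S$ assigns types to the elements of a nonempty finite set $\mathrm{var}(\mathcal S)$ of matrix variables. Typing: $M$ has type $\mathcal S(M)$; $\mathsf{let}\ M=e_1\ \mathsf{in}\ e_2$ has type $\tau_2$ if $e_1$ has type $\tau_1$ over $\mathcal S$ and $e_2$ has type $\tau_2$ over $\mathcal S[M:=\tau_1]$; if $e:s_1\times s_2$, then $e^*:s_2\times s_1$ and $\mathbf 1(e):s_1\times 1$; if $e:s\times 1$, then $\mathsf{diag}(e):s\times s$; if $e_1:s_1\times s_2$ and $e_2:s_2\times s_3$, then $e_1\cdot e_2:s_1\times s_3$; if $n>0$ and all $e_k:\tau$, then $\mathsf{apply}[f](e_1,\dots,e_n):\tau$;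 if $e:s\times s$, then $\mathsf{eigen}(e):s\times s$. **Semantics.** An instance $I$ assigns complex matrices to finitely many matrix variables. The set $e(I)$ of possible results is defined by recursion on $e$: $A\in M(I)$ iff $A=I(M)$; $B\in(\mathsf{let}\ M=e_1\ \mathsf{in}\ e_2)(I)$ iff $B\in e_2(I[M:=A])$ for some $A\in e_1(I)$; in the other cases one takes possible results of the subexpressions, of matching dimensions, and applies conjugate transpose, the $m\times1$ vector of ones ($m$ the number of rows), the diagonal matrix of a column vector, the matrix product, entrywise application of $f$, or $\mathsf{eigen}$, respectively. For an $n\times n$ matrix $A$ the possible results of $\mathsf{eigen}$ on $A$ are: if $A$ is diagonalizable, all $n\times n$ matrices whose columns form a basis of $\mathbf C^n$ of eigenvectors of $A$ in which distinct basis vectors for the same eigenvalue are orthogonal; otherwise, only the zero matrix. **Input-sized expressions and formulas.** An input-sized expression $(\mathcal S,e,\sigma)$ consists of a schema $\mathcal S$, an expression $e$ well-typed over $\mathcal S$ with output type $t_1\times t_2$, and an assignment $\sigma$ of positive integers to (at least) the size symbols occurring in $\mathcal S$, extended by $\sigma(1)=1$. An instance conforms to $\mathcal S$ by $\sigma$ if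 it is defined exactly on $\mathrm{var}(\mathcal S)$ and $I(M)$ is a $\sigma(s_1)\times\sigma(s_2)$ matrix whenever $\mathcal S(M)=s_1\times s_2$. Existential formulas over the reals are built from real variables, integer constants, $+$, $\cdot$ and, for each pointwise function symbol $f:\mathbf C^n\to\mathbf C$, two function symbols of arity $2n$ for the real and the imaginary part of $f$, by means of $=$, $<$, $\lor$, $\land$, $\exists$. Input-sized expressions and formulas are written as strings over finite alphabets, with the sizes $\sigma(\alpha)$ in unary. **Theorem.** There is a translation, computable by a Turing machine in time polynomial in the length of the input string, that maps every input-sized expression $(\mathcal S,e,\sigma)$ to an existential formula $\psi$ over the reals whose only pointwise function symbols are those of functions used in $e$, such that: 1. The set of free variables of $\psi$ is exactly $\mathrm{FV}(\mathcal S,e,\sigma)$, which consists of $x_{M,i,j,\Re}$ and $x_{M,i,j,\Im}$ for $M\in\mathrm{var}(\mathcal S)$, $\mathcal S(M)=s_1\times s_2$, $1\le i\le\sigma(s_1)$, $1\le j\le\sigma(s_2)$, and of $y_{i,j,\Re}$ and $y_{i,j,\Im}$ for $1\le i\le\sigma(t_1)$, $1\le j\le\sigma(t_2)$. 2. Every assignment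 $\rho$ of real numbers to these variables specifies, through the $x$-variables (as real and imaginary parts of the entries), an instance $I$ conforming to $\mathcal S$ by $\sigma$ and, through the $y$-variables, a $\sigma(t_1)\times\sigma(t_2)$ matrix $B$. 3. For every interpretation of the pointwise function symbols by functions $\mathbf C^n\to\mathbf C$ and every assignment $\rho$, the formula $\psi$ is true over the reals under $\rho$ if and only if $B\in e(I)$. -/

import Mathlib

namespace Matlang

/-! ### Syntax of expressions, types, schemas -/

/-- Identifiers (of matrix variables, size symbols and pointwise functions) are strings of bits. -/
abbrev Name : Type := List Bool

/-- Expressions of the matrix language with the `eigen` operation.  In `apply f n args` the pointwise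
function symbol is the name `f` together with its arity `n`. -/
inductive Expr : Type
  | var (M : Name) : Expr
  | letIn (M : Name) (e₁ e₂ : Expr) : Expr
  | transp (e : Expr) : Expr
  | ones (e : Expr) : Expr
  | diag (e : Expr) : Expr
  | mul (e₁ e₂ : Expr) : Expr
  | apply (f : Name) (n : ℕ) (args : Fin n → Expr) : Expr
  | eigen (e : Expr) : Expr

/-- A size term is an explicit `1` or a size symbol. -/
inductive SizeTerm : Type
  | one : SizeTerm
  | sym (α : Name) : SizeTerm

/-- The type `s₁ × s₂` is the pair `(s₁, s₂)`. -/
abbrev Ty : Type := SizeTerm × SizeTerm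

/-- The typing rules: `HasType S e τ` means that `e` has output type `τ` over the schema `S`, where
`S M = none` if `M` is not a variable of the schema. -/
inductive HasType : (Name → Option Ty) → Expr → Ty → Prop
  | var {S : Name → Option Ty} {M : Name} {τ : Ty} (h : S M = some τ) : HasType S (.var M) τ
  | letIn {S : Name → Option Ty} {M : Name} {e₁ e₂ : Expr} {τ₁ τ₂ : Ty} (h₁ : HasType S e₁ τ₁)
      (h₂ : HasType (Function.update S M (some τ₁)) e₂ τ₂) : HasType S (.letIn M e₁ e₂) τ₂
  | transp {S : Name → Option Ty} {e : Expr} {s₁ s₂ : SizeTerm} (h : HasType S e (s₁, s₂)) :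
      HasType S (.transp e) (s₂, s₁)
  | ones {S : Name → Option Ty} {e : Expr} {s₁ s₂ : SizeTerm} (h : HasType S e (s₁, s₂)) :
      HasType S (.ones e) (s₁, .one)
  | diag {S : Name → Option Ty} {e : Expr} {s : SizeTerm} (h : HasType S e (s, .one)) :
      HasType S (.diag e) (s, s)
  | mul {S : Name → Option Ty} {e₁ e₂ : Expr} {s₁ s₂ s₃ : SizeTerm}
      (h₁ : HasType S e₁ (s₁, s₂)) (h₂ : HasType S e₂ (s₂, s₃)) : HasType S (.mul e₁ e₂) (s₁, s₃)
  | apply {S : Name → Option Ty} {f : Name} {n : ℕ} {args : Fin n → Expr} {τ : Ty} (hn : 0 < n)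
      (h : ∀ k, HasType S (args k) τ) : HasType S (.apply f n args) τ
  | eigen {S : Name → Option Ty} {e : Expr} {s : SizeTerm} (h : HasType S e (s, s)) :
      HasType S (.eigen e) (s, s)

/-- The pointwise function symbols (name, arity) used in an expression. -/
def Expr.symbols : Expr → Set (Name × ℕ)
  | .var _ => ∅
  | .letIn _ e₁ e₂ => e₁.symbols ∪ e₂.symbols
  | .transp e => e.symbols
  | .ones e => e.symbols
  | .diag e => e.symbols
  | .mul e₁ e₂ => e₁.symbols ∪ e₂.symbols
  | .apply f n args => {(f, n)} ∪ ⋃ k, (args k).symbols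
  | .eigen e => e.symbols

/-! ### Semantics of expressions -/

/-- An interpretation of the pointwise function symbols: the symbol with name `f` and arity `n`
denotes the function `Ω f n : ℂⁿ → ℂ`. -/
abbrev Interp : Type := Name → (n : ℕ) → (Fin n → ℂ) → ℂ

/-- Complex matrices of arbitrary dimensions. -/
structure Mat : Type where
  rows : ℕ
  cols : ℕ
  entries : Matrix (Fin rows) (Fin cols) ℂ

/-- An instance assigns matrices to matrix variables; `I M = none` if `M` is not a variable of the
instance. -/
abbrev Inst : Type := Name → Option Mat

/-- `v` is an eigenvector of `A` for the eigenvalue `μ`. -/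
def IsEigenvector {n : ℕ} (A : Matrix (Fin n) (Fin n) ℂ) (μ : ℂ) (v : Fin n → ℂ) : Prop :=
  Module.End.HasEigenvector (Matrix.toLin' A) μ v

/-- There is a basis of `ℂⁿ` that consists of eigenvectors of `A`. -/
def IsDiagonalizable {n : ℕ} (A : Matrix (Fin n) (Fin n) ℂ) : Prop :=
  ∃ b : Module.Basis (Fin n) ℂ (Fin n → ℂ), ∀ j, ∃ μ, IsEigenvector A μ (b j)

/-- The columns of `B` form a basis of `ℂⁿ` consisting of eigenvectors of `A`, where (distinct)
basis vectors corresponding to the same eigenvalue are orthogonal. -/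
def IsOrthoEigenbasis {n : ℕ} (A B : Matrix (Fin n) (Fin n) ℂ) : Prop :=
  (LinearIndependent ℂ B.col ∧ Submodule.span ℂ (Set.range B.col) = ⊤) ∧
  (∀ j, ∃ μ, IsEigenvector A μ (B.col j)) ∧
  (∀ i j μ, i ≠ j → IsEigenvector A μ (B.col i) → IsEigenvector A μ (B.col j) →
    star (B.col i) ⬝ᵥ B.col j = 0)

/-- `B` is a possible result of `eigen` on `A`. -/
def IsEigenResult {n : ℕ} (A B : Matrix (Fin n) (Fin n) ℂ) : Prop :=
  (IsDiagonalizable A ∧ IsOrthoEigenbasis A B) ∨ (¬ IsDiagonalizable A ∧ B = 0)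

/-- The set `e(I)` of the possible results of the expression `e` on the instance `I`. -/
def Expr.results (Ω : Interp) : Expr → Inst → Set Mat
  | .var M, I => {A | I M = some A}
  | .letIn M e₁ e₂, I => {B | ∃ A ∈ e₁.results Ω I, B ∈ e₂.results Ω (Function.update I M (some A))}
  | .transp e, I => {B | ∃ (m n : ℕ) (A : Matrix (Fin m) (Fin n) ℂ),
      ⟨m, n, A⟩ ∈ e.results Ω I ∧ B = ⟨n, m, A.conjTranspose⟩}
  | .ones e, I => {B | ∃ (m n : ℕ) (A : Matrix (Fin m) (Fin n) ℂ),
      ⟨m, n, A⟩ ∈ e.results Ω I ∧ B = ⟨m, 1, Matrix.of fun _ _ => 1⟩}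
  | .diag e, I => {B | ∃ (m : ℕ) (A : Matrix (Fin m) (Fin 1) ℂ),
      ⟨m, 1, A⟩ ∈ e.results Ω I ∧ B = ⟨m, m, Matrix.diagonal fun i => A i 0⟩}
  | .mul e₁ e₂, I => {C | ∃ (m n p : ℕ) (A : Matrix (Fin m) (Fin n) ℂ)
      (B : Matrix (Fin n) (Fin p) ℂ),
      ⟨m, n, A⟩ ∈ e₁.results Ω I ∧ ⟨n, p, B⟩ ∈ e₂.results Ω I ∧ C = ⟨m, p, A * B⟩}
  | .apply f n args, I => {C | ∃ (m p : ℕ) (A : Fin n → Matrix (Fin m) (Fin p) ℂ),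
      (∀ k, ⟨m, p, A k⟩ ∈ (args k).results Ω I) ∧
      C = ⟨m, p, Matrix.of fun i j => Ω f n fun k => A k i j⟩}
  | .eigen e, I => {C | ∃ (n : ℕ) (A B : Matrix (Fin n) (Fin n) ℂ),
      ⟨n, n, A⟩ ∈ e.results Ω I ∧ IsEigenResult A B ∧ C = ⟨n, n, B⟩}

/-- The value of a size term under an assignment `σ` of sizes to size symbols. -/
def SizeTerm.value (σ : Name → ℕ) : SizeTerm → ℕ
  | .one => 1
  | .sym α => σ α

/-- The instance `I` conforms to the schema `S` by the size assignment `σ`. -/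
def ConformsBy (I : Inst) (S : Name → Option Ty) (σ : Name → ℕ) : Prop :=
  (∀ M, I M = none ↔ S M = none) ∧
  ∀ M τ A, S M = some τ → I M = some A → A.rows = τ.1.value σ ∧ A.cols = τ.2.value σ

/-! ### Existential formulas over the reals -/

/-- Real or imaginary part. -/
inductive Part : Type
  | re : Part
  | im : Part
  deriving DecidableEq

/-- The part of a complex number. -/
def Part.get : Part → ℂ → ℝ
  | .re, z => z.re
  | .im, z => z.im

/-- The real variables.  The `x M i j p` stand for the entries of the input matrices, the `y i j p`
for the entries of the output matrix (rows and columns are numbered from `0`); the `z w i j p` are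
an infinite supply of further variables. -/
inductive RVar : Type
  | x (M : Name) (i j : ℕ) (p : Part) : RVar
  | y (i j : ℕ) (p : Part) : RVar
  | z (w : Name) (i j : ℕ) (p : Part) : RVar
  deriving DecidableEq

/-- Terms over the vocabulary of the reals, expanded with symbols for complex functions.  A function
`f : ℂⁿ → ℂ` gives two function symbols with `2n` real arguments, one for the real and one for the
imaginary part of its value; the arguments are the `n` real parts `a` and the `n` imaginary
parts `b`. -/
inductive RTerm : Type
  | var (v : RVar) : RTerm
  | int (c : ℤ) : RTerm
  | add (t u : RTerm) : RTerm
  | mul (t u : RTerm) : RTerm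
  | fn (f : Name) (p : Part) (n : ℕ) (a b : Fin n → RTerm) : RTerm

/-- Existential first-order formulas over the same vocabulary. -/
inductive ExFormula : Type
  | eq (t u : RTerm) : ExFormula
  | lt (t u : RTerm) : ExFormula
  | or (φ χ : ExFormula) : ExFormula
  | and (φ χ : ExFormula) : ExFormula
  | ex (v : RVar) (φ : ExFormula) : ExFormula

/-- The value of a term under an assignment of real numbers to the variables. -/
def RTerm.value (Ω : Interp) (ρ : RVar → ℝ) : RTerm → ℝ
  | .var v => ρ v
  | .int c => (c : ℝ)
  | .add t u => t.value Ω ρ + u.value Ω ρ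
  | .mul t u => t.value Ω ρ * u.value Ω ρ
  | .fn f p n a b => p.get (Ω f n fun k => ⟨(a k).value Ω ρ, (b k).value Ω ρ⟩)

/-- Truth of a formula over the reals under an assignment. -/
def ExFormula.Holds (Ω : Interp) : ExFormula → (RVar → ℝ) → Prop
  | .eq t u, ρ => t.value Ω ρ = u.value Ω ρ
  | .lt t u, ρ => t.value Ω ρ < u.value Ω ρ
  | .or φ χ, ρ => φ.Holds Ω ρ ∨ χ.Holds Ω ρ
  | .and φ χ, ρ => φ.Holds Ω ρ ∧ χ.Holds Ω ρ
  | .ex v φ, ρ => ∃ r : ℝ, φ.Holds Ω (Function.update ρ v r)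

/-- The variables occurring in a term. -/
def RTerm.vars : RTerm → Set RVar
  | .var v => {v}
  | .int _ => ∅
  | .add t u => t.vars ∪ u.vars
  | .mul t u => t.vars ∪ u.vars
  | .fn _ _ _ a b => ⋃ k, ((a k).vars ∪ (b k).vars)

/-- The free variables of a formula. -/
def ExFormula.freeVars : ExFormula → Set RVar
  | .eq t u => t.vars ∪ u.vars
  | .lt t u => t.vars ∪ u.vars
  | .or φ χ => φ.freeVars ∪ χ.freeVars
  | .and φ χ => φ.freeVars ∪ χ.freeVars
  | .ex v φ => φ.freeVars \ {v}

/-- The complex function symbols (name, arity) that are used in a term. -/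
def RTerm.symbols : RTerm → Set (Name × ℕ)
  | .var _ => ∅
  | .int _ => ∅
  | .add t u => t.symbols ∪ u.symbols
  | .mul t u => t.symbols ∪ u.symbols
  | .fn f _ n a b => {(f, n)} ∪ ⋃ k, ((a k).symbols ∪ (b k).symbols)

/-- The complex function symbols (name, arity) that are used in a formula. -/
def ExFormula.symbols : ExFormula → Set (Name × ℕ)
  | .eq t u => t.symbols ∪ u.symbols
  | .lt t u => t.symbols ∪ u.symbols
  | .or φ χ => φ.symbols ∪ χ.symbols
  | .and φ χ => φ.symbols ∪ χ.symbols
  | .ex _ φ => φ.symbols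

/-! ### Input-sized expressions -/

/-- An input-sized expression.  The schema and the size assignment are finite functions, given by
the lists of their argument-value pairs. -/
structure InputSized : Type where
  schema : List (Name × Ty)
  schema_nodup : (schema.map Prod.fst).Nodup
  schema_ne_nil : schema ≠ []
  expr : Expr
  outType : Ty
  hasType : HasType (fun M => schema.lookup M) expr outType
  sizes : List (Name × ℕ)
  sizes_nodup : (sizes.map Prod.fst).Nodup
  sizes_pos : ∀ q ∈ sizes, 0 < q.2
  sizes_defined : ∀ q ∈ schema, ∀ α, (q.2.1 = .sym α ∨ q.2.2 = .sym α) → α ∈ sizes.map Prod.fst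

namespace InputSized

/-- The schema as a partial function. -/
def schemaFn (E : InputSized) : Name → Option Ty := fun M => E.schema.lookup M

/-- The size assignment as a function; the value `0` is only taken where it is not defined. -/
def size (E : InputSized) : Name → ℕ := fun α => (E.sizes.lookup α).getD 0

/-- The number of rows of the output. -/
def outRows (E : InputSized) : ℕ := E.outType.1.value E.size

/-- The number of columns of the output. -/
def outCols (E : InputSized) : ℕ := E.outType.2.value E.size

/-- The set of variables for the real and imaginary parts of the entries of the input matrices and
of the output matrix. -/
def FV (E : InputSized) : Set RVar :=
  {v | (∃ M τ i j p, E.schemaFn M = some τ ∧ i < τ.1.value E.size ∧ j < τ.2.value E.size ∧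
          v = .x M i j p) ∨
       (∃ i j p, i < E.outRows ∧ j < E.outCols ∧ v = .y i j p)}

/-- The instance that an assignment specifies through the `x`-variables. -/
def instanceOf (E : InputSized) (ρ : RVar → ℝ) : Inst := fun M =>
  (E.schemaFn M).map fun τ => ⟨τ.1.value E.size, τ.2.value E.size,
    Matrix.of fun i j => ⟨ρ (.x M i j .re), ρ (.x M i j .im)⟩⟩

/-- The matrix that an assignment specifies through the `y`-variables. -/
def outputOf (E : InputSized) (ρ : RVar → ℝ) : Mat :=
  ⟨E.outRows, E.outCols, Matrix.of fun i j => ⟨ρ (.y i j .re), ρ (.y i j .im)⟩⟩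

end InputSized

/-! ### Encoding of input-sized expressions by strings

Everything is written in prefix notation.  Sizes are written in unary. -/

/-- The input alphabet. -/
inductive InTok : Type
  | bit (b : Bool) | tick | close | item | one | sym
  | var | letIn | transp | ones | diag | mul | apply | eigen
  deriving DecidableEq, Fintype

def encName (w : Name) : List InTok := w.map InTok.bit ++ [.close]

def encNat (n : ℕ) : List InTok := List.replicate n .tick ++ [.close]

def encSizeTerm : SizeTerm → List InTok
  | .one => [.one]
  | .sym α => .sym :: encName α

def encTy (τ : Ty) : List InTok := encSizeTerm τ.1 ++ encSizeTerm τ.2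

def encSchema : List (Name × Ty) → List InTok
  | [] => [.close]
  | q :: l => .item :: (encName q.1 ++ encTy q.2 ++ encSchema l)

def encSizes : List (Name × ℕ) → List InTok
  | [] => [.close]
  | q :: l => .item :: (encName q.1 ++ encNat q.2 ++ encSizes l)

def encExpr : Expr → List InTok
  | .var M => .var :: encName M
  | .letIn M e₁ e₂ => .letIn :: (encName M ++ encExpr e₁ ++ encExpr e₂)
  | .transp e => .transp :: encExpr e
  | .ones e => .ones :: encExpr e
  | .diag e => .diag :: encExpr e
  | .mul e₁ e₂ => .mul :: (encExpr e₁ ++ encExpr e₂)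
  | .apply f n args =>
      .apply :: (encName f ++ encNat n ++ (List.ofFn fun k => encExpr (args k)).flatten)
  | .eigen e => .eigen :: encExpr e

/-- The string that represents an input-sized expression. -/
def encInput (E : InputSized) : List InTok :=
  encSchema E.schema ++ encSizes E.sizes ++ encExpr E.expr

/-! ### Encoding of formulas by strings

Prefix notation again; integers are written in binary with a sign, the arities and the row and
column numbers in unary. -/

/-- The output alphabet. -/
inductive OutTok : Type
  | bit (b : Bool) | tick | close | re | im | x | y | z
  | var | int | add | mul | fn | eq | lt | or | and | ex
  deriving DecidableEq, Fintype

def outName (w : Name) : List OutTok := w.map OutTok.bit ++ [.close]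

def outNat (n : ℕ) : List OutTok := List.replicate n .tick ++ [.close]

def outInt (c : ℤ) : List OutTok :=
  .bit (decide (c < 0)) :: outName (Computability.encodeNat c.natAbs)

def outPart : Part → OutTok
  | .re => .re
  | .im => .im

def outVar : RVar → List OutTok
  | .x M i j p => .x :: (outName M ++ outNat i ++ outNat j ++ [outPart p])
  | .y i j p => .y :: (outNat i ++ outNat j ++ [outPart p])
  | .z w i j p => .z :: (outName w ++ outNat i ++ outNat j ++ [outPart p])

def outTerm : RTerm → List OutTok
  | .var v => .var :: outVar v
  | .int c => .int :: outInt c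
  | .add t u => .add :: (outTerm t ++ outTerm u)
  | .mul t u => .mul :: (outTerm t ++ outTerm u)
  | .fn f p n a b => .fn :: (outName f ++ [outPart p] ++ outNat n ++
      (List.ofFn fun k => outTerm (a k) ++ outTerm (b k)).flatten)

/-- The string that represents a formula. -/
def encFormula : ExFormula → List OutTok
  | .eq t u => .eq :: (outTerm t ++ outTerm u)
  | .lt t u => .lt :: (outTerm t ++ outTerm u)
  | .or φ χ => .or :: (encFormula φ ++ encFormula χ)
  | .and φ χ => .and :: (encFormula φ ++ encFormula χ)
  | .ex v φ => .ex :: (outVar v ++ encFormula φ)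

/-! ### The encodings are injective -/

theorem HasType.unique {S : Name → Option Ty} {e : Expr} {τ τ' : Ty} (h : HasType S e τ)
    (h' : HasType S e τ') : τ = τ' := by
  induction h generalizing τ' with
  | var h => cases h' with | var h2 => simpa [h] using h2
  | letIn _ _ ih1 ih2 =>
    cases h' with | letIn h3 h4 => obtain rfl := ih1 h3; exact ih2 h4
  | transp _ ih => cases h' with | transp h2 => have := ih h2; simp_all
  | ones _ ih => cases h' with | ones h2 => have := ih h2; simp_all
  | diag _ ih => cases h' with | diag h2 => have := ih h2; simp_all
  | mul _ _ ih1 ih2 =>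
    cases h' with | mul h3 h4 => have := ih1 h3; have := ih2 h4; simp_all
  | apply hn _ ih => cases h' with | apply _ h2 => exact ih ⟨0, hn⟩ (h2 _)
  | eigen _ ih => cases h' with | eigen h2 => have := ih h2; simp_all

theorem flatten_ofFn_inj {α β : Type} (enc : α → List β) {n : ℕ} (a b : Fin n → α)
    (h : ∀ k c r s, enc (a k) ++ r = enc c ++ s → a k = c ∧ r = s) {r s : List β}
    (heq : (List.ofFn fun k => enc (a k)).flatten ++ r = (List.ofFn fun k => enc (b k)).flatten ++ s) :
    a = b ∧ r = s := by
  induction n with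
  | zero => exact ⟨funext fun k => k.elim0, by simpa using heq⟩
  | succ n ih =>
    simp only [List.ofFn_succ, List.flatten_cons, List.append_assoc] at heq
    obtain ⟨h0, h1⟩ := h 0 _ _ _ heq
    obtain ⟨h2, h3⟩ := ih (fun k => a k.succ) (fun k => b k.succ) (fun k => h k.succ) h1
    refine ⟨funext fun k => ?_, h3⟩
    refine Fin.cases h0 (fun k => congrFun h2 k) k

theorem encName_inj {w w' : Name} {r s : List InTok} (h : encName w ++ r = encName w' ++ s) :
    w = w' ∧ r = s := by
  induction w generalizing w' with
  | nil => cases w' <;> simp_all [encName]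
  | cons b w ih =>
    cases w' with
    | nil => simp [encName] at h
    | cons b' w' =>
      simp only [encName, List.map_cons, List.cons_append, List.cons.injEq, InTok.bit.injEq] at h
      obtain ⟨rfl, h⟩ := h
      simpa using ih h

theorem encNat_inj {m n : ℕ} {r s : List InTok} (h : encNat m ++ r = encNat n ++ s) :
    m = n ∧ r = s := by
  induction m generalizing n with
  | zero => cases n <;> simp_all [encNat, List.replicate_succ]
  | succ m ih =>
    cases n with
    | zero => simp [encNat, List.replicate_succ] at h
    | succ n =>
      simp only [encNat, List.replicate_succ, List.cons_append, List.cons.injEq, true_and] at h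
      simpa using ih h

theorem encSizeTerm_inj {a b : SizeTerm} {r s : List InTok}
    (h : encSizeTerm a ++ r = encSizeTerm b ++ s) : a = b ∧ r = s := by
  cases a <;> cases b <;> simp [encSizeTerm] at h ⊢
  · exact h
  · exact encName_inj h

theorem encTy_inj {a b : Ty} {r s : List InTok} (h : encTy a ++ r = encTy b ++ s) :
    a = b ∧ r = s := by
  simp only [encTy, List.append_assoc] at h
  replace h := encSizeTerm_inj h
  obtain ⟨h1, h⟩ := h
  replace h := encSizeTerm_inj h
  obtain ⟨h2, h⟩ := h
  exact ⟨Prod.ext h1 h2, h⟩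

theorem encSchema_inj {a b : List (Name × Ty)} {r s : List InTok}
    (h : encSchema a ++ r = encSchema b ++ s) : a = b ∧ r = s := by
  induction a generalizing b with
  | nil => cases b <;> simp_all [encSchema]
  | cons q a ih =>
    cases b with
    | nil => simp [encSchema] at h
    | cons q' b =>
      simp only [encSchema, List.cons_append, List.append_assoc, List.cons.injEq, true_and] at h
      replace h := encName_inj h
      obtain ⟨h1, h⟩ := h
      replace h := encTy_inj h
      obtain ⟨h2, h⟩ := h
      replace h := ih h
      obtain ⟨rfl, h⟩ := h
      exact ⟨by rw [Prod.ext h1 h2], h⟩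

theorem encSizes_inj {a b : List (Name × ℕ)} {r s : List InTok}
    (h : encSizes a ++ r = encSizes b ++ s) : a = b ∧ r = s := by
  induction a generalizing b with
  | nil => cases b <;> simp_all [encSizes]
  | cons q a ih =>
    cases b with
    | nil => simp [encSizes] at h
    | cons q' b =>
      simp only [encSizes, List.cons_append, List.append_assoc, List.cons.injEq, true_and] at h
      replace h := encName_inj h
      obtain ⟨h1, h⟩ := h
      replace h := encNat_inj h
      obtain ⟨h2, h⟩ := h
      replace h := ih h
      obtain ⟨rfl, h⟩ := h
      exact ⟨by rw [Prod.ext h1 h2], h⟩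

theorem encExpr_inj {a b : Expr} {r s : List InTok} (h : encExpr a ++ r = encExpr b ++ s) :
    a = b ∧ r = s := by
  induction a generalizing b r s with
  | var M =>
    cases b <;> simp [encExpr] at h ⊢
    exact encName_inj h
  | letIn M e₁ e₂ ih₁ ih₂ =>
    cases b <;> simp [encExpr] at h ⊢
    replace h := encName_inj h
    obtain ⟨rfl, h⟩ := h
    replace h := ih₁ h
    obtain ⟨rfl, h⟩ := h
    replace h := ih₂ h
    obtain ⟨rfl, h⟩ := h
    simp [h]
  | transp e ih => cases b <;> simp [encExpr] at h ⊢; exact ih h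
  | ones e ih => cases b <;> simp [encExpr] at h ⊢; exact ih h
  | diag e ih => cases b <;> simp [encExpr] at h ⊢; exact ih h
  | mul e₁ e₂ ih₁ ih₂ =>
    cases b <;> simp [encExpr] at h ⊢
    replace h := ih₁ h
    obtain ⟨rfl, h⟩ := h
    replace h := ih₂ h
    obtain ⟨rfl, h⟩ := h
    simp [h]
  | apply f n args ih =>
    cases b <;> simp only [encExpr, List.cons_append, List.append_assoc, List.cons.injEq,
      true_and, reduceCtorEq, false_and] at h
    replace h := encName_inj h
    obtain ⟨rfl, h⟩ := h
    replace h := encNat_inj h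
    obtain ⟨rfl, h⟩ := h
    replace h := flatten_ofFn_inj encExpr args _ (fun k _ _ _ h => ih k h) h
    obtain ⟨rfl, h⟩ := h
    exact ⟨rfl, h⟩
  | eigen e ih => cases b <;> simp [encExpr] at h ⊢; exact ih h

theorem encInput_injective : Function.Injective encInput := by
  intro E E' h
  simp only [encInput, List.append_assoc] at h
  replace h := encSchema_inj h
  obtain ⟨h1, h⟩ := h
  replace h := encSizes_inj h
  obtain ⟨h2, h⟩ := h
  obtain ⟨h3, -⟩ := encExpr_inj (r := []) (s := []) (by simpa using h)
  cases E with | mk S _ _ e τ ht z _ _ _ =>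
  cases E' with | mk S' _ _ e' τ' ht' z' _ _ _ =>
  obtain rfl : S = S' := h1
  obtain rfl : z = z' := h2
  obtain rfl : e = e' := h3
  obtain rfl := ht.unique ht'
  rfl

theorem outName_inj {w w' : Name} {r s : List OutTok} (h : outName w ++ r = outName w' ++ s) :
    w = w' ∧ r = s := by
  induction w generalizing w' with
  | nil => cases w' <;> simp_all [outName]
  | cons b w ih =>
    cases w' with
    | nil => simp [outName] at h
    | cons b' w' =>
      simp only [outName, List.map_cons, List.cons_append, List.cons.injEq, OutTok.bit.injEq] at h
      obtain ⟨rfl, h⟩ := h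
      simpa using ih h

theorem outNat_inj {m n : ℕ} {r s : List OutTok} (h : outNat m ++ r = outNat n ++ s) :
    m = n ∧ r = s := by
  induction m generalizing n with
  | zero => cases n <;> simp_all [outNat, List.replicate_succ]
  | succ m ih =>
    cases n with
    | zero => simp [outNat, List.replicate_succ] at h
    | succ n =>
      simp only [outNat, List.replicate_succ, List.cons_append, List.cons.injEq, true_and] at h
      simpa using ih h

theorem outInt_inj {c d : ℤ} {r s : List OutTok} (h : outInt c ++ r = outInt d ++ s) :
    c = d ∧ r = s := by
  simp only [outInt, List.cons_append, List.cons.injEq, OutTok.bit.injEq, decide_eq_decide] at h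
  obtain ⟨h0, h⟩ := h
  replace h := outName_inj h
  obtain ⟨h1, h⟩ := h
  have h2 := congrArg Computability.decodeNat h1
  simp only [Computability.decode_encodeNat] at h2
  exact ⟨by omega, h⟩

theorem outPart_inj {p q : Part} (h : outPart p = outPart q) : p = q := by
  cases p <;> cases q <;> simp_all [outPart]

theorem outVar_inj {a b : RVar} {r s : List OutTok} (h : outVar a ++ r = outVar b ++ s) :
    a = b ∧ r = s := by
  cases a <;> cases b <;> simp only [outVar, List.cons_append, List.append_assoc, List.cons.injEq,
      true_and, reduceCtorEq, false_and, List.nil_append] at h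
  · replace h := outName_inj h
    obtain ⟨rfl, h⟩ := h
    replace h := outNat_inj h
    obtain ⟨rfl, h⟩ := h
    replace h := outNat_inj h
    obtain ⟨rfl, h⟩ := h
    simp only [List.cons.injEq] at h
    obtain rfl := outPart_inj h.1
    exact ⟨rfl, h.2⟩
  · replace h := outNat_inj h
    obtain ⟨rfl, h⟩ := h
    replace h := outNat_inj h
    obtain ⟨rfl, h⟩ := h
    simp only [List.cons.injEq] at h
    obtain rfl := outPart_inj h.1
    exact ⟨rfl, h.2⟩
  · replace h := outName_inj h
    obtain ⟨rfl, h⟩ := h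
    replace h := outNat_inj h
    obtain ⟨rfl, h⟩ := h
    replace h := outNat_inj h
    obtain ⟨rfl, h⟩ := h
    simp only [List.cons.injEq] at h
    obtain rfl := outPart_inj h.1
    exact ⟨rfl, h.2⟩

theorem outTerm_inj {a b : RTerm} {r s : List OutTok} (h : outTerm a ++ r = outTerm b ++ s) :
    a = b ∧ r = s := by
  induction a generalizing b r s with
  | var v => cases b <;> simp [outTerm] at h ⊢; exact outVar_inj h
  | int c => cases b <;> simp [outTerm] at h ⊢; exact outInt_inj h
  | add t u ih₁ ih₂ =>
    cases b <;> simp [outTerm] at h ⊢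
    replace h := ih₁ h
    obtain ⟨rfl, h⟩ := h
    replace h := ih₂ h
    obtain ⟨rfl, h⟩ := h
    simp [h]
  | mul t u ih₁ ih₂ =>
    cases b <;> simp [outTerm] at h ⊢
    replace h := ih₁ h
    obtain ⟨rfl, h⟩ := h
    replace h := ih₂ h
    obtain ⟨rfl, h⟩ := h
    simp [h]
  | fn f p n a₁ a₂ ih₁ ih₂ =>
    cases b with
    | fn f' p' n' b₁ b₂ =>
      simp only [outTerm, List.cons_append, List.append_assoc, List.cons.injEq,
        true_and, List.nil_append] at h
      replace h := outName_inj h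
      obtain ⟨rfl, h⟩ := h
      simp only [List.cons.injEq] at h
      obtain ⟨hp, h⟩ := h
      obtain rfl := outPart_inj hp
      replace h := outNat_inj h
      obtain ⟨rfl, h⟩ := h
      obtain ⟨h1, h5⟩ := flatten_ofFn_inj (fun q : RTerm × RTerm => outTerm q.1 ++ outTerm q.2)
        (fun k => (a₁ k, a₂ k)) (fun k => (b₁ k, b₂ k)) (by
          intro k c r s h
          simp only [List.append_assoc] at h
          replace h := ih₁ k h
          obtain ⟨h1, h⟩ := h
          replace h := ih₂ k h
          obtain ⟨h2, h⟩ := h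
          exact ⟨Prod.ext h1 h2, h⟩) h
      have h3 : a₁ = b₁ := funext fun k => congrArg Prod.fst (congrFun h1 k)
      have h4 : a₂ = b₂ := funext fun k => congrArg Prod.snd (congrFun h1 k)
      subst h3 h4
      exact ⟨rfl, h5⟩
    | _ => simp [outTerm] at h

theorem encFormula_inj {a b : ExFormula} {r s : List OutTok}
    (h : encFormula a ++ r = encFormula b ++ s) : a = b ∧ r = s := by
  induction a generalizing b r s with
  | eq t u =>
    cases b <;> simp [encFormula] at h ⊢
    replace h := outTerm_inj h
    obtain ⟨rfl, h⟩ := h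
    replace h := outTerm_inj h
    obtain ⟨rfl, h⟩ := h
    simp [h]
  | lt t u =>
    cases b <;> simp [encFormula] at h ⊢
    replace h := outTerm_inj h
    obtain ⟨rfl, h⟩ := h
    replace h := outTerm_inj h
    obtain ⟨rfl, h⟩ := h
    simp [h]
  | or φ χ ih₁ ih₂ =>
    cases b <;> simp [encFormula] at h ⊢
    replace h := ih₁ h
    obtain ⟨rfl, h⟩ := h
    replace h := ih₂ h
    obtain ⟨rfl, h⟩ := h
    simp [h]
  | and φ χ ih₁ ih₂ =>
    cases b <;> simp [encFormula] at h ⊢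
    replace h := ih₁ h
    obtain ⟨rfl, h⟩ := h
    replace h := ih₂ h
    obtain ⟨rfl, h⟩ := h
    simp [h]
  | ex v φ ih =>
    cases b <;> simp [encFormula] at h ⊢
    replace h := outVar_inj h
    obtain ⟨rfl, h⟩ := h
    replace h := ih h
    obtain ⟨rfl, h⟩ := h
    simp [h]

theorem encFormula_injective : Function.Injective encFormula := fun a b h =>
  (encFormula_inj (r := []) (s := []) (by simpa using h)).1

end Matlang

set_option linter.constructorNameAsVariable false

/-! ### A structured programming language over finitely many stacks -/

namespace Matlang

/-! The formula is built by recursion on the expression. An r × c complex matrix is represented by a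
block of 2rc real variables, and `trans env e` says that the block `outBlk` is a possible result of
e when the blocks `varBlk M` hold the values of the variables in scope. The choice of a result of a
subexpression becomes an existential quantifier over a block, and each operation becomes a
conjunction of equations between entries. Before a subformula is used, `wrap` binds its result block
and identifies it with an argument block. Hence the same few names serve at every depth, each
subformula occurs once, and each operator adds a text polynomial in the dimensions, which are given
in unary.

Only `eigen` needs mathematics, because formulas have no negation. A matrix B is a basis as required
iff AB = B·diag(λ) for some λ, B has a right inverse, and any two columns either have distinct λ's
or are orthogonal (`isOrthoEigenbasis_iff`). That A is not diagonalizable has a positive witness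
too: a scalar λ and vectors v and w ≠ 0 with Av = λv + w and Aw = λw (`not_isDiagonalizable_iff`).
Without such a witness every generalized eigenspace over ℂ is an eigenspace, and the generalized
eigenspaces span. With these facts `means_trans` is a direct induction on the typing derivation, and
`holds_translation` adds the equations that tie the input blocks to the x-variables and the result
block to the y-variables.

For computability, the formula is written from right to left on an output stack. In prefix notation,
a formula whose last subformulas already lie on the stack is completed by putting a prefix in front
of them; all formulas are shaped with this in mind. Each prefix is a concatenation of strings under
at most three nested index loops; such strings are described by `Gen`, and `Gen.exec_prog` gives a
program for them whose time is bounded by the polynomial `Gen.cost`. The recursion over the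
expression is replaced by a stack of pending tasks: `reach_translation` shows that their number is
linear in the length of the expression and that each takes at most `stepCost` steps. Finally, a
structured program has only finitely many continuations, so these can be the control states of a
Turing machine with stacks (`nonempty_tm2ComputableInPolyTime`). -/

/-- The work stacks of the translator. -/
inductive Stk : Type
  | out | src | spare | kont | env | back | tmp | name | name2 | row | col | row2 | col2 | mid
  | arg | fn | num | flag | ix | jx | kx
  deriving DecidableEq

instance : Fintype Stk :=
  .ofList [.out, .src, .spare, .kont, .env, .back, .tmp, .name, .name2, .row, .col, .row2, .col2,
    .mid, .arg, .fn, .num, .flag, .ix, .jx, .kx] fun x => by cases x <;> decide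

/-- The contents of the work stacks. -/
abbrev Store : Type := Stk → List OutTok

/-- Structured programs over the work stacks.  Both `case` and `loop` pop a symbol and act on the
symbol that was popped. -/
inductive Prog : Type
  | skip : Prog
  | push (k : Stk) (a : OutTok) : Prog
  | seq (p q : Prog) : Prog
  | case (k : Stk) (f : Option OutTok → Prog) : Prog
  | loop (k : Stk) (g : Option OutTok → Bool) (f : Option OutTok → Prog) : Prog

namespace Prog

/-- The continuation after one step, where `a` is the symbol that is popped, if any. -/
def next : List Prog → Option OutTok → List Prog
  | [], _ => []
  | skip :: c, _ => c
  | push _ _ :: c, _ => c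
  | seq p q :: c, _ => p :: q :: c
  | case _ f :: c, a => f a :: c
  | loop k g f :: c, a => if g a then f a :: loop k g f :: c else c

/-- One step of execution, on a list of programs that remain to be run. -/
def step : List Prog × Store → List Prog × Store
  | (push k a :: c, s) => (c, Function.update s k (a :: s k))
  | (case k f :: c, s) => (next (case k f :: c) (s k).head?, Function.update s k (s k).tail)
  | (loop k g f :: c, s) => (next (loop k g f :: c) (s k).head?, Function.update s k (s k).tail)
  | (c, s) => (next c none, s)

/-- The continuations that occur while `p` is run with continuation `c`. -/
def conts : Prog → List Prog → Set (List Prog)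
  | skip, c => {skip :: c}
  | push k a, c => {push k a :: c}
  | seq p q, c => insert (seq p q :: c) (p.conts (q :: c) ∪ q.conts c)
  | case k f, c => insert (case k f :: c) (⋃ a, (f a).conts c)
  | loop k g f, c => insert (loop k g f :: c) (⋃ a, (f a).conts (loop k g f :: c))

/-- The branches of `case` and `loop` are indexed by the finite type of popped symbols, and the body
of a loop continues with the loop itself instead of an unfolding of it. This is what makes the set
of control states finite. -/
theorem conts_finite (p : Prog) (c : List Prog) : (p.conts c).Finite := by
  induction p generalizing c with
  | skip => exact Set.finite_singleton _
  | push k a => exact Set.finite_singleton _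
  | seq p q ihp ihq => exact ((ihp _).union (ihq _)).insert _
  | case k f ih => exact (Set.finite_iUnion fun a => ih a _).insert _
  | loop k g f ih => exact (Set.finite_iUnion fun a => ih a _).insert _

theorem self_mem_conts (p : Prog) (c : List Prog) : p :: c ∈ p.conts c := by
  cases p <;> simp [conts]

/-- Closure of the control points under transitions. The exit to `c` is the only way to leave the
set, which for c = [] is the halting point. -/
theorem next_mem_conts (p : Prog) (c l : List Prog) (a : Option OutTok) (h : l ∈ p.conts c) :
    next l a ∈ insert c (p.conts c) := by
  induction p generalizing c l with
  | skip => obtain rfl := h; simp [next]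
  | push k b => obtain rfl := h; simp [next]
  | seq p q ihp ihq =>
    obtain rfl | h | h := h
    · exact .inr (.inr (.inl (self_mem_conts _ _)))
    · obtain h | h := ihp _ _ h
      · rw [h]; exact .inr (.inr (.inr (self_mem_conts _ _)))
      · exact .inr (.inr (.inl h))
    · obtain h | h := ihq _ _ h
      · exact .inl h
      · exact .inr (.inr (.inr h))
  | case k f ih =>
    obtain rfl | h := h
    · exact .inr (.inr (Set.mem_iUnion.2 ⟨a, self_mem_conts _ _⟩))
    · obtain ⟨b, h⟩ := Set.mem_iUnion.1 h
      obtain h | h := ih b _ _ h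
      · exact .inl h
      · exact .inr (.inr (Set.mem_iUnion.2 ⟨b, h⟩))
  | loop k g f ih =>
    obtain rfl | h := h
    · simp only [next]
      split
      · exact .inr (.inr (Set.mem_iUnion.2 ⟨a, self_mem_conts _ _⟩))
      · exact .inl rfl
    · obtain ⟨b, h⟩ := Set.mem_iUnion.1 h
      obtain h | h := ih b _ _ h
      · rw [h]; exact .inr (.inl rfl)
      · exact .inr (.inr (Set.mem_iUnion.2 ⟨b, h⟩))

/-! ### Realization of programs by stack machines -/

/-- The control points of the machine that realizes `p`. -/
def Label (p : Prog) : Type := {l : List Prog // l ∈ insert [] (p.conts [])}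

noncomputable instance (p : Prog) : Fintype (Label p) :=
  ((p.conts_finite []).insert []).fintype

def Label.next {p : Prog} (l : Label p) (a : Option OutTok) : Label p :=
  ⟨Prog.next l.1 a, by
    obtain ⟨l, rfl | h⟩ := l
    · exact .inl rfl
    · exact next_mem_conts _ _ _ _ h⟩

/-- The alphabets of the stacks of the machine: the stack `none` holds the input. -/
abbrev Alphabet : Option Stk → Type
  | none => InTok
  | some _ => OutTok

/-- The instruction at a control point. -/
def instr {p : Prog} (l : Label p) :
    Turing.TM2.Stmt Alphabet (Option (Label p)) (Option OutTok) :=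
  match l.1 with
  | [] => .load (fun _ => none) .halt
  | push k a :: _ => .push (some k) (fun _ => a) (.goto fun _ => some (l.next none))
  | case k _ :: _ => .pop (some k) (fun _ a => a) (.goto fun v => some (l.next v))
  | loop k _ _ :: _ => .pop (some k) (fun _ a => a) (.goto fun v => some (l.next v))
  | _ => .goto fun _ => some (l.next none)

/-- The machine that moves its input, translated by `conv`, to the stack `src` (which reverses it)
and then runs `p`. -/
noncomputable def machine (conv : InTok → OutTok) (p : Prog) : Turing.FinTM2 where
  K := Option Stk
  k₀ := none
  k₁ := some .out
  Γ := Alphabet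
  Λ := Option (Label p)
  main := none
  σ := Option OutTok
  initialState := none
  Γk₀Fin := inferInstanceAs (Fintype InTok)
  m := fun l => l.elim
    (.pop none (fun _ a => a.map conv) (.branch Option.isSome
      (.push (some .src) (fun v => v.getD .close) (.goto fun _ => none))
      (.goto fun _ => some ⟨[p], .inr (self_mem_conts _ _)⟩)))
    instr

/-- The stacks of the machine with input `x` and work stacks `s`. -/
def contents (x : List InTok) (s : Store) : ∀ k : Option Stk, List (Alphabet k)
  | none => x
  | some k => s k

theorem update_contents_some (x : List InTok) (s : Store) (k : Stk) (l : List OutTok) :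
    Function.update (contents x s) (some k) l = contents x (Function.update s k l) := by
  funext k'
  cases k' with
  | none => rfl
  | some k' =>
    by_cases h : k' = k
    · subst h; simp [contents]
    · rw [Function.update_of_ne (by simpa using h)]
      simp [contents, h]

theorem update_contents_none (x y : List InTok) (s : Store) :
    Function.update (contents x s) none y = contents y s := by
  funext k'
  cases k' with
  | none => simp [contents]
  | some k' => rw [Function.update_of_ne (by simp)]; rfl

/-- One program step is exactly one machine step, because a single statement of the machine both
pops a symbol into the internal state and jumps depending on it. -/
theorem machine_step (conv : InTok → OutTok) (p : Prog) (l : Label p) (hl : l.1 ≠ [])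
    (v : Option OutTok) (s : Store) :
    ∃ (l' : Label p) (v' : Option OutTok),
      (machine conv p).step ⟨some (some l), v, contents [] s⟩ =
        some ⟨some (some l'), v', contents [] (step (l.1, s)).2⟩ ∧ l'.1 = (step (l.1, s)).1 := by
  obtain ⟨l, h⟩ := l
  match l, h, hl with
  | skip :: c, h, _ => exact ⟨_, _, rfl, rfl⟩
  | seq p q :: c, h, _ => exact ⟨_, _, rfl, rfl⟩
  | push k a :: c, h, _ =>
    refine ⟨Label.next ⟨_, h⟩ none, v, ?_, rfl⟩
    change some _ = some _
    simp only [step, ← update_contents_some]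
    rfl
  | case k f :: c, h, _ =>
    refine ⟨Label.next ⟨_, h⟩ (s k).head?, (s k).head?, ?_, rfl⟩
    change some _ = some _
    simp only [step, ← update_contents_some]
    rfl
  | loop k g f :: c, h, _ =>
    refine ⟨Label.next ⟨_, h⟩ (s k).head?, (s k).head?, ?_, rfl⟩
    change some _ = some _
    simp only [step, ← update_contents_some]
    rfl

theorem step_nil (t : ℕ) (s : Store) : step^[t] ([], s) = ([], s) := by
  induction t with
  | zero => rfl
  | succ t ih => rw [Function.iterate_succ_apply]; exact ih

/-- `step` idles at the empty continuation, whereas a halted machine has no successor; hence the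
exact number t' of useful steps has to be found below t. The additional step executes the halting
instruction, which also resets the internal state, as the prescribed final configuration carries the
initial one. -/
theorem machine_run (conv : InTok → OutTok) (p : Prog) (t : ℕ) (l : Label p)
    (v : Option OutTok) (s s' : Store) (h : step^[t] (l.1, s) = ([], s')) :
    ∃ t' ≤ t, (flip bind (machine conv p).step)^[t' + 1]
      (some ⟨some (some l), v, contents [] s⟩) = some ⟨none, none, contents [] s'⟩ := by
  induction t generalizing l v s with
  | zero =>
    refine ⟨0, le_rfl, ?_⟩
    obtain ⟨l, hl⟩ := l
    simp only [Function.iterate_zero, id, Prod.mk.injEq] at h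
    obtain ⟨rfl, rfl⟩ := h
    rfl
  | succ t ih =>
    by_cases hl : l.1 = []
    · refine ⟨0, by omega, ?_⟩
      obtain ⟨l, hl'⟩ := l
      obtain rfl : l = [] := hl
      rw [step_nil] at h
      obtain rfl : s = s' := congrArg Prod.snd h
      rfl
    · obtain ⟨l', v', h1, h2⟩ := machine_step conv p l hl v s
      rw [Function.iterate_succ_apply] at h
      obtain ⟨t', ht, h3⟩ := ih l' v' (step (l.1, s)).2 (by rw [h2]; exact h)
      refine ⟨t' + 1, by omega, ?_⟩
      rw [Function.iterate_succ_apply]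
      have h4 : flip bind (machine conv p).step (some ⟨some (some l), v, contents [] s⟩) =
        some ⟨some (some l'), v', contents [] (step (l.1, s)).2⟩ := h1
      rw [h4]
      exact h3

/-- One step per input symbol, and one that finds the input exhausted. Passing from stack to stack
reverses the input. -/
theorem machine_load (conv : InTok → OutTok) (p : Prog) (x : List InTok)
    (v : Option OutTok) (s : Store) :
    (flip bind (machine conv p).step)^[x.length + 1] (some ⟨some none, v, contents x s⟩) =
      some ⟨some (some ⟨[p], .inr (self_mem_conts _ _)⟩), none,
        contents [] (Function.update s .src ((x.map conv).reverse ++ s .src))⟩ := by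
  induction x generalizing v s with
  | nil =>
    simp only [List.map_nil, List.reverse_nil, List.nil_append, Function.update_eq_self]
    have h := congrArg (fun S => some (some (Turing.TM2.Cfg.mk
      (some (some (⟨[p], .inr (self_mem_conts _ _)⟩ : Label p))) (none : Option OutTok) S)))
      (update_contents_none [] [] s)
    exact Option.some_injective _ h
  | cons a x ih =>
    rw [List.length_cons, Function.iterate_succ_apply]
    have h : flip bind (machine conv p).step (some ⟨some none, v, contents (a :: x) s⟩) =
        some ⟨some none, some (conv a),
          contents x (Function.update s .src (conv a :: s .src))⟩ := by
      rw [← update_contents_some, ← update_contents_none (a :: x) x s]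
      rfl
    rw [h, ih]
    simp

/-- A function that is computed by a program in polynomial time is computed by a Turing machine in
polynomial time. -/
theorem nonempty_tm2ComputableInPolyTime {α β : Type} {ea : α → List InTok}
    {eb : β → List OutTok} {f : α → β} (conv : InTok → OutTok) (p : Prog) (b : Polynomial ℕ)
    (h : ∀ a, ∃ t ≤ b.eval (ea a).length,
      step^[t] ([p], Function.update (fun _ => []) .src ((ea a).map conv).reverse) =
        ([], Function.update (fun _ => []) .out (eb (f a)))) :
    Nonempty (Turing.TM2ComputableInPolyTime ea eb f) := by
  -- Loading takes one step more than the input length, and running takes at most b steps and one to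
  -- halt.
  refine ⟨⟨⟨machine conv p, Equiv.refl _, Equiv.refl _⟩, b + Polynomial.X + 2, fun a => ?_⟩⟩
  refine Classical.choice ?_
  obtain ⟨t, ht, h1⟩ := h a
  obtain ⟨t', ht', h2⟩ := machine_run conv p t ⟨[p], .inr (self_mem_conts _ _)⟩ none _ _ h1
  refine ⟨⟨⟨(t' + 1) + ((ea a).length + 1), ?_⟩, ?_⟩⟩
  · have h3 := machine_load conv p (ea a) none (fun _ => [])
    have h4 : Turing.initList (machine conv p) ((ea a).map (Equiv.refl _).invFun) =
        ⟨some none, none, contents (ea a) fun _ => []⟩ := by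
      simp only [Turing.initList]
      congr 1
      funext k
      cases k with
      | none => simp [machine, contents]; rfl
      | some k => simp [machine, contents]
    have h5 : Turing.haltList (machine conv p) ((eb (f a)).map (Equiv.refl _).invFun) =
        ⟨none, none, contents [] (Function.update (fun _ => []) .out (eb (f a)))⟩ := by
      simp only [Turing.haltList]
      congr 1
      funext k
      cases k with
      | none => simp [machine, contents]
      | some k =>
        by_cases hk : k = .out
        · subst hk; simp [machine, contents]; rfl
        · simp [machine, contents, hk]
    rw [Function.iterate_add_apply]
    simp only [Option.map_some]
    erw [h4, h5, h3]
    simpa using h2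
  · simp only [Polynomial.eval_add, Polynomial.eval_X, Polynomial.eval_ofNat]
    omega

end Prog

/-! ### Execution of programs with time bounds -/

namespace Prog

/-- Execution leads from the configuration `a` to the configuration `b` in at most `T` steps. -/
def Reach (a b : List Prog × Store) (T : ℕ) : Prop := ∃ t ≤ T, step^[t] a = b

theorem Reach.refl (a : List Prog × Store) (T : ℕ) : Reach a a T := ⟨0, Nat.zero_le _, rfl⟩

theorem Reach.trans {a b c : List Prog × Store} {T U : ℕ} (h : Reach a b T) (h' : Reach b c U) :
    Reach a c (T + U) := by
  obtain ⟨t, ht, rfl⟩ := h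
  obtain ⟨u, hu, rfl⟩ := h'
  exact ⟨u + t, by omega, Function.iterate_add_apply _ _ _ _⟩

theorem Reach.mono {a b : List Prog × Store} {T U : ℕ} (h : Reach a b T) (hT : T ≤ U) :
    Reach a b U := by
  obtain ⟨t, ht, h⟩ := h
  exact ⟨t, ht.trans hT, h⟩

theorem Reach.head {a b : List Prog × Store} {T : ℕ} (h : Reach (step a) b T) :
    Reach a b (T + 1) := by
  obtain ⟨t, ht, h⟩ := h
  exact ⟨t + 1, by omega, by rwa [Function.iterate_succ_apply]⟩

/-- The program `p` leads from the store `s` to the store `s'` in at most `T` steps. -/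
def Exec (p : Prog) (s s' : Store) (T : ℕ) : Prop := ∀ c, Reach (p :: c, s) (c, s') T

theorem Exec.mono {p : Prog} {s s' : Store} {T U : ℕ} (h : Exec p s s' T) (hT : T ≤ U) :
    Exec p s s' U := fun c => (h c).mono hT

theorem Exec.of_eq {p : Prog} {s s' s'' : Store} {T U : ℕ} (h : Exec p s s' T) (hs : s' = s'')
    (hT : T ≤ U) : Exec p s s'' U := hs ▸ h.mono hT

theorem exec_skip (s : Store) : Exec skip s s 1 := fun _ => .head (.refl _ 0)

theorem exec_push (k : Stk) (a : OutTok) (s : Store) :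
    Exec (push k a) s (Function.update s k (a :: s k)) 1 := fun _ => .head (.refl _ 0)

theorem Exec.seq {p q : Prog} {s s' s'' : Store} {T U : ℕ} (h : Exec p s s' T)
    (h' : Exec q s' s'' U) : Exec (.seq p q) s s'' (T + U + 1) := fun c =>
  .head ((h (q :: c)).trans (h' c))

theorem Exec.case {k : Stk} {f : Option OutTok → Prog} {s s' : Store} {T : ℕ}
    (h : Exec (f (s k).head?) (Function.update s k (s k).tail) s' T) :
    Exec (.case k f) s s' (T + 1) := fun c => .head (h c)

/-- The symbol on which the loop stops is consumed as well. Thus reading a field removes its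
terminating `close`, and a loop over the entries of a list removes the end marker of the list. -/
theorem Exec.loop_stop {k : Stk} {g : Option OutTok → Bool} {f : Option OutTok → Prog} {s : Store}
    (h : g (s k).head? = false) : Exec (.loop k g f) s (Function.update s k (s k).tail) 1 := by
  refine fun c => .head ?_
  simp only [step, next, h]
  exact .refl _ 0

/-- A single round that comes back to the same loop. It serves for the loop over pending tasks,
where the treatment of one subexpression is a segment of rounds and not a program that ends. -/
theorem reach_loop_step {k : Stk} {g : Option OutTok → Bool} {f : Option OutTok → Prog}
    {s s' : Store} {T : ℕ} {c : List Prog} (hg : g (s k).head? = true)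
    (h : Exec (f (s k).head?) (Function.update s k (s k).tail) s' T) :
    Reach (.loop k g f :: c, s) (.loop k g f :: c, s') (T + 1) := by
  refine .head ?_
  simp only [step, next, hg]
  exact h _

theorem Exec.loop_step {k : Stk} {g : Option OutTok → Bool} {f : Option OutTok → Prog}
    {s s' s'' : Store} {T U : ℕ} (hg : g (s k).head? = true)
    (h : Exec (f (s k).head?) (Function.update s k (s k).tail) s' T)
    (h' : Exec (.loop k g f) s' s'' U) : Exec (.loop k g f) s s'' (T + U + 1) := fun c =>
  ((reach_loop_step hg h).trans (h' c)).mono (by omega)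

/-! ### Elementary programs -/

/-- A sequence of programs. -/
def block : List Prog → Prog
  | [] => skip
  | [p] => p
  | p :: l => seq p (block l)

/-- Push the popped symbol, if any. -/
def pushOpt (k : Stk) : Option OutTok → Prog
  | none => skip
  | some a => push k a

/-- Move all of the stack `a` to `b`, which reverses it. -/
def move (a b : Stk) : Prog := loop a Option.isSome (pushOpt b)

/-- Append the stack `a`, with `f` applied to each symbol, to the top of `b`. -/
def copy (a b : Stk) (f : OutTok → OutTok) : Prog :=
  seq (move a .tmp) (loop .tmp Option.isSome fun
    | none => skip
    | some x => seq (push a x) (push b (f x)))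

/-- Empty a stack. -/
def clear (a : Stk) : Prog := loop a Option.isSome fun _ => skip

/-- Whether a popped symbol lies before the next `close`. -/
def inField (a : Option OutTok) : Bool := a.isSome && a != some .close

/-- Move the symbols of `a` before the first `close` to `b`, and remove the `close`. -/
def moveField (a b : Stk) : Prog := loop a inField (pushOpt b)

theorem exec_move {a b : Stk} (hab : a ≠ b) (s : Store) :
    Exec (move a b) s (Function.update (Function.update s a []) b ((s a).reverse ++ s b))
      (2 * (s a).length + 1) := by
  generalize hl : s a = l
  induction l generalizing s with
  | nil =>
    refine (Exec.loop_stop (by simp [hl])).of_eq ?_ (by simp)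
    funext k
    by_cases hk : k = b
    · subst hk; simp [hab.symm]
    · simp [hl, hk]
  | cons x l ih =>
    refine (Exec.loop_step (by simp [hl]) (T := 1) (s' := Function.update (Function.update s a l)
      b (x :: s b)) ?_ (ih _ (by simp [hab]))).of_eq ?_ ?_
    · rw [hl]
      refine (exec_push _ _ _).of_eq ?_ le_rfl
      simp [hab.symm]
    · funext k
      by_cases hk : k = b
      · subst hk; simp
      · by_cases hk' : k = a
        · subst hk'; simp [hab]
        · simp [hk, hk']
    · simp only [List.length_cons]; omega

/-- The passage through `tmp` reverses twice, so `a` is restored and its image lies on `b` in the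
original order. -/
theorem exec_copy {a b : Stk} (f : OutTok → OutTok) (hab : a ≠ b) (ha : a ≠ .tmp) (hb : b ≠ .tmp)
    (s : Store) (hs : s .tmp = []) :
    Exec (copy a b f) s (Function.update s b ((s a).map f ++ s b)) (6 * (s a).length + 3) := by
  have key : ∀ (l : List OutTok) (s : Store), s .tmp = l →
      Exec (loop .tmp Option.isSome fun
        | none => skip
        | some x => seq (push a x) (push b (f x))) s
      (Function.update (Function.update (Function.update s .tmp []) a (l.reverse ++ s a)) b
        ((l.map f).reverse ++ s b)) (4 * l.length + 1) := by
    intro l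
    induction l with
    | nil =>
      intro s hl
      refine (Exec.loop_stop (by simp [hl])).of_eq ?_ (by simp)
      funext k
      by_cases hk : k = b
      · subst hk; simp [hb]
      · by_cases hk' : k = a
        · subst hk'; simp [hab, ha]
        · simp [hl, hk, hk']
    | cons x l ih =>
      intro s hl
      refine (Exec.loop_step (by simp [hl]) (T := 3) (s' := Function.update (Function.update
        (Function.update s .tmp l) a (x :: s a)) b (f x :: s b)) ?_ (ih _ ?_)).of_eq ?_ ?_
      · rw [hl]
        refine ((exec_push _ _ _).seq (exec_push _ _ _)).of_eq ?_ le_rfl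
        simp [ha, hb, hab.symm]
      · simp [ha.symm, hb.symm]
      · funext k
        by_cases hk : k = b
        · subst hk; simp
        · by_cases hk' : k = a
          · subst hk'; simp [hk]
          · simp [hk, hk']
            by_cases hk'' : k = .tmp
            · subst hk''; simp
            · simp [hk, hk', hk'']
      · simp only [List.length_cons]; omega
  refine ((exec_move ha s).seq (key (s a).reverse _ (by simp [hs]))).of_eq ?_ ?_
  · funext k
    by_cases hk : k = b
    · subst hk; simp [hab.symm, hb]
    · by_cases hk' : k = a
      · subst hk'; simp [hk, ha]
      · simp only [ne_eq, hk, not_false_eq_true, Function.update_of_ne, hk']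
        by_cases hk'' : k = .tmp
        · subst hk''; simp [hs]
        · simp [hk'', hk']
  · simp only [List.length_reverse]; omega

theorem exec_clear (a : Stk) (s : Store) :
    Exec (clear a) s (Function.update s a []) (2 * (s a).length + 1) := by
  generalize hl : s a = l
  induction l generalizing s with
  | nil => exact (Exec.loop_stop (by simp [hl])).of_eq (by simp [hl]) (by simp)
  | cons x l ih =>
    refine (Exec.loop_step (by simp [hl]) (exec_skip _) (ih _ (by simp [hl]))).of_eq (by simp) ?_
    simp only [List.length_cons]; omega

theorem exec_moveField {a b : Stk} (hab : a ≠ b) (s : Store) (l r : List OutTok)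
    (hl : s a = l ++ .close :: r) (hc : OutTok.close ∉ l) :
    Exec (moveField a b) s (Function.update (Function.update s a r) b (l.reverse ++ s b))
      (2 * l.length + 1) := by
  induction l generalizing s with
  | nil =>
    refine (Exec.loop_stop (by simp [hl, inField])).of_eq ?_ (by simp)
    funext k
    by_cases hk : k = b
    · subst hk; simp [hab.symm]
    · simp [hl, hk]
  | cons x l ih =>
    simp only [List.mem_cons, not_or] at hc
    refine (Exec.loop_step (by simp [hl, inField, Ne.symm hc.1]) (T := 1)
      (s' := Function.update (Function.update s a (l ++ .close :: r)) b (x :: s b)) ?_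
      (ih _ (by simp [hab]) hc.2)).of_eq ?_ ?_
    · rw [hl]
      refine (exec_push _ _ _).of_eq ?_ le_rfl
      simp [hab.symm]
    · funext k
      by_cases hk : k = b
      · subst hk; simp
      · by_cases hk' : k = a
        · subst hk'; simp [hab]
        · simp [hk, hk']
    · simp only [List.length_cons]; omega

end Prog

/-! ### String generators -/

/-- A generator of strings from the contents of the work stacks: `each i r p` is the concatenation
of the strings `p` where `i` holds `0`, `1`, … ticks, as many times as `r` has symbols. -/
inductive Gen : Type
  | const (l : List OutTok) : Gen
  | reg (r : Stk) : Gen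
  | regBits (r : Stk) : Gen
  | app (p q : Gen) : Gen
  | each (i r : Stk) (p : Gen) : Gen

namespace Gen

open Prog

instance : Append Gen := ⟨app⟩

/-- A number in unary. -/
def ticks (n : ℕ) : List OutTok := List.replicate n .tick

def toBit (_ : OutTok) : OutTok := .bit true

def toTick (_ : OutTok) : OutTok := .tick

/-- The string that a generator describes. -/
def eval : Gen → Store → List OutTok
  | const l, _ => l
  | reg r, s => s r
  | regBits r, s => (s r).map toBit
  | app p q, s => p.eval s ++ q.eval s
  | each i r p, s =>
    (List.range (s r).length).flatMap fun m => p.eval (Function.update s i (ticks m))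

@[simp] theorem eval_append (p q : Gen) (s : Store) : (p ++ q).eval s = p.eval s ++ q.eval s := rfl

/-- The program that puts a fixed string on the output stack. -/
def emit : List OutTok → Prog
  | [] => skip
  | a :: l => seq (emit l) (push .out a)

/-- The program that puts the string on the output stack. -/
def prog : Gen → Prog
  | const l => emit l
  | reg r => copy r .out id
  | regBits r => copy r .out toBit
  | app p q => seq q.prog p.prog
  | each i r p => seq (copy r i toTick) (loop i Option.isSome fun _ => p.prog)

/-- The stacks used as loop counters. -/
def isIndex : Stk → Bool
  | .ix | .jx | .kx => true
  | _ => false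

/-- The stacks that generators may read. -/
def isReg : Stk → Bool
  | .name | .row | .col | .row2 | .col2 | .arg | .fn | .ix | .jx | .kx => true
  | _ => false

/-- The generator reads only registers, and its loop counters, which are not in `B`, are not
used twice. -/
def ok : Gen → List Stk → Bool
  | const _, _ => true
  | reg r, _ => isReg r
  | regBits r, _ => isReg r
  | app p q, B => p.ok B && q.ok B
  | each i r p, B => isIndex i && isReg r && !B.contains i && i != r && p.ok (i :: B)

/-- A bound for the running time, if all registers have length at most the argument. -/
noncomputable def cost : Gen → Polynomial ℕ
  | const l => 2 * l.length + 1
  | reg _ => 6 * Polynomial.X + 3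
  | regBits _ => 6 * Polynomial.X + 3
  | app p q => p.cost + q.cost + 1
  | each _ _ p => 6 * Polynomial.X + 5 + Polynomial.X * (p.cost + 1)

theorem eval_congr {p : Gen} {B : List Stk} (h : p.ok B) {s s' : Store}
    (hs : ∀ r, isReg r → s r = s' r) : p.eval s = p.eval s' := by
  induction p generalizing B s s' with
  | const l => rfl
  | reg r => exact hs r h
  | regBits r => simp only [eval]; rw [hs r h]
  | app p q ihp ihq =>
    simp only [ok, Bool.and_eq_true] at h
    simp only [eval]
    rw [ihp h.1 hs, ihq h.2 hs]
  | each i r p ih =>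
    simp only [ok, Bool.and_eq_true] at h
    simp only [eval]
    rw [hs r h.1.1.1.2]
    congr 1
    funext m
    refine ih h.2 fun r hr => ?_
    simp only [Function.update_apply]
    rw [hs r hr]

theorem eval_update_out {p : Gen} {B : List Stk} (h : p.ok B) (s : Store) (l : List OutTok) :
    p.eval (Function.update s .out l) = p.eval s :=
  eval_congr h fun r hr => Function.update_of_ne (by rintro rfl; simp [isReg] at hr) _ _

/-- Since output is put on top of a stack, strings are produced from right to left: the second part
of a concatenation runs first, and loops count down. The pop that starts a round leaves exactly as
many ticks on the counter as the index of that round, so the counter itself is the unary index. The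
condition on `B` says that only the counters of enclosing loops are in use. -/
theorem exec_prog {p : Gen} {B : List Stk} (h : p.ok B) {s : Store} {n : ℕ}
    (hi : ∀ i, isIndex i → i ∉ B → s i = []) (ht : s .tmp = [])
    (hn : ∀ r, isReg r → (s r).length ≤ n) :
    Exec p.prog s (Function.update s .out (p.eval s ++ s .out)) (p.cost.eval n) := by
  induction p generalizing B s with
  | const l =>
    induction l with
    | nil => exact (exec_skip s).of_eq (by simp [eval]) (by simp [cost])
    | cons a l ih =>
      refine ((ih h).seq (exec_push .out a _)).of_eq (by simp [eval]) ?_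
      simp [cost]; omega
  | reg r =>
    refine (exec_copy id ?_ ?_ (by simp) s ht).of_eq (by simp [eval]) ?_
    · rintro rfl; simp [ok, isReg] at h
    · rintro rfl; simp [ok, isReg] at h
    · have := hn r h
      simp [cost]; omega
  | regBits r =>
    refine (exec_copy toBit ?_ ?_ (by simp) s ht).of_eq (by simp [eval]) ?_
    · rintro rfl; simp [ok, isReg] at h
    · rintro rfl; simp [ok, isReg] at h
    · have := hn r h
      simp [cost]; omega
  | app p q ihp ihq =>
    simp only [ok, Bool.and_eq_true] at h
    refine ((ihq h.2 hi ht hn).seq (ihp (s := Function.update s .out (q.eval s ++ s .out)) h.1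
      ?_ ?_ ?_)).of_eq ?_ ?_
    · intro i h1 h2
      rw [Function.update_of_ne (by rintro rfl; simp [isIndex] at h1)]
      exact hi i h1 h2
    · simpa using ht
    · intro r hr
      rw [Function.update_of_ne (by rintro rfl; simp [isReg] at hr)]
      exact hn r hr
    · simp [eval, eval_update_out h.1]
    · simp [cost]; omega
  | each i r p ih =>
    simp only [ok, Bool.and_eq_true, Bool.not_eq_true', List.contains_eq_mem,
      decide_eq_false_iff_not, bne_iff_ne, ne_eq] at h
    obtain ⟨⟨⟨⟨h1, h2⟩, h3⟩, h4⟩, h5⟩ := h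
    have hio : i ≠ .out := by rintro rfl; simp [isIndex] at h1
    have hit : i ≠ .tmp := by rintro rfl; simp [isIndex] at h1
    have hrt : r ≠ .tmp := by rintro rfl; simp [isReg] at h2
    -- The rounds still to be run, from a store s' that may differ from s only in the counter and in
    -- the output; the text of a round depends on neither the output nor the old value of the
    -- counter.
    have key : ∀ (m : ℕ) (s' : Store), m ≤ n → s' i = ticks m →
        (∀ r, r ≠ i → r ≠ .out → s' r = s r) →
        Exec (loop i Option.isSome fun _ => p.prog) s'
        (Function.update (Function.update s' i []) .out
          (((List.range m).flatMap fun m => p.eval (Function.update s i (ticks m))) ++ s' .out))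
        (m * (p.cost.eval n + 1) + 1) := by
      intro m
      induction m with
      | zero =>
        intro s' _ h6 h7
        have h6 : s' i = [] := h6
        refine (Exec.loop_stop (by simp [h6])).of_eq ?_ (by simp)
        funext k
        by_cases hk : k = .out
        · subst hk; simp [hio.symm]
        · simp [h6, hk]
      | succ m ihm =>
        intro s' hm h6 h7
        have h6 : s' i = .tick :: ticks m := h6
        have h8 : p.eval (Function.update s' i (ticks m)) =
            p.eval (Function.update s i (ticks m)) := by
          refine eval_congr h5 fun r' hr' => ?_
          by_cases hr : r' = i
          · subst hr; simp
          · simp only [ne_eq, hr, not_false_eq_true, Function.update_of_ne]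
            exact h7 _ hr (by rintro rfl; simp [isReg] at hr')
        have h9 := ih h5 (s := Function.update s' i (ticks m)) (by
          intro i' h1' h3'
          simp only [List.mem_cons, not_or] at h3'
          rw [Function.update_of_ne h3'.1, h7 _ h3'.1 (by rintro rfl; simp [isIndex] at h1')]
          exact hi _ h1' h3'.2) (by
          rw [Function.update_of_ne hit.symm, h7 _ hit.symm (by simp)]; exact ht) (by
          intro r' hr'
          by_cases hr : r' = i
          · subst hr; simp [ticks]; omega
          · simp only [ne_eq, hr, not_false_eq_true, Function.update_of_ne]
            rw [h7 _ hr (by rintro rfl; simp [isReg] at hr')]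
            exact hn _ hr')
        refine (Exec.loop_step (by simp [h6]) (by rw [h6]; exact h9)
          (ihm _ (by omega) ?_ ?_)).of_eq ?_ ?_
        · simp [hio]
        · intro r' hr hr'
          simp [hr, hr']
          exact h7 _ hr hr'
        · rw [h8]
          funext k
          by_cases hk : k = .out
          · subst hk
            simp [hio.symm, List.range_succ]
          · simp only [ne_eq, hk, not_false_eq_true, Function.update_of_ne]
            by_cases hk' : k = i
            · subst hk'; simp
            · simp [hk, hk']
        · rw [Nat.succ_mul]; omega
    have h6 := exec_copy (a := r) (b := i) toTick (Ne.symm h4) hrt hit s ht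
    rw [hi i h1 h3, List.append_nil] at h6
    have h7 : (s r).map toTick = ticks (s r).length := by
      simp [ticks, List.eq_replicate_iff, toTick]
    rw [h7] at h6
    have hle := hn r h2
    refine (h6.seq (key (s r).length _ hle (by simp) fun r' hr hr' => by simp [hr])).of_eq ?_ ?_
    · funext k
      by_cases hk : k = .out
      · subst hk; simp [eval, hio.symm]
      · simp only [ne_eq, hk, not_false_eq_true, Function.update_of_ne]
        by_cases hk' : k = i
        · subst hk'; simp [hi k h1 h3]
        · simp [hk']
    · have := Nat.mul_le_mul_right (p.cost.eval n + 1) hle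
      simp only [cost, Polynomial.eval_add, Polynomial.eval_mul, Polynomial.eval_ofNat,
        Polynomial.eval_X, Polynomial.eval_one]
      omega

end Gen

/-! ### Combinators for formulas -/

/-- A quantifier prefix. -/
def exs (l : List RVar) (φ : ExFormula) : ExFormula := l.foldr .ex φ

/-- A conjunction, ending with `φ`. -/
def ands (l : List ExFormula) (φ : ExFormula) : ExFormula := l.foldr .and φ

/-- A valid formula without variables. -/
def verum : ExFormula := .eq (.int 0) (.int 0)

/-- A family of variables for the entries of a matrix. -/
abbrev Blk : Type := ℕ → ℕ → Part → RVar

/-- The variables of an `r × c` block. -/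
def blkVars (b : Blk) (r c : ℕ) : List RVar :=
  (List.range r).flatMap fun i => (List.range c).flatMap fun j => [b i j .re, b i j .im]

/-- Constraints for all positions of an `r × c` matrix. -/
def grid (r c : ℕ) (ψ : ℕ → ℕ → List ExFormula) : List ExFormula :=
  (List.range r).flatMap fun i => (List.range c).flatMap fun j => ψ i j

/-- Complex terms: pairs of a real and an imaginary part. -/
structure CTerm : Type where
  re : RTerm
  im : RTerm

/-- The sum of the terms `t 0`, …, `t (n - 1)`. -/
def rsum (n : ℕ) (t : ℕ → RTerm) : RTerm := (List.range n).foldr (fun k u => .add (t k) u) (.int 0)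

namespace CTerm

def zero : CTerm := ⟨.int 0, .int 0⟩

def one : CTerm := ⟨.int 1, .int 0⟩

def entry (b : Blk) (i j : ℕ) : CTerm := ⟨.var (b i j .re), .var (b i j .im)⟩

def add (a b : CTerm) : CTerm := ⟨.add a.re b.re, .add a.im b.im⟩

def mul (a b : CTerm) : CTerm :=
  ⟨.add (.mul a.re b.re) (.mul (.int (-1)) (.mul a.im b.im)),
    .add (.mul a.re b.im) (.mul a.im b.re)⟩

def conj (a : CTerm) : CTerm := ⟨a.re, .mul (.int (-1)) a.im⟩

def sum (n : ℕ) (t : ℕ → CTerm) : CTerm := ⟨rsum n fun k => (t k).re, rsum n fun k => (t k).im⟩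

/-- The value of a complex term. -/
def value (Ω : Interp) (ρ : RVar → ℝ) (a : CTerm) : ℂ := ⟨a.re.value Ω ρ, a.im.value Ω ρ⟩

end CTerm

/-- The two real equations that express an equation between complex terms. -/
def ceq (a b : CTerm) : List ExFormula := [.eq a.re b.re, .eq a.im b.im]

/-- The square of the absolute value of a complex term. -/
def normSqTerm (a : CTerm) : RTerm := .add (.mul a.re a.re) (.mul a.im a.im)

/-- A formula that expresses that two complex terms have distinct values. -/
def cne (a b : CTerm) : ExFormula :=
  .or (.or (.lt a.re b.re) (.lt b.re a.re)) (.or (.lt a.im b.im) (.lt b.im a.im))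

/-! ### The translation of expressions -/

/-- The block that stands for the result of an expression. -/
def outBlk : Name := [true, false]

/-- The block that stands for the value of the argument with number `k`. -/
def argBlk (k : ℕ) : Name := List.replicate (k + 2) true

def eigBlk₁ : Name := [true, false, false]

def eigBlk₂ : Name := [true, false, true]

def eigBlk₃ : Name := [true, false, false, false]

/-- The block that stands for the value of a matrix variable. -/
def varBlk (M : Name) : Name := false :: M

/-- `φ`, with the result block renamed to the block of argument `k`. -/
def wrap (k r c : ℕ) (φ : ExFormula) : ExFormula :=
  exs (blkVars (.z outBlk) r c) (ands (grid r c fun i j =>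
    ceq (.entry (.z outBlk) i j) (.entry (.z (argBlk k)) i j)) φ)

def varF (w : Name) (r c : ℕ) : ExFormula :=
  ands (grid r c fun i j => ceq (.entry (.z outBlk) i j) (.entry (.z w) i j)) verum

def transpF (r c : ℕ) (X : ExFormula) : ExFormula :=
  exs (blkVars (.z (argBlk 0)) r c) (ands (grid r c fun i j =>
    ceq (.entry (.z outBlk) j i) (.conj (.entry (.z (argBlk 0)) i j))) X)

def onesF (r c : ℕ) (X : ExFormula) : ExFormula :=
  exs (blkVars (.z (argBlk 0)) r c) (ands ((List.range r).flatMap fun i =>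
    ceq (.entry (.z outBlk) i 0) .one) X)

def diagF (r c : ℕ) (X : ExFormula) : ExFormula :=
  exs (blkVars (.z (argBlk 0)) r c) (ands ((List.range r).flatMap fun i =>
    ceq (.entry (.z outBlk) i i) (.entry (.z (argBlk 0)) i 0) ++ (List.range i).flatMap fun j =>
      ceq (.entry (.z outBlk) i j) .zero ++ ceq (.entry (.z outBlk) j i) .zero) X)

def mulF (r m c : ℕ) (X₂ X₁ : ExFormula) : ExFormula :=
  exs (blkVars (.z (argBlk 0)) r m) (exs (blkVars (.z (argBlk 1)) m c) (ands (grid r c fun i j =>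
    ceq (.entry (.z outBlk) i j)
      (.sum m fun k => .mul (.entry (.z (argBlk 0)) i k) (.entry (.z (argBlk 1)) k j)))
    (.and X₂ X₁)))

def letF (w : Name) (r c : ℕ) (X₂ X₁ : ExFormula) : ExFormula :=
  exs (blkVars (.z (argBlk 0)) r c) (.and (exs (blkVars (.z w) r c) (ands (grid r c fun i j =>
    ceq (.entry (.z w) i j) (.entry (.z (argBlk 0)) i j)) X₂)) X₁)

def applyTerm (f : Name) (p : Part) (n i j : ℕ) : RTerm :=
  .fn f p n (fun k => .var (.z (argBlk k) i j .re)) fun k => .var (.z (argBlk k) i j .im)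

def applyF (f : Name) (n r c : ℕ) (X : ExFormula) : ExFormula :=
  exs ((List.range n).flatMap fun k => blkVars (.z (argBlk k)) r c) (ands (grid r c fun i j =>
    ceq (.entry (.z outBlk) i j) ⟨applyTerm f .re n i j, applyTerm f .im n i j⟩) X)

/-- A conjunction that is built by adding conjuncts in front. -/
def accum (X : ℕ → ExFormula) : ℕ → ExFormula
  | 0 => verum
  | k + 1 => .and (X k) (accum X k)

/-- The result block is a basis of eigenvectors of the argument block as required. -/
def eigBasisF (n : ℕ) : ExFormula :=
  exs (blkVars (.z eigBlk₁) n n) (exs (blkVars (.z eigBlk₂) n n)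
    (ands (grid n n fun i j =>
      ceq (.sum n fun k => .mul (.entry (.z (argBlk 0)) i k) (.entry (.z outBlk) k j))
        (.mul (.entry (.z eigBlk₁) j j) (.entry (.z outBlk) i j)))
    (ands ((List.range n).flatMap fun i =>
      ceq (.sum n fun k => .mul (.entry (.z outBlk) i k) (.entry (.z eigBlk₂) k i)) .one)
    (ands ((List.range n).flatMap fun i => (List.range i).flatMap fun j =>
      ceq (.sum n fun k => .mul (.entry (.z outBlk) i k) (.entry (.z eigBlk₂) k j)) .zero ++
      (ceq (.sum n fun k => .mul (.entry (.z outBlk) j k) (.entry (.z eigBlk₂) k i)) .zero ++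
      [.or (cne (.entry (.z eigBlk₁) i i) (.entry (.z eigBlk₁) j j))
        (ands (ceq (.sum n fun k => .mul (.conj (.entry (.z outBlk) k i)) (.entry (.z outBlk) k j))
          .zero) verum)])) verum))))

/-- The result block is zero and the argument block is not diagonalizable. -/
def eigDefectF (n : ℕ) : ExFormula :=
  exs (blkVars (.z eigBlk₁) n n) (exs (blkVars (.z eigBlk₂) n n) (exs (blkVars (.z eigBlk₃) n n)
    (ands (grid n n fun i j =>
      ceq (.entry (.z outBlk) i j) .zero ++
      (ceq (.sum n fun k => .mul (.entry (.z (argBlk 0)) i k) (.entry (.z eigBlk₂) k j))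
        (.add (.mul (.entry (.z eigBlk₁) j j) (.entry (.z eigBlk₂) i j))
          (.entry (.z eigBlk₃) i j)) ++
      ceq (.sum n fun k => .mul (.entry (.z (argBlk 0)) i k) (.entry (.z eigBlk₃) k j))
        (.mul (.entry (.z eigBlk₁) j j) (.entry (.z eigBlk₃) i j))))
    (.lt (.int 0) (rsum n fun i => rsum n fun j => normSqTerm (.entry (.z eigBlk₃) i j))))))

def eigenF (n c : ℕ) (X : ExFormula) : ExFormula :=
  exs (blkVars (.z (argBlk 0)) n c) (.and (.or (eigBasisF n) (eigDefectF n)) X)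

/-- The variables in scope, with the dimensions of their values. -/
abbrev Env : Type := List (Name × ℕ × ℕ)

/-- The dimensions of the results of an expression. -/
def dims : Env → Expr → ℕ × ℕ
  | env, .var M => (env.lookup (varBlk M)).getD (0, 0)
  | env, .letIn M e₁ e₂ => dims ((varBlk M, dims env e₁) :: env) e₂
  | env, .transp e => (dims env e).swap
  | env, .ones e => ((dims env e).1, 1)
  | env, .diag e => ((dims env e).1, (dims env e).1)
  | env, .mul e₁ e₂ => ((dims env e₁).1, (dims env e₂).2)
  | env, .apply _ n args => if h : 0 < n then dims env (args ⟨0, h⟩) else (0, 0)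
  | env, .eigen e => dims env e

/-- The formula that expresses that the result block is a possible result of the expression. -/
def trans : Env → Expr → ExFormula
  | env, .var M => varF (varBlk M) (dims env (.var M)).1 (dims env (.var M)).2
  | env, .letIn M e₁ e₂ => letF (varBlk M) (dims env e₁).1 (dims env e₁).2
      (trans ((varBlk M, dims env e₁) :: env) e₂)
      (wrap 0 (dims env e₁).1 (dims env e₁).2 (trans env e₁))
  | env, .transp e => transpF (dims env e).1 (dims env e).2
      (wrap 0 (dims env e).1 (dims env e).2 (trans env e))
  | env, .ones e => onesF (dims env e).1 (dims env e).2
      (wrap 0 (dims env e).1 (dims env e).2 (trans env e))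
  | env, .diag e => diagF (dims env e).1 (dims env e).2
      (wrap 0 (dims env e).1 (dims env e).2 (trans env e))
  | env, .mul e₁ e₂ => mulF (dims env e₁).1 (dims env e₂).1 (dims env e₂).2
      (wrap 1 (dims env e₂).1 (dims env e₂).2 (trans env e₂))
      (wrap 0 (dims env e₁).1 (dims env e₁).2 (trans env e₁))
  | env, .apply f n args => applyF f n (dims env (.apply f n args)).1
      (dims env (.apply f n args)).2
      (accum (fun k => if h : k < n then
        wrap k (dims env (args ⟨k, h⟩)).1 (dims env (args ⟨k, h⟩)).2 (trans env (args ⟨k, h⟩))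
        else verum) n)
  | env, .eigen e => eigenF (dims env e).1 (dims env e).2
      (wrap 0 (dims env e).1 (dims env e).2 (trans env e))

/-- The environment `env` gives the variables of the schema the dimensions of their types. -/
def Env.Fits (env : Env) (S : Name → Option Ty) (σ : Name → ℕ) : Prop :=
  ∀ M, env.lookup (varBlk M) = (S M).map fun τ => (τ.1.value σ, τ.2.value σ)

theorem Env.Fits.update {env : Env} {S : Name → Option Ty} {σ : Name → ℕ} (h : env.Fits S σ)
    (M : Name) (τ : Ty) :
    Env.Fits ((varBlk M, τ.1.value σ, τ.2.value σ) :: env) (Function.update S M (some τ)) σ := by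
  intro M'
  by_cases hM : M' = M
  · subst hM; simp
  · rw [Function.update_of_ne hM, ← h M', List.lookup_cons]
    have : (varBlk M' == varBlk M) = false := by simpa [varBlk] using hM
    rw [this]

theorem dims_eq {S : Name → Option Ty} {e : Expr} {τ : Ty} (h : HasType S e τ) {σ : Name → ℕ}
    {env : Env} (hE : env.Fits S σ) : dims env e = (τ.1.value σ, τ.2.value σ) := by
  induction h generalizing env with
  | var h => rw [dims, hE, h]; rfl
  | letIn h₁ h₂ ih₁ ih₂ => rw [dims, ih₁ hE]; exact ih₂ (hE.update _ _)
  | transp h ih => rw [dims, ih hE]; rfl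
  | ones h ih => rw [dims, ih hE]; rfl
  | diag h ih => rw [dims, ih hE]
  | mul h₁ h₂ ih₁ ih₂ => rw [dims, ih₁ hE, ih₂ hE]
  | apply hn h ih => rw [dims, dif_pos hn]; exact ih _ hE
  | eigen h ih => rw [dims, ih hE]

/-! ### Function symbols -/

@[simp] theorem symbols_exs (l : List RVar) (φ : ExFormula) : (exs l φ).symbols = φ.symbols := by
  induction l with
  | nil => rfl
  | cons v l ih => exact ih

@[simp] theorem symbols_ands (l : List ExFormula) (φ : ExFormula) :
    (ands l φ).symbols = (⋃ ψ ∈ l, ψ.symbols) ∪ φ.symbols := by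
  induction l with
  | nil => simp [ands]
  | cons ψ l ih =>
    change ψ.symbols ∪ (ands l φ).symbols = _
    rw [ih]
    simp [Set.union_assoc]

@[simp] theorem symbols_rsum (n : ℕ) (t : ℕ → RTerm) :
    (rsum n t).symbols = ⋃ k ∈ Finset.range n, (t k).symbols := by
  have : ∀ l : List ℕ, (l.foldr (fun k u => RTerm.add (t k) u) (.int 0)).symbols =
      ⋃ k ∈ l, (t k).symbols := by
    intro l
    induction l with
    | nil => simp [RTerm.symbols]
    | cons k l ih => simp [RTerm.symbols, ih]
  simp [rsum, this]

theorem symbols_accum_subset {X : ℕ → ExFormula} {A : Set (Name × ℕ)}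
    (h : ∀ k, (X k).symbols ⊆ A) (n : ℕ) : (accum X n).symbols ⊆ A := by
  induction n with
  | zero => simp [accum, verum, ExFormula.symbols, RTerm.symbols]
  | succ n ih => exact Set.union_subset (h n) ih

theorem symbols_grid (r c : ℕ) (ψ : ℕ → ℕ → List ExFormula) (A : Set (Name × ℕ))
    (h : ∀ i j, ∀ χ ∈ ψ i j, χ.symbols ⊆ A) : ⋃ χ ∈ grid r c ψ, χ.symbols ⊆ A := by
  simp only [grid, List.mem_flatMap, Set.iUnion_subset_iff]
  rintro χ ⟨i, -, j, -, hχ⟩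
  exact h _ _ _ hχ

theorem symbols_wrap (k r c : ℕ) (φ : ExFormula) : (wrap k r c φ).symbols = φ.symbols := by
  simp only [wrap, symbols_exs, symbols_ands, Set.union_eq_right]
  refine (symbols_grid _ _ _ ∅ ?_).trans (Set.empty_subset _)
  simp [ceq, ExFormula.symbols, RTerm.symbols, CTerm.entry]

theorem symbols_eigBasisF (n : ℕ) : (eigBasisF n).symbols = ∅ := by
  simp [eigBasisF, grid, ceq, cne, verum, ExFormula.symbols, RTerm.symbols, CTerm.entry, CTerm.sum,
    CTerm.mul, CTerm.conj, CTerm.zero, CTerm.one]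

theorem symbols_eigDefectF (n : ℕ) : (eigDefectF n).symbols = ∅ := by
  simp [eigDefectF, grid, ceq, normSqTerm, ExFormula.symbols, RTerm.symbols, CTerm.entry,
    CTerm.sum, CTerm.mul, CTerm.add, CTerm.zero]

theorem symbols_trans (env : Env) (e : Expr) : (trans env e).symbols ⊆ e.symbols := by
  induction e generalizing env with
  | var M =>
    simp [trans, varF, verum, grid, ceq, ExFormula.symbols, RTerm.symbols, CTerm.entry]
  | letIn M e₁ e₂ ih₁ ih₂ =>
    simp only [trans, letF, symbols_exs, symbols_ands, symbols_wrap, ExFormula.symbols,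
      Expr.symbols]
    refine Set.union_subset (Set.union_subset ?_ ((ih₂ _).trans Set.subset_union_right))
      ((ih₁ _).trans Set.subset_union_left)
    refine symbols_grid _ _ _ _ ?_
    simp [ceq, ExFormula.symbols, RTerm.symbols, CTerm.entry]
  | transp e ih =>
    simp only [trans, transpF, symbols_exs, symbols_ands, symbols_wrap, Expr.symbols]
    refine Set.union_subset (symbols_grid _ _ _ _ ?_) (ih _)
    simp [ceq, ExFormula.symbols, RTerm.symbols, CTerm.entry, CTerm.conj]
  | ones e ih =>
    simp only [trans, onesF, symbols_exs, symbols_ands, symbols_wrap, Expr.symbols]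
    refine Set.union_subset ?_ (ih _)
    simp [ceq, ExFormula.symbols, RTerm.symbols, CTerm.entry, CTerm.one]
  | diag e ih =>
    simp only [trans, diagF, symbols_exs, symbols_ands, symbols_wrap, Expr.symbols]
    refine Set.union_subset ?_ (ih _)
    simp [ceq, ExFormula.symbols, RTerm.symbols, CTerm.entry, CTerm.zero]
  | mul e₁ e₂ ih₁ ih₂ =>
    simp only [trans, mulF, symbols_exs, symbols_ands, symbols_wrap, Expr.symbols,
      ExFormula.symbols]
    refine Set.union_subset (symbols_grid _ _ _ _ ?_) (Set.union_subset
      ((ih₂ _).trans Set.subset_union_right) ((ih₁ _).trans Set.subset_union_left))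
    simp [ceq, ExFormula.symbols, RTerm.symbols, CTerm.entry, CTerm.sum, CTerm.mul]
  | apply f n args ih =>
    simp only [trans, applyF, symbols_exs, symbols_ands, Expr.symbols]
    refine Set.union_subset (symbols_grid _ _ _ _ ?_) (symbols_accum_subset (fun k => ?_) _)
    · simp [ceq, ExFormula.symbols, RTerm.symbols, CTerm.entry, applyTerm]
    · split_ifs with h
      · rw [symbols_wrap]
        exact (ih _ _).trans ((Set.subset_iUnion (fun k => (args k).symbols) _).trans
          Set.subset_union_right)
      · simp [verum, ExFormula.symbols, RTerm.symbols]
  | eigen e ih =>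
    simp only [trans, eigenF, symbols_exs, symbols_wrap, Expr.symbols,
      ExFormula.symbols, symbols_eigBasisF, symbols_eigDefectF]
    simpa using ih _

/-! ### Free variables -/

theorem freeVars_exs (l : List RVar) (φ : ExFormula) :
    (exs l φ).freeVars = φ.freeVars \ {v | v ∈ l} := by
  induction l with
  | nil => simp [exs]
  | cons v l ih =>
    change (exs l φ).freeVars \ {v} = _
    rw [ih]
    ext w
    simp [and_assoc, and_comm]

theorem freeVars_ands (l : List ExFormula) (φ : ExFormula) :
    (ands l φ).freeVars = {v | ∃ ψ ∈ l, v ∈ ψ.freeVars} ∪ φ.freeVars := by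
  induction l with
  | nil => simp [ands]
  | cons ψ l ih =>
    change ψ.freeVars ∪ (ands l φ).freeVars = _
    rw [ih]
    ext w
    simp [or_assoc]

theorem mem_vars_rsum (n : ℕ) (t : ℕ → RTerm) (v : RVar) :
    v ∈ (rsum n t).vars ↔ ∃ k < n, v ∈ (t k).vars := by
  have : ∀ l : List ℕ, v ∈ (l.foldr (fun k u => RTerm.add (t k) u) (.int 0)).vars ↔
      ∃ k ∈ l, v ∈ (t k).vars := by
    intro l
    induction l with
    | nil => simp [RTerm.vars]
    | cons k l ih => simp [RTerm.vars, ih]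
  simp [rsum, this]

theorem mem_blkVars {b : Blk} {r c : ℕ} {v : RVar} :
    v ∈ blkVars b r c ↔ ∃ i < r, ∃ j < c, ∃ p, v = b i j p := by
  simp only [blkVars, List.mem_flatMap, List.mem_range, List.mem_cons, List.not_mem_nil, or_false]
  refine exists_congr fun i => and_congr_right fun _ => exists_congr fun j =>
    and_congr_right fun _ => ⟨?_, ?_⟩
  · rintro (h | h)
    exacts [⟨_, h⟩, ⟨_, h⟩]
  · rintro ⟨_ | _, h⟩
    exacts [.inl h, .inr h]

/-- The variables of a complex term. -/
def CTerm.vars (a : CTerm) : Set RVar := a.re.vars ∪ a.im.vars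

theorem mem_freeVars_ceq {a b : CTerm} {v : RVar} :
    (∃ ψ ∈ ceq a b, v ∈ ψ.freeVars) ↔ v ∈ a.vars ∨ v ∈ b.vars := by
  simp [ceq, ExFormula.freeVars, CTerm.vars]
  tauto

/-- The set of variables of a block. -/
def blkSet (b : Blk) (r c : ℕ) : Set RVar := {v | v ∈ blkVars b r c}

theorem freeVars_exs_subset {l : List RVar} {φ : ExFormula} {B : Set RVar}
    (h : φ.freeVars ⊆ {v | v ∈ l} ∪ B) : (exs l φ).freeVars ⊆ B := by
  rw [freeVars_exs, Set.sdiff_subset_iff]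
  exact h

theorem freeVars_ands_subset {l : List ExFormula} {φ : ExFormula} {B : Set RVar}
    (h : ∀ ψ ∈ l, ψ.freeVars ⊆ B) (h' : φ.freeVars ⊆ B) : (ands l φ).freeVars ⊆ B := by
  rw [freeVars_ands]
  rintro v (⟨ψ, hψ, hv⟩ | hv)
  exacts [h ψ hψ hv, h' hv]

theorem freeVars_range_subset {n : ℕ} {ψ : ℕ → List ExFormula} {B : Set RVar}
    (h : ∀ i < n, ∀ χ ∈ ψ i, χ.freeVars ⊆ B) :
    ∀ χ ∈ (List.range n).flatMap ψ, χ.freeVars ⊆ B := by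
  simp only [List.mem_flatMap, List.mem_range]
  rintro χ ⟨i, hi, hχ⟩
  exact h i hi χ hχ

theorem freeVars_grid_subset {r c : ℕ} {ψ : ℕ → ℕ → List ExFormula} {B : Set RVar}
    (h : ∀ i < r, ∀ j < c, ∀ χ ∈ ψ i j, χ.freeVars ⊆ B) :
    ∀ χ ∈ grid r c ψ, χ.freeVars ⊆ B :=
  freeVars_range_subset fun i hi => freeVars_range_subset fun j hj => h i hi j hj

theorem freeVars_append_subset {l l' : List ExFormula} {B : Set RVar}
    (h : ∀ χ ∈ l, χ.freeVars ⊆ B) (h' : ∀ χ ∈ l', χ.freeVars ⊆ B) :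
    ∀ χ ∈ l ++ l', χ.freeVars ⊆ B := by
  simp only [List.mem_append]
  rintro χ (hχ | hχ)
  exacts [h χ hχ, h' χ hχ]

theorem freeVars_ceq_subset {a b : CTerm} {B : Set RVar} (ha : a.vars ⊆ B) (hb : b.vars ⊆ B) :
    ∀ χ ∈ ceq a b, χ.freeVars ⊆ B := fun χ hχ v hv =>
  (mem_freeVars_ceq.1 ⟨χ, hχ, hv⟩).elim (@ha v) (@hb v)

theorem freeVars_cne_subset {a b : CTerm} {B : Set RVar} (ha : a.vars ⊆ B) (hb : b.vars ⊆ B) :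
    (cne a b).freeVars ⊆ B := by
  simp only [CTerm.vars, Set.union_subset_iff] at ha hb
  simp [cne, ExFormula.freeVars, ha, hb]

theorem freeVars_verum (B : Set RVar) : verum.freeVars ⊆ B := by
  simp [verum, ExFormula.freeVars, RTerm.vars]

theorem vars_entry_subset {b : Blk} {r c i j : ℕ} {B : Set RVar} (hi : i < r) (hj : j < c)
    (h : blkSet b r c ⊆ B) : (CTerm.entry b i j).vars ⊆ B := by
  refine subset_trans ?_ h
  rintro v (hv | hv)
  · exact mem_blkVars.2 ⟨i, hi, j, hj, _, hv⟩
  · exact mem_blkVars.2 ⟨i, hi, j, hj, _, hv⟩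

theorem vars_zero_subset (B : Set RVar) : CTerm.zero.vars ⊆ B := by
  simp [CTerm.vars, CTerm.zero, RTerm.vars]

theorem vars_one_subset (B : Set RVar) : CTerm.one.vars ⊆ B := by
  simp [CTerm.vars, CTerm.one, RTerm.vars]

theorem vars_add_subset {a b : CTerm} {B : Set RVar} (ha : a.vars ⊆ B) (hb : b.vars ⊆ B) :
    (a.add b).vars ⊆ B := by
  simp only [CTerm.vars, Set.union_subset_iff] at ha hb
  simp [CTerm.vars, CTerm.add, RTerm.vars, ha, hb]

theorem vars_mul_subset {a b : CTerm} {B : Set RVar} (ha : a.vars ⊆ B) (hb : b.vars ⊆ B) :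
    (a.mul b).vars ⊆ B := by
  simp only [CTerm.vars, Set.union_subset_iff] at ha hb
  simp [CTerm.vars, CTerm.mul, RTerm.vars, ha, hb]

theorem vars_conj_subset {a : CTerm} {B : Set RVar} (ha : a.vars ⊆ B) : a.conj.vars ⊆ B := by
  simp only [CTerm.vars, Set.union_subset_iff] at ha
  simp [CTerm.vars, CTerm.conj, RTerm.vars, ha]

theorem vars_sum_subset {n : ℕ} {t : ℕ → CTerm} {B : Set RVar} (h : ∀ k < n, (t k).vars ⊆ B) :
    (CTerm.sum n t).vars ⊆ B := by
  rintro v (hv | hv)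
  · obtain ⟨k, hk, hv⟩ := (mem_vars_rsum _ _ _).1 hv
    exact h k hk (.inl hv)
  · obtain ⟨k, hk, hv⟩ := (mem_vars_rsum _ _ _).1 hv
    exact h k hk (.inr hv)

theorem freeVars_wrap_subset {k r c : ℕ} {φ : ExFormula} {E : Set RVar}
    (h : φ.freeVars ⊆ blkSet (.z outBlk) r c ∪ E) :
    (wrap k r c φ).freeVars ⊆ blkSet (.z (argBlk k)) r c ∪ E := by
  refine freeVars_exs_subset (freeVars_ands_subset (freeVars_grid_subset fun i hi j hj =>
    freeVars_ceq_subset (vars_entry_subset hi hj ?_) (vars_entry_subset hi hj ?_)) (h.trans ?_))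
  · exact Set.subset_union_left
  · exact subset_trans Set.subset_union_left Set.subset_union_right
  · exact Set.union_subset_union_right _ Set.subset_union_right

theorem freeVars_varF_subset {w : Name} {r c : ℕ} {B : Set RVar}
    (h : blkSet (.z outBlk) r c ⊆ B) (h' : blkSet (.z w) r c ⊆ B) :
    (varF w r c).freeVars ⊆ B :=
  freeVars_ands_subset (freeVars_grid_subset fun _ hi _ hj =>
    freeVars_ceq_subset (vars_entry_subset hi hj h) (vars_entry_subset hi hj h')) (freeVars_verum _)

theorem freeVars_transpF_subset {r c : ℕ} {X : ExFormula} {E : Set RVar}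
    (h : X.freeVars ⊆ blkSet (.z (argBlk 0)) r c ∪ E) :
    (transpF r c X).freeVars ⊆ blkSet (.z outBlk) c r ∪ E := by
  refine freeVars_exs_subset (freeVars_ands_subset (freeVars_grid_subset fun i hi j hj =>
    freeVars_ceq_subset (vars_entry_subset hj hi ?_) (vars_conj_subset
      (vars_entry_subset hi hj ?_))) (h.trans ?_))
  · exact subset_trans Set.subset_union_left Set.subset_union_right
  · exact Set.subset_union_left
  · exact Set.union_subset_union_right _ Set.subset_union_right

theorem freeVars_onesF_subset {r c : ℕ} {X : ExFormula} {E : Set RVar}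
    (h : X.freeVars ⊆ blkSet (.z (argBlk 0)) r c ∪ E) :
    (onesF r c X).freeVars ⊆ blkSet (.z outBlk) r 1 ∪ E := by
  refine freeVars_exs_subset (freeVars_ands_subset (freeVars_range_subset fun i hi =>
    freeVars_ceq_subset (vars_entry_subset hi one_pos ?_) (vars_one_subset _)) (h.trans ?_))
  · exact subset_trans Set.subset_union_left Set.subset_union_right
  · exact Set.union_subset_union_right _ Set.subset_union_right

theorem freeVars_diagF_subset {r : ℕ} {X : ExFormula} {E : Set RVar}
    (h : X.freeVars ⊆ blkSet (.z (argBlk 0)) r 1 ∪ E) :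
    (diagF r 1 X).freeVars ⊆ blkSet (.z outBlk) r r ∪ E := by
  have hO : blkSet (.z outBlk) r r ⊆ {v | v ∈ blkVars (.z (argBlk 0)) r 1} ∪
      (blkSet (.z outBlk) r r ∪ E) :=
    subset_trans Set.subset_union_left Set.subset_union_right
  refine freeVars_exs_subset (freeVars_ands_subset (freeVars_range_subset fun i hi =>
    freeVars_append_subset (freeVars_ceq_subset (vars_entry_subset hi hi hO)
      (vars_entry_subset hi one_pos Set.subset_union_left)) (freeVars_range_subset fun j hj =>
      freeVars_append_subset
        (freeVars_ceq_subset (vars_entry_subset hi (hj.trans hi) hO) (vars_zero_subset _))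
        (freeVars_ceq_subset (vars_entry_subset (hj.trans hi) hi hO) (vars_zero_subset _))))
      (h.trans ?_))
  exact Set.union_subset_union_right _ Set.subset_union_right

theorem freeVars_mulF_subset {r m c : ℕ} {X₂ X₁ : ExFormula} {E : Set RVar}
    (h₂ : X₂.freeVars ⊆ blkSet (.z (argBlk 1)) m c ∪ E)
    (h₁ : X₁.freeVars ⊆ blkSet (.z (argBlk 0)) r m ∪ E) :
    (mulF r m c X₂ X₁).freeVars ⊆ blkSet (.z outBlk) r c ∪ E := by
  refine freeVars_exs_subset (freeVars_exs_subset (freeVars_ands_subset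
    (freeVars_grid_subset fun i hi j hj =>
    freeVars_ceq_subset (vars_entry_subset hi hj ?_) (vars_sum_subset fun k hk =>
      vars_mul_subset (vars_entry_subset hi hk ?_) (vars_entry_subset hk hj ?_)))
      (Set.union_subset (h₂.trans ?_) (h₁.trans ?_))))
  all_goals
    intro v hv
    simp only [blkSet, Set.mem_union, Set.mem_ofPred_eq] at hv ⊢
    tauto

theorem freeVars_letF_subset {w : Name} {r c : ℕ} {X₂ X₁ : ExFormula} {B E : Set RVar}
    (h₂ : X₂.freeVars ⊆ B ∪ (blkSet (.z w) r c ∪ E))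
    (h₁ : X₁.freeVars ⊆ blkSet (.z (argBlk 0)) r c ∪ E) :
    (letF w r c X₂ X₁).freeVars ⊆ B ∪ E := by
  refine freeVars_exs_subset (Set.union_subset (freeVars_exs_subset (freeVars_ands_subset
    (freeVars_grid_subset fun i hi j hj => freeVars_ceq_subset (vars_entry_subset hi hj ?_)
      (vars_entry_subset hi hj ?_)) (h₂.trans ?_))) (h₁.trans ?_))
  all_goals
    intro v hv
    simp only [blkSet, Set.mem_union, Set.mem_ofPred_eq] at hv ⊢
    tauto

theorem freeVars_accum_subset {X : ℕ → ExFormula} {B : Set RVar} {n : ℕ}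
    (h : ∀ k < n, (X k).freeVars ⊆ B) : (accum X n).freeVars ⊆ B := by
  induction n with
  | zero => exact freeVars_verum _
  | succ n ih => exact Set.union_subset (h n n.lt_succ_self) (ih fun k hk => h k (hk.trans
      n.lt_succ_self))

theorem freeVars_applyF_subset {f : Name} {n r c : ℕ} {X : ExFormula} {E : Set RVar}
    (h : X.freeVars ⊆ {v | ∃ k < n, v ∈ blkVars (.z (argBlk k)) r c} ∪ E) :
    (applyF f n r c X).freeVars ⊆ blkSet (.z outBlk) r c ∪ E := by
  refine freeVars_exs_subset (freeVars_ands_subset (freeVars_grid_subset fun i hi j hj =>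
    freeVars_ceq_subset (vars_entry_subset hi hj ?_) ?_) (h.trans ?_))
  · exact subset_trans Set.subset_union_left Set.subset_union_right
  · refine subset_trans ?_ Set.subset_union_left
    simp only [CTerm.vars, applyTerm, RTerm.vars, Set.union_subset_iff, Set.iUnion_subset_iff,
      List.mem_flatMap, List.mem_range, Set.singleton_subset_iff]
    have (k : Fin n) (p : Part) : ∃ l < n, RVar.z (argBlk k) i j p ∈ blkVars (.z (argBlk l)) r c :=
      ⟨k, k.2, mem_blkVars.2 ⟨i, hi, j, hj, p, rfl⟩⟩
    exact ⟨fun k => ⟨this k _, this k _⟩, fun k => ⟨this k _, this k _⟩⟩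
  · refine Set.union_subset_union ?_ Set.subset_union_right
    simp

theorem freeVars_eigBasisF_subset {n : ℕ} {B : Set RVar} (h : blkSet (.z outBlk) n n ⊆ B)
    (h' : blkSet (.z (argBlk 0)) n n ⊆ B) : (eigBasisF n).freeVars ⊆ B := by
  refine freeVars_exs_subset (freeVars_exs_subset ?_)
  set C := {v | v ∈ blkVars (RVar.z eigBlk₂) n n} ∪ ({v | v ∈ blkVars (RVar.z eigBlk₁) n n} ∪ B)
  replace h : blkSet (.z outBlk) n n ⊆ C := fun v hv => .inr (.inr (h hv))
  replace h' : blkSet (.z (argBlk 0)) n n ⊆ C := fun v hv => .inr (.inr (h' hv))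
  have h₁ : blkSet (.z eigBlk₁) n n ⊆ C := fun v hv => .inr (.inl hv)
  have h₂ : blkSet (.z eigBlk₂) n n ⊆ C := fun v hv => .inl hv
  have dot (a b : ℕ → CTerm) (t : CTerm) (ha : ∀ k < n, (a k).vars ⊆ C)
      (hb : ∀ k < n, (b k).vars ⊆ C) (ht : t.vars ⊆ C) :
      ∀ χ ∈ ceq (.sum n fun k => .mul (a k) (b k)) t, χ.freeVars ⊆ C :=
    freeVars_ceq_subset (vars_sum_subset fun k hk => vars_mul_subset (ha k hk) (hb k hk)) ht
  refine freeVars_ands_subset (freeVars_grid_subset fun i hi j hj =>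
    dot _ _ _ (fun k hk => vars_entry_subset hi hk h') (fun k hk => vars_entry_subset hk hj h)
      (vars_mul_subset (vars_entry_subset hj hj h₁) (vars_entry_subset hi hj h)))
    (freeVars_ands_subset (freeVars_range_subset fun i hi =>
    dot _ _ _ (fun k hk => vars_entry_subset hi hk h) (fun k hk => vars_entry_subset hk hi h₂)
      (vars_one_subset _)) (freeVars_ands_subset (freeVars_range_subset fun i hi =>
      freeVars_range_subset fun j hj => freeVars_append_subset
        (dot _ _ _ (fun k hk => vars_entry_subset hi hk h)
          (fun k hk => vars_entry_subset hk (hj.trans hi) h₂) (vars_zero_subset _))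
        (freeVars_append_subset (dot _ _ _ (fun k hk => vars_entry_subset (hj.trans hi) hk h)
          (fun k hk => vars_entry_subset hk hi h₂) (vars_zero_subset _)) ?_)) (freeVars_verum _)))
  simp only [List.mem_singleton, forall_eq]
  exact Set.union_subset (freeVars_cne_subset (vars_entry_subset hi hi h₁)
    (vars_entry_subset (hj.trans hi) (hj.trans hi) h₁)) (freeVars_ands_subset
      (dot _ _ _ (fun k hk => vars_conj_subset (vars_entry_subset hk hi h))
        (fun k hk => vars_entry_subset hk (hj.trans hi) h) (vars_zero_subset _)) (freeVars_verum _))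

theorem freeVars_eigDefectF_subset {n : ℕ} {B : Set RVar} (h : blkSet (.z outBlk) n n ⊆ B)
    (h' : blkSet (.z (argBlk 0)) n n ⊆ B) : (eigDefectF n).freeVars ⊆ B := by
  refine freeVars_exs_subset (freeVars_exs_subset (freeVars_exs_subset ?_))
  set C := {v | v ∈ blkVars (RVar.z eigBlk₃) n n} ∪ ({v | v ∈ blkVars (RVar.z eigBlk₂) n n} ∪
    ({v | v ∈ blkVars (RVar.z eigBlk₁) n n} ∪ B))
  replace h : blkSet (.z outBlk) n n ⊆ C := fun v hv => .inr (.inr (.inr (h hv)))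
  replace h' : blkSet (.z (argBlk 0)) n n ⊆ C := fun v hv => .inr (.inr (.inr (h' hv)))
  have h₁ : blkSet (.z eigBlk₁) n n ⊆ C := fun v hv => .inr (.inr (.inl hv))
  have h₂ : blkSet (.z eigBlk₂) n n ⊆ C := fun v hv => .inr (.inl hv)
  have h₃ : blkSet (.z eigBlk₃) n n ⊆ C := fun v hv => .inl hv
  have dot (a b : ℕ → CTerm) (t : CTerm) (ha : ∀ k < n, (a k).vars ⊆ C)
      (hb : ∀ k < n, (b k).vars ⊆ C) (ht : t.vars ⊆ C) :
      ∀ χ ∈ ceq (.sum n fun k => .mul (a k) (b k)) t, χ.freeVars ⊆ C :=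
    freeVars_ceq_subset (vars_sum_subset fun k hk => vars_mul_subset (ha k hk) (hb k hk)) ht
  refine freeVars_ands_subset (freeVars_grid_subset fun i hi j hj => freeVars_append_subset
    (freeVars_ceq_subset (vars_entry_subset hi hj h) (vars_zero_subset _)) (freeVars_append_subset
    (dot _ _ _ (fun k hk => vars_entry_subset hi hk h') (fun k hk => vars_entry_subset hk hj h₂)
      (vars_add_subset (vars_mul_subset (vars_entry_subset hj hj h₁) (vars_entry_subset hi hj h₂))
        (vars_entry_subset hi hj h₃)))
    (dot _ _ _ (fun k hk => vars_entry_subset hi hk h') (fun k hk => vars_entry_subset hk hj h₃)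
      (vars_mul_subset (vars_entry_subset hj hj h₁) (vars_entry_subset hi hj h₃))))) ?_
  rintro v (hv | hv)
  · simp [RTerm.vars] at hv
  · obtain ⟨i, hi, hv⟩ := (mem_vars_rsum _ _ _).1 hv
    obtain ⟨j, hj, hv⟩ := (mem_vars_rsum _ _ _).1 hv
    refine vars_entry_subset hi hj h₃ ?_
    simp only [normSqTerm, RTerm.vars] at hv
    simp only [CTerm.vars]
    simpa using hv

theorem freeVars_eigenF_subset {n : ℕ} {X : ExFormula} {E : Set RVar}
    (h : X.freeVars ⊆ blkSet (.z (argBlk 0)) n n ∪ E) :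
    (eigenF n n X).freeVars ⊆ blkSet (.z outBlk) n n ∪ E := by
  have hO : blkSet (.z outBlk) n n ⊆ {v | v ∈ blkVars (.z (argBlk 0)) n n} ∪
      (blkSet (.z outBlk) n n ∪ E) :=
    subset_trans Set.subset_union_left Set.subset_union_right
  refine freeVars_exs_subset (Set.union_subset (Set.union_subset
    (freeVars_eigBasisF_subset hO Set.subset_union_left)
    (freeVars_eigDefectF_subset hO Set.subset_union_left)) (h.trans ?_))
  exact Set.union_subset_union_right _ Set.subset_union_right

/-- The variables for the values of the variables in scope. -/
def Env.vars (env : Env) : Set RVar :=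
  {v | ∃ M r c, env.lookup (varBlk M) = some (r, c) ∧ v ∈ blkVars (.z (varBlk M)) r c}

/-- Only an inclusion, because a new variable hides an older one with the same name, whose block may
have had other dimensions. -/
theorem Env.vars_cons_subset (env : Env) (M : Name) (d : ℕ × ℕ) :
    Env.vars ((varBlk M, d) :: env) ⊆ blkSet (.z (varBlk M)) d.1 d.2 ∪ env.vars := by
  rintro v ⟨M', r, c, h, hv⟩
  by_cases hM : M' = M
  · subst hM
    simp only [List.lookup_cons_self, Option.some.injEq] at h
    subst h
    exact .inl hv
  · have : (varBlk M' == varBlk M) = false := by simpa [varBlk] using hM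
    rw [List.lookup_cons, this] at h
    exact .inr ⟨M', r, c, h, hv⟩

/-- The inclusion suffices: all these variables are bound again in the complete formula, whose free
variables come from the equations with the x- and y-variables. -/
theorem freeVars_trans_subset {S : Name → Option Ty} {e : Expr} {τ : Ty} (h : HasType S e τ)
    {σ : Name → ℕ} {env : Env} (hE : env.Fits S σ) :
    (trans env e).freeVars ⊆ blkSet (.z outBlk) (τ.1.value σ) (τ.2.value σ) ∪ env.vars := by
  induction h generalizing env with
  | @var S M τ h =>
    rw [trans, dims_eq (.var h) hE]
    refine freeVars_varF_subset Set.subset_union_left (subset_trans ?_ Set.subset_union_right)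
    intro v hv
    exact ⟨M, _, _, by rw [hE, h]; rfl, hv⟩
  | letIn h₁ h₂ ih₁ ih₂ =>
    rw [trans, dims_eq h₁ hE]
    refine freeVars_letF_subset ((ih₂ (hE.update _ _)).trans ?_) (freeVars_wrap_subset (ih₁ hE))
    exact Set.union_subset_union_right _ (Env.vars_cons_subset _ _ _)
  | transp h ih =>
    rw [trans, dims_eq h hE]
    exact freeVars_transpF_subset (freeVars_wrap_subset (ih hE))
  | ones h ih =>
    rw [trans, dims_eq h hE]
    exact freeVars_onesF_subset (freeVars_wrap_subset (ih hE))
  | diag h ih =>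
    rw [trans, dims_eq h hE]
    exact freeVars_diagF_subset (freeVars_wrap_subset (ih hE))
  | mul h₁ h₂ ih₁ ih₂ =>
    rw [trans, dims_eq h₁ hE, dims_eq h₂ hE]
    exact freeVars_mulF_subset (freeVars_wrap_subset (ih₂ hE)) (freeVars_wrap_subset (ih₁ hE))
  | apply hn h ih =>
    rw [trans, dims_eq (.apply hn h) hE]
    refine freeVars_applyF_subset (freeVars_accum_subset fun k hk => ?_)
    rw [dif_pos hk, dims_eq (h _) hE]
    refine (freeVars_wrap_subset (ih _ hE)).trans (Set.union_subset_union_left _ ?_)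
    exact fun v hv => ⟨k, hk, hv⟩
  | eigen h ih =>
    rw [trans, dims_eq h hE]
    exact freeVars_eigenF_subset (freeVars_wrap_subset (ih hE))

end Matlang

namespace Matlang

/-! ### Semantics of the combinators -/

variable {Ω : Interp} {ρ : RVar → ℝ}

theorem holds_ands {l : List ExFormula} {φ : ExFormula} :
    (ands l φ).Holds Ω ρ ↔ (∀ ψ ∈ l, ψ.Holds Ω ρ) ∧ φ.Holds Ω ρ := by
  induction l with
  | nil => simp [ands]
  | cons ψ l ih =>
    change ψ.Holds Ω ρ ∧ (ands l φ).Holds Ω ρ ↔ _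
    rw [ih]
    simp [and_assoc]

/-- The values of all variables of a prefix can be chosen at once. Repetitions in `l` do no harm,
since the final values of ρ' may be used at every quantifier. -/
theorem holds_exs {l : List RVar} {φ : ExFormula} :
    (exs l φ).Holds Ω ρ ↔ ∃ ρ', (∀ v ∉ l, ρ' v = ρ v) ∧ φ.Holds Ω ρ' := by
  induction l generalizing ρ with
  | nil =>
    refine ⟨fun h => ⟨ρ, fun _ _ => rfl, h⟩, ?_⟩
    rintro ⟨ρ', h, h'⟩
    obtain rfl : ρ' = ρ := funext fun v => h v (List.not_mem_nil)
    exact h'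
  | cons w l ih =>
    change (∃ r : ℝ, (exs l φ).Holds Ω (Function.update ρ w r)) ↔ _
    constructor
    · rintro ⟨r, h⟩
      obtain ⟨ρ', h1, h2⟩ := ih.1 h
      refine ⟨ρ', fun v hv => ?_, h2⟩
      simp only [List.mem_cons, not_or] at hv
      rw [h1 v hv.2, Function.update_of_ne hv.1]
    · rintro ⟨ρ', h1, h2⟩
      refine ⟨ρ' w, ih.2 ⟨ρ', fun v hv => ?_, h2⟩⟩
      by_cases hw : v = w
      · subst hw; simp
      · rw [Function.update_of_ne hw]
        exact h1 v (by simp [hw, hv])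

theorem holds_verum : verum.Holds Ω ρ := rfl

/-- The complex number given by the variables at a position of a block. -/
def get (b : Blk) (ρ : RVar → ℝ) (i j : ℕ) : ℂ := ⟨ρ (b i j .re), ρ (b i j .im)⟩

/-- The matrix given by the variables of a block. -/
def mat (b : Blk) (ρ : RVar → ℝ) (r c : ℕ) : Matrix (Fin r) (Fin c) ℂ :=
  Matrix.of fun i j => get b ρ i j

@[simp] theorem mat_apply (b : Blk) (ρ : RVar → ℝ) (r c : ℕ) (i : Fin r) (j : Fin c) :
    mat b ρ r c i j = get b ρ i j := rfl

@[simp] theorem value_entry (b : Blk) (i j : ℕ) : (CTerm.entry b i j).value Ω ρ = get b ρ i j := rfl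

@[simp] theorem value_zero : CTerm.zero.value Ω ρ = 0 := by
  simp [CTerm.value, CTerm.zero, RTerm.value, Complex.ext_iff]

@[simp] theorem value_one : CTerm.one.value Ω ρ = 1 := by
  simp [CTerm.value, CTerm.one, RTerm.value, Complex.ext_iff]

@[simp] theorem value_add (a b : CTerm) :
    (a.add b).value Ω ρ = a.value Ω ρ + b.value Ω ρ := by
  simp [CTerm.value, CTerm.add, RTerm.value, Complex.ext_iff]

@[simp] theorem value_mul (a b : CTerm) :
    (a.mul b).value Ω ρ = a.value Ω ρ * b.value Ω ρ := by
  simp [CTerm.value, CTerm.mul, RTerm.value, Complex.ext_iff, sub_eq_add_neg]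

@[simp] theorem value_conj (a : CTerm) : a.conj.value Ω ρ = star (a.value Ω ρ) := by
  simp [CTerm.value, CTerm.conj, RTerm.value, Complex.ext_iff]

theorem value_rsum (n : ℕ) (t : ℕ → RTerm) :
    (rsum n t).value Ω ρ = ∑ k : Fin n, (t k).value Ω ρ := by
  have : ∀ l : List ℕ, (l.foldr (fun k u => RTerm.add (t k) u) (.int 0)).value Ω ρ =
      (l.map fun k => (t k).value Ω ρ).sum := by
    intro l
    induction l with
    | nil => simp [RTerm.value]
    | cons k l ih => simp [RTerm.value, ih]
  rw [rsum, this, Fin.sum_univ_eq_sum_range fun k => (t k).value Ω ρ]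
  rfl

@[simp] theorem value_sum (n : ℕ) (t : ℕ → CTerm) :
    (CTerm.sum n t).value Ω ρ = ∑ k : Fin n, (t k).value Ω ρ := by
  simp [CTerm.value, CTerm.sum, value_rsum, Complex.ext_iff]

theorem holds_ceq {a b : CTerm} :
    (∀ χ ∈ ceq a b, χ.Holds Ω ρ) ↔ a.value Ω ρ = b.value Ω ρ := by
  simp [ceq, CTerm.value, ExFormula.Holds]

theorem holds_cne {a b : CTerm} : (cne a b).Holds Ω ρ ↔ a.value Ω ρ ≠ b.value Ω ρ := by
  simp only [cne, ExFormula.Holds, CTerm.value, ne_eq, Complex.mk.injEq, not_and_or]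
  rw [← ne_eq, ← ne_eq, lt_or_lt_iff_ne, lt_or_lt_iff_ne]

theorem forall_range_flatMap {n : ℕ} {ψ : ℕ → List ExFormula} :
    (∀ χ ∈ (List.range n).flatMap ψ, χ.Holds Ω ρ) ↔ ∀ i : Fin n, ∀ χ ∈ ψ i, χ.Holds Ω ρ := by
  simp only [List.mem_flatMap, List.mem_range]
  constructor
  · exact fun h i χ hχ => h χ ⟨i, i.2, hχ⟩
  · rintro h χ ⟨i, hi, hχ⟩
    exact h ⟨i, hi⟩ χ hχ

theorem forall_grid {r c : ℕ} {ψ : ℕ → ℕ → List ExFormula} :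
    (∀ χ ∈ grid r c ψ, χ.Holds Ω ρ) ↔
      ∀ (i : Fin r) (j : Fin c), ∀ χ ∈ ψ i j, χ.Holds Ω ρ := by
  simp only [grid, forall_range_flatMap]

theorem forall_append {l l' : List ExFormula} :
    (∀ χ ∈ l ++ l', χ.Holds Ω ρ) ↔ (∀ χ ∈ l, χ.Holds Ω ρ) ∧ ∀ χ ∈ l', χ.Holds Ω ρ := by
  simp [or_imp, forall_and]

/-- Assign the entries of a matrix to a block. -/
def setBlk (ρ : RVar → ℝ) (w : Name) {r c : ℕ} (A : Matrix (Fin r) (Fin c) ℂ) : RVar → ℝ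
  | .z w' i j p => if h : w' = w ∧ i < r ∧ j < c then p.get (A ⟨i, h.2.1⟩ ⟨j, h.2.2⟩)
      else ρ (.z w' i j p)
  | v => ρ v

theorem setBlk_of_notMem {w : Name} {r c : ℕ} {A : Matrix (Fin r) (Fin c) ℂ} {v : RVar}
    (hv : v ∉ blkVars (.z w) r c) : setBlk ρ w A v = ρ v := by
  cases v with
  | z w' i j p =>
    rw [setBlk, dif_neg]
    rintro ⟨rfl, hi, hj⟩
    exact hv (mem_blkVars.2 ⟨i, hi, j, hj, p, rfl⟩)
  | _ => rfl

@[simp] theorem get_setBlk_self (w : Name) {r c : ℕ} (A : Matrix (Fin r) (Fin c) ℂ) (i : Fin r)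
    (j : Fin c) : get (.z w) (setBlk ρ w A) i j = A i j := by
  simp [get, setBlk, Part.get]

@[simp] theorem mat_setBlk_self (w : Name) {r c : ℕ} (A : Matrix (Fin r) (Fin c) ℂ) :
    mat (.z w) (setBlk ρ w A) r c = A := by
  ext i j
  simp

theorem get_setBlk_ne {w w' : Name} (h : w' ≠ w) {r c : ℕ} (A : Matrix (Fin r) (Fin c) ℂ)
    (i j : ℕ) : get (.z w') (setBlk ρ w A) i j = get (.z w') ρ i j := by
  simp [get, setBlk, h]

theorem mat_setBlk_ne {w w' : Name} (h : w' ≠ w) {r c : ℕ} (A : Matrix (Fin r) (Fin c) ℂ)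
    (r' c' : ℕ) : mat (.z w') (setBlk ρ w A) r' c' = mat (.z w') ρ r' c' := by
  ext i j
  simp [get_setBlk_ne h]

/-- The bridge from reals to matrices: from here on, a quantifier prefix over a block is treated as
one quantifier over complex matrices. -/
theorem holds_exs_blk {w : Name} {r c : ℕ} {φ : ExFormula} :
    (exs (blkVars (.z w) r c) φ).Holds Ω ρ ↔
      ∃ A : Matrix (Fin r) (Fin c) ℂ, φ.Holds Ω (setBlk ρ w A) := by
  rw [holds_exs]
  constructor
  · rintro ⟨ρ', h, h'⟩
    refine ⟨mat (.z w) ρ' r c, ?_⟩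
    convert h' using 1
    funext v
    by_cases hv : v ∈ blkVars (.z w) r c
    · obtain ⟨i, hi, j, hj, p, rfl⟩ := mem_blkVars.1 hv
      cases p <;> simp [setBlk, hi, hj, get, Part.get]
    · rw [setBlk_of_notMem hv, h v hv]
  · rintro ⟨A, h⟩
    exact ⟨_, fun v hv => setBlk_of_notMem hv, h⟩

/-- The instance that is given by the blocks of the variables in scope. -/
def Env.inst (env : Env) (ρ : RVar → ℝ) : Inst := fun M =>
  (env.lookup (varBlk M)).map fun d => ⟨d.1, d.2, mat (.z (varBlk M)) ρ d.1 d.2⟩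

theorem Env.inst_congr (env : Env) {ρ ρ' : RVar → ℝ}
    (h : ∀ M i j, get (.z (varBlk M)) ρ i j = get (.z (varBlk M)) ρ' i j) :
    env.inst ρ = env.inst ρ' := by
  funext M
  simp only [Env.inst]
  congr 1
  funext d
  congr 1
  ext i j
  exact h _ _ _

/-- The first bit of a name separates the auxiliary blocks from the blocks of variables in scope, so
binding an auxiliary block does not change the instance. -/
theorem Env.inst_setBlk (env : Env) (w : Name) {r c : ℕ} (A : Matrix (Fin r) (Fin c) ℂ) :
    env.inst (setBlk ρ (true :: w) A) = env.inst ρ :=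
  env.inst_congr fun M => get_setBlk_ne (by simp [varBlk]) A

/-- Overwriting the block implements hiding. If an older block with this name was larger, its
remaining entries keep their values, but the new dimensions prevent them from being read. -/
theorem Env.inst_cons_setBlk (env : Env) (M : Name) {r c : ℕ} (A : Matrix (Fin r) (Fin c) ℂ) :
    Env.inst ((varBlk M, r, c) :: env) (setBlk ρ (varBlk M) A) =
      Function.update (env.inst ρ) M (some ⟨r, c, A⟩) := by
  funext M'
  by_cases hM : M' = M
  · subst hM; simp [Env.inst]
  · have h : varBlk M' ≠ varBlk M := by simpa [varBlk] using hM
    have h' : (varBlk M' == varBlk M) = false := by simpa using h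
    simp [Env.inst, hM, List.lookup_cons, h', mat_setBlk_ne h]

/-- `φ` expresses that the result block belongs to `R`, given the instance. -/
def Means (Ω : Interp) (env : Env) (r c : ℕ) (φ : ExFormula) (R : Inst → Set Mat) : Prop :=
  ∀ ρ, φ.Holds Ω ρ ↔ ⟨r, c, mat (.z outBlk) ρ r c⟩ ∈ R (env.inst ρ)

theorem argBlk_eq (k : ℕ) : argBlk k = true :: List.replicate (k + 1) true := rfl

theorem outBlk_ne_argBlk (k : ℕ) : outBlk ≠ argBlk k := by
  simp [outBlk, argBlk, List.replicate_succ]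

theorem argBlk_inj {k l : ℕ} : argBlk k = argBlk l ↔ k = l := by
  refine ⟨fun h => ?_, fun h => h ▸ rfl⟩
  simpa [argBlk] using congrArg List.length h

theorem mat_eq_iff {b : Blk} {r c : ℕ} {A : Matrix (Fin r) (Fin c) ℂ} :
    (∀ (i : Fin r) (j : Fin c), get b ρ i j = A i j) ↔ mat b ρ r c = A :=
  ⟨fun h => by ext i j; exact h i j, fun h i j => by rw [← h]; rfl⟩

/-- The local quantifier frees the result block for the enclosing operation; the equations leave
only one choice for it. -/
theorem Means.holds_wrap {env : Env} {r c : ℕ} {φ : ExFormula} {R : Inst → Set Mat}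
    (h : Means Ω env r c φ R) (k : ℕ) :
    (wrap k r c φ).Holds Ω ρ ↔ ⟨r, c, mat (.z (argBlk k)) ρ r c⟩ ∈ R (env.inst ρ) := by
  rw [wrap, holds_exs_blk]
  have key (A : Matrix (Fin r) (Fin c) ℂ) : (ands (grid r c fun i j =>
      ceq (.entry (.z outBlk) i j) (.entry (.z (argBlk k)) i j)) φ).Holds Ω (setBlk ρ outBlk A) ↔
      mat (.z (argBlk k)) ρ r c = A ∧ ⟨r, c, A⟩ ∈ R (env.inst ρ) := by
    rw [holds_ands, forall_grid, h (setBlk ρ outBlk A), mat_setBlk_self, outBlk, Env.inst_setBlk,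
      ← mat_eq_iff]
    simp only [holds_ceq, value_entry, get_setBlk_self]
    refine and_congr_left fun _ => forall_congr' fun i => forall_congr' fun j => ?_
    rw [get_setBlk_ne (by simp [argBlk, List.replicate_succ]), eq_comm]
  simp only [key, exists_eq_left']

theorem means_varF {env : Env} {M : Name} {r c : ℕ} (h : env.lookup (varBlk M) = some (r, c)) :
    Means Ω env r c (varF (varBlk M) r c) ((Expr.var M).results Ω) := by
  intro ρ
  rw [varF, holds_ands, forall_grid]
  simp only [holds_ceq, value_entry, holds_verum, and_true, Expr.results, Set.mem_ofPred_eq,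
    Env.inst, h, Option.map_some, Option.some.injEq, Mat.mk.injEq, heq_eq_eq, true_and]
  rw [eq_comm (a := mat _ _ _ _)]
  exact mat_eq_iff (A := mat (.z (varBlk M)) ρ r c)

theorem Means.transpF {env : Env} {r c : ℕ} {φ : ExFormula} {e : Expr}
    (h : Means Ω env r c φ (e.results Ω)) :
    Means Ω env c r (transpF r c (wrap 0 r c φ)) ((Expr.transp e).results Ω) := by
  intro ρ
  rw [Matlang.transpF, holds_exs_blk]
  simp only [holds_ands, forall_grid, h.holds_wrap, holds_ceq, value_entry, value_conj,
    get_setBlk_self, mat_setBlk_self, argBlk_eq 0, Env.inst_setBlk, Expr.results,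
      Set.mem_ofPred_eq, Mat.mk.injEq]
  constructor
  · rintro ⟨A, h1, h2⟩
    refine ⟨r, c, A, h2, rfl, rfl, heq_of_eq ?_⟩
    ext i j
    exact h1 j i
  · rintro ⟨m, n, A, h1, rfl, rfl, h2⟩
    refine ⟨A, fun i j => ?_, h1⟩
    have := congrFun (congrFun (eq_of_heq h2) j) i
    exact this

/-- The number of columns of the argument is not visible in the result, so `hd` has to exclude
possible results of e of other dimensions. The same holds for the inner dimension of a product and
for the value of a `let`. -/
theorem Means.onesF {env : Env} {r c : ℕ} {φ : ExFormula} {e : Expr}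
    (h : Means Ω env r c φ (e.results Ω))
    (hd : ∀ ρ, ∀ A ∈ e.results Ω (env.inst ρ), A.rows = r ∧ A.cols = c) :
    Means Ω env r 1 (onesF r c (wrap 0 r c φ)) ((Expr.ones e).results Ω) := by
  intro ρ
  rw [Matlang.onesF, holds_exs_blk]
  simp only [holds_ands, forall_range_flatMap, h.holds_wrap, holds_ceq, value_entry, value_one,
    mat_setBlk_self, argBlk_eq 0, Env.inst_setBlk, Expr.results, Set.mem_ofPred_eq, Mat.mk.injEq]
  constructor
  · rintro ⟨A, h1, h2⟩
    refine ⟨r, c, A, h2, rfl, trivial, heq_of_eq ?_⟩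
    ext i j
    obtain rfl : j = 0 := Subsingleton.elim _ _
    exact h1 i
  · rintro ⟨m, n, A, h1, h3, -, h2⟩
    obtain ⟨rfl, rfl⟩ := hd ρ _ h1
    refine ⟨A, fun i => ?_, h1⟩
    exact congrFun (congrFun (eq_of_heq h2) i) 0

/-- Off-diagonal positions are listed as the pairs (i, j) and (j, i) with j < i. In this form they
can be enumerated by nested counting, without a test i ≠ j. -/
theorem diag_iff {r : ℕ} {f : ℕ → ℕ → ℂ} {A : Matrix (Fin r) (Fin 1) ℂ} :
    (∀ i : Fin r, f i i = A i 0 ∧ ∀ j : Fin i, f i j = 0 ∧ f j i = 0) ↔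
      Matrix.of (fun i j : Fin r => f i j) = Matrix.diagonal fun i => A i 0 := by
  constructor
  · intro h
    ext i j
    rcases lt_trichotomy i j with hij | rfl | hij
    · simpa [hij.ne] using ((h j).2 ⟨i, hij⟩).2
    · simpa using (h i).1
    · simpa [hij.ne'] using ((h i).2 ⟨j, hij⟩).1
  · intro h i
    have h' (i j : Fin r) := congrFun (congrFun h i) j
    refine ⟨by simpa using h' i i, fun j => ?_⟩
    have hne : i ≠ ⟨j, j.2.trans i.2⟩ := by
      intro h0
      have := congrArg Fin.val h0
      have := j.2
      simp_all
    refine ⟨?_, ?_⟩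
    · simpa [hne] using h' i ⟨j, j.2.trans i.2⟩
    · simpa [hne.symm] using h' ⟨j, j.2.trans i.2⟩ i

theorem Means.diagF {env : Env} {r : ℕ} {φ : ExFormula} {e : Expr}
    (h : Means Ω env r 1 φ (e.results Ω)) :
    Means Ω env r r (diagF r 1 (wrap 0 r 1 φ)) ((Expr.diag e).results Ω) := by
  intro ρ
  rw [Matlang.diagF, holds_exs_blk]
  have h0 (A : Matrix (Fin r) (Fin 1) ℂ) (i : Fin r) :
      get (.z (argBlk 0)) (setBlk ρ (argBlk 0) A) i 0 = A i 0 := get_setBlk_self _ A i 0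
  simp only [holds_ands, forall_range_flatMap, forall_append, h.holds_wrap, holds_ceq, value_entry,
    value_zero, h0, diag_iff, mat_setBlk_self, get_setBlk_ne (outBlk_ne_argBlk 0)]
  simp only [argBlk_eq 0, Env.inst_setBlk, Expr.results, Set.mem_ofPred_eq, Mat.mk.injEq]
  constructor
  · rintro ⟨A, h1, h2⟩
    exact ⟨r, A, h2, rfl, rfl, heq_of_eq h1⟩
  · rintro ⟨m, A, h1, rfl, -, h2⟩
    exact ⟨A, eq_of_heq h2, h1⟩

theorem Means.mulF {env : Env} {r m c : ℕ} {φ₁ φ₂ : ExFormula} {e₁ e₂ : Expr}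
    (h₁ : Means Ω env r m φ₁ (e₁.results Ω)) (h₂ : Means Ω env m c φ₂ (e₂.results Ω))
    (hd : ∀ ρ, ∀ A ∈ e₁.results Ω (env.inst ρ), A.rows = r ∧ A.cols = m) :
    Means Ω env r c (mulF r m c (wrap 1 m c φ₂) (wrap 0 r m φ₁)) ((Expr.mul e₁ e₂).results Ω) := by
  intro ρ
  have h01 : argBlk 0 ≠ argBlk 1 := by simp [argBlk_inj]
  rw [Matlang.mulF, holds_exs_blk]
  simp only [holds_exs_blk]
  simp only [holds_ands, forall_grid, ExFormula.Holds, h₁.holds_wrap, h₂.holds_wrap, holds_ceq,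
    value_entry, value_sum, value_mul, mat_setBlk_self, get_setBlk_ne (outBlk_ne_argBlk _),
    mat_setBlk_ne h01, get_setBlk_ne h01, get_setBlk_self]
  simp only [argBlk_eq, Env.inst_setBlk, Expr.results, Set.mem_ofPred_eq, Mat.mk.injEq]
  constructor
  · rintro ⟨A, B, h3, h4, h5⟩
    refine ⟨r, m, c, A, B, h5, h4, rfl, rfl, heq_of_eq ?_⟩
    ext i j
    rw [Matrix.mul_apply]
    exact h3 i j
  · rintro ⟨r', m', c', A, B, h3, h4, rfl, rfl, h5⟩
    obtain ⟨-, h6⟩ := hd ρ _ h3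
    obtain rfl : m' = m := h6
    refine ⟨A, B, fun i j => ?_, h4, h3⟩
    rw [← Matrix.mul_apply, ← eq_of_heq h5]
    rfl

/-- The value is chosen in an argument block and then copied to the block of M inside a smaller
scope: e₁ may itself mention an outer M, so its formula has to stand outside the quantifier over
`varBlk M`. -/
theorem Means.letF {env : Env} {M : Name} {r c r' c' : ℕ} {φ₁ φ₂ : ExFormula} {e₁ e₂ : Expr}
    (h₁ : Means Ω env r c φ₁ (e₁.results Ω))
    (h₂ : Means Ω ((varBlk M, r, c) :: env) r' c' φ₂ (e₂.results Ω))
    (hd : ∀ ρ, ∀ A ∈ e₁.results Ω (env.inst ρ), A.rows = r ∧ A.cols = c) :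
    Means Ω env r' c' (letF (varBlk M) r c φ₂ (wrap 0 r c φ₁)) ((Expr.letIn M e₁ e₂).results Ω) :=
      by
  intro ρ
  have h0 : argBlk 0 ≠ varBlk M := by simp [argBlk_eq, varBlk]
  have h0' : outBlk ≠ varBlk M := by simp [outBlk, varBlk]
  rw [Matlang.letF, holds_exs_blk]
  simp only [ExFormula.Holds, h₁.holds_wrap, mat_setBlk_self, holds_exs_blk]
  have key (A B : Matrix (Fin r) (Fin c) ℂ) : (ands (grid r c fun i j =>
      ceq (.entry (.z (varBlk M)) i j) (.entry (.z (argBlk 0)) i j)) φ₂).Holds Ω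
        (setBlk (setBlk ρ (argBlk 0) A) (varBlk M) B) ↔
      A = B ∧ ⟨r', c', mat (.z outBlk) ρ r' c'⟩ ∈
        e₂.results Ω (Function.update (env.inst ρ) M (some ⟨r, c, B⟩)) := by
    rw [holds_ands, forall_grid, h₂ _, Env.inst_cons_setBlk, mat_setBlk_ne h0',
      mat_setBlk_ne (outBlk_ne_argBlk 0), argBlk_eq, Env.inst_setBlk, ← argBlk_eq]
    simp only [holds_ceq, value_entry, get_setBlk_ne h0, get_setBlk_self]
    rw [← Matrix.ext_iff]
    simp only [eq_comm]
  simp only [key, exists_eq_left']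
  simp only [argBlk_eq 0, Env.inst_setBlk, Expr.results, Set.mem_ofPred_eq]
  constructor
  · rintro ⟨A, h3, h4⟩
    exact ⟨_, h4, h3⟩
  · rintro ⟨⟨m, n, A⟩, h3, h4⟩
    obtain ⟨h5, h6⟩ := hd ρ _ h3
    obtain rfl : m = r := h5
    obtain rfl : n = c := h6
    exact ⟨A, h4, h3⟩

theorem holds_accum {X : ℕ → ExFormula} {n : ℕ} :
    (accum X n).Holds Ω ρ ↔ ∀ k : Fin n, (X k).Holds Ω ρ := by
  induction n with
  | zero => simp [accum, holds_verum]
  | succ n ih =>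
    change (X n).Holds Ω ρ ∧ (accum X n).Holds Ω ρ ↔ _
    rw [ih, Fin.forall_fin_succ', and_comm]
    rfl

/-- Assign the entries of matrices to the blocks for arguments. -/
def setArgs (ρ : RVar → ℝ) {n r c : ℕ} (A : Fin n → Matrix (Fin r) (Fin c) ℂ) : RVar → ℝ
  | .z w i j p => if h : w = argBlk (w.length - 2) ∧ w.length - 2 < n ∧ i < r ∧ j < c then
      p.get (A ⟨w.length - 2, h.2.1⟩ ⟨i, h.2.2.1⟩ ⟨j, h.2.2.2⟩) else ρ (.z w i j p)
  | v => ρ v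

/-- The blocks of all n arguments are assigned simultaneously. The number of an argument is
recovered from the length of the name of its block, which is the number plus 2. -/
theorem holds_exs_args {n r c : ℕ} {φ : ExFormula} :
    (exs ((List.range n).flatMap fun k => blkVars (.z (argBlk k)) r c) φ).Holds Ω ρ ↔
      ∃ A : Fin n → Matrix (Fin r) (Fin c) ℂ, φ.Holds Ω (setArgs ρ A) := by
  rw [holds_exs]
  constructor
  · rintro ⟨ρ', h, h'⟩
    refine ⟨fun k => mat (.z (argBlk k)) ρ' r c, ?_⟩
    convert h' using 1
    funext v
    by_cases hv : v ∈ (List.range n).flatMap fun k => blkVars (.z (argBlk k)) r c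
    · simp only [List.mem_flatMap, List.mem_range, mem_blkVars] at hv
      obtain ⟨k, hk, i, hi, j, hj, p, rfl⟩ := hv
      cases p <;> simp [setArgs, argBlk, hk, hi, hj, get, Part.get]
    · rw [h v hv]
      cases v with
      | z w i j p =>
        rw [setArgs, dif_neg]
        rintro ⟨h1, h2, hi, hj⟩
        refine hv (List.mem_flatMap.2 ⟨w.length - 2, List.mem_range.2 h2,
          mem_blkVars.2 ⟨i, hi, j, hj, p, ?_⟩⟩)
        rw [← h1]
      | _ => rfl
  · rintro ⟨A, h⟩
    refine ⟨_, fun v hv => ?_, h⟩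
    cases v with
    | z w i j p =>
      rw [setArgs, dif_neg]
      rintro ⟨h1, h2, hi, hj⟩
      refine hv (List.mem_flatMap.2 ⟨w.length - 2, List.mem_range.2 h2,
        mem_blkVars.2 ⟨i, hi, j, hj, p, ?_⟩⟩)
      rw [← h1]
    | _ => rfl

theorem setArgs_arg {n r c : ℕ} (A : Fin n → Matrix (Fin r) (Fin c) ℂ) (k : Fin n) (i : Fin r)
    (j : Fin c) (p : Part) : setArgs ρ A (.z (argBlk k) i j p) = p.get (A k i j) := by
  simp [setArgs, argBlk]

theorem mat_setArgs {n r c : ℕ} (A : Fin n → Matrix (Fin r) (Fin c) ℂ) (k : Fin n) :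
    mat (.z (argBlk k)) (setArgs ρ A) r c = A k := by
  ext i j
  simp [get, setArgs_arg, Part.get]

theorem get_setArgs_ne {n r c : ℕ} (A : Fin n → Matrix (Fin r) (Fin c) ℂ) {w : Name}
    (hw : ∀ k, w ≠ argBlk k) (i j : ℕ) : get (.z w) (setArgs ρ A) i j = get (.z w) ρ i j := by
  simp [get, setArgs, hw]

theorem Means.applyF {env : Env} {f : Name} {n r c : ℕ} {args : Fin n → Expr}
    {φ : Fin n → ExFormula} (h : ∀ k, Means Ω env r c (φ k) ((args k).results Ω)) :
    Means Ω env r c (applyF f n r c (accum (fun k => if h : k < n then wrap k r c (φ ⟨k, h⟩)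
      else verum) n)) ((Expr.apply f n args).results Ω) := by
  intro ρ
  rw [Matlang.applyF, holds_exs_args]
  have hO (A : Fin n → Matrix (Fin r) (Fin c) ℂ) (i j : ℕ) :=
    get_setArgs_ne (ρ := ρ) A outBlk_ne_argBlk i j
  have hI (A : Fin n → Matrix (Fin r) (Fin c) ℂ) : env.inst (setArgs ρ A) = env.inst ρ :=
    env.inst_congr fun M => get_setArgs_ne A (by simp [varBlk, argBlk_eq])
  have hf (A : Fin n → Matrix (Fin r) (Fin c) ℂ) (i : Fin r) (j : Fin c) :
      CTerm.value Ω (setArgs ρ A) ⟨applyTerm f .re n i j, applyTerm f .im n i j⟩ =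
        Ω f n fun k => A k i j := by
    simp [CTerm.value, applyTerm, RTerm.value, setArgs_arg, Part.get]
  simp only [holds_ands, forall_grid, holds_accum, holds_ceq, value_entry, hO, hf, Fin.is_lt,
    dif_pos, (h _).holds_wrap, hI, Expr.results, Set.mem_ofPred_eq, Mat.mk.injEq, Fin.eta,
    mat_setArgs]
  constructor
  · rintro ⟨A, h1, h2⟩
    refine ⟨r, c, A, h2, rfl, rfl, heq_of_eq ?_⟩
    ext i j
    exact h1 i j
  · rintro ⟨r', c', A, h1, rfl, rfl, h2⟩
    exact ⟨A, fun i j => congrFun (congrFun (eq_of_heq h2) i) j, h1⟩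

end Matlang

namespace Matlang

/-! ### Eigenvector bases -/

theorem isEigenvector_iff {n : ℕ} {A : Matrix (Fin n) (Fin n) ℂ} {μ : ℂ} {v : Fin n → ℂ} :
    IsEigenvector A μ v ↔ A.mulVec v = μ • v ∧ v ≠ 0 := by
  rw [IsEigenvector, Module.End.hasEigenvector_iff, Module.End.mem_eigenspace_iff,
    Matrix.toLin'_apply]

theorem IsOrthoEigenbasis.isDiagonalizable {n : ℕ} {A B : Matrix (Fin n) (Fin n) ℂ}
    (h : IsOrthoEigenbasis A B) : IsDiagonalizable A :=
  ⟨Module.Basis.mk h.1.1 h.1.2.ge, fun j => by simpa using h.2.1 j⟩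

theorem isEigenvector_unique {n : ℕ} {A : Matrix (Fin n) (Fin n) ℂ} {μ ν : ℂ} {v : Fin n → ℂ}
    (h : IsEigenvector A μ v) (h' : IsEigenvector A ν v) : μ = ν := by
  rw [isEigenvector_iff] at h h'
  have h1 : (μ - ν) • v = 0 := by rw [sub_smul, ← h.1, ← h'.1, sub_self]
  exact sub_eq_zero.1 ((smul_eq_zero.1 h1).resolve_right h.2)

/-- A square matrix with a right inverse is invertible, so its columns form a basis; in particular
they are nonzero, and the column equations make them eigenvectors for the values L j j. An
eigenvector determines its eigenvalue, hence two columns share one exactly if their L's agree.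
Orthogonality is symmetric up to conjugation, so the pairs with j < i suffice. Of L only the
diagonal matters. -/
theorem isOrthoEigenbasis_iff {n : ℕ} {A B : Matrix (Fin n) (Fin n) ℂ} :
    IsOrthoEigenbasis A B ↔ ∃ L C : Matrix (Fin n) (Fin n) ℂ,
      (∀ i j, (A * B) i j = L j j * B i j) ∧ B * C = 1 ∧
      ∀ i j, j < i → L i i ≠ L j j ∨ star (B.col i) ⬝ᵥ B.col j = 0 := by
  constructor
  · rintro ⟨⟨h1, -⟩, h2, h3⟩
    choose μ hμ using h2
    have hu : IsUnit B := Matrix.linearIndependent_cols_iff_isUnit.1 h1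
    refine ⟨Matrix.diagonal μ, B⁻¹, fun i j => ?_, ?_, fun i j hij => ?_⟩
    · have := congrFun (isEigenvector_iff.1 (hμ j)).1 i
      simpa [Matrix.mul_apply, Matrix.mulVec, dotProduct] using this
    · exact Matrix.mul_nonsing_inv _ ((Matrix.isUnit_iff_isUnit_det _).1 hu)
    · by_cases h : μ i = μ j
      · exact .inr (h3 i j (μ i) hij.ne' (hμ i) (h ▸ hμ j))
      · exact .inl (by simpa using h)
  · rintro ⟨L, C, h1, h2, h3⟩
    have hu : IsUnit B := IsUnit.of_mul_eq_one C h2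
    have hli : LinearIndependent ℂ B.col := Matrix.linearIndependent_cols_iff_isUnit.2 hu
    have hL (j : Fin n) : IsEigenvector A (L j j) (B.col j) := by
      rw [isEigenvector_iff]
      refine ⟨?_, hli.ne_zero j⟩
      ext i
      have := h1 i j
      simpa [Matrix.mul_apply, Matrix.mulVec, dotProduct] using this
    refine ⟨⟨hli, hli.span_eq_top_of_card_eq_finrank' (by simp)⟩, fun j => ⟨_, hL j⟩, ?_⟩
    intro i j μ hij hi hj
    have h4 : L i i = L j j := (isEigenvector_unique (hL i) hi).trans
      (isEigenvector_unique (hL j) hj).symm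
    rcases lt_or_gt_of_ne hij with h | h
    · have := (h3 j i h).resolve_left (by simp [h4])
      rwa [← star_eq_zero, Matrix.star_dotProduct, star_star] at this
    · exact (h3 i j h).resolve_left (by simp [h4])

/-- The hypothesis says that (A - μ)²v = 0 implies (A - μ)v = 0. By induction on the exponent,
generalized eigenspaces are eigenspaces; over ℂ they span, and being independent they form a direct
sum, whose bases are collected. -/
theorem isDiagonalizable_of_ker_sq {n : ℕ} {A : Matrix (Fin n) (Fin n) ℂ}
    (h : ∀ (μ : ℂ) (v w : Fin n → ℂ), A.mulVec v = μ • v + w → A.mulVec w = μ • w → w = 0) :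
    IsDiagonalizable A := by
  set f : Module.End ℂ (Fin n → ℂ) := Matrix.toLin' A with hf
  have h1 (μ : ℂ) : f.maxGenEigenspace μ = f.eigenspace μ := by
    refine le_antisymm (fun v hv => ?_) ((f.genEigenspace μ).monotone le_top)
    rw [Module.End.mem_maxGenEigenspace] at hv
    obtain ⟨k, hk⟩ := hv
    induction k generalizing v with
    | zero =>
      have : v = 0 := by simpa using hk
      rw [this]
      exact Submodule.zero_mem _
    | succ k ih =>
      rw [pow_succ, Module.End.mul_apply] at hk
      -- The vector (f - μ)v is annihilated by a smaller power, so it lies in the eigenspace; v and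
      -- (f - μ)v then form a pair as in the hypothesis.
      have h2 := ih _ hk
      rw [Module.End.mem_eigenspace_iff] at h2 ⊢
      have h3 := h μ v ((f - μ • 1) v) (by simp [hf]) (by rw [← h2]; rfl)
      simpa [sub_eq_zero] using h3
  have h2 : ⨆ μ, f.eigenspace μ = ⊤ := by
    rw [← Module.End.iSup_maxGenEigenspace_eq_top f]
    simp only [h1]
  have h3 : DirectSum.IsInternal f.eigenspace :=
    DirectSum.isInternal_submodule_of_iSupIndep_of_iSup_eq_top f.eigenspaces_iSupIndep h2
  let b' := h3.collectedBasis fun μ => Module.Free.chooseBasis ℂ (f.eigenspace μ)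
  have : Fintype (Σ μ, Module.Free.ChooseBasisIndex ℂ (f.eigenspace μ)) :=
    FiniteDimensional.fintypeBasisIndex b'
  have hc : Fintype.card (Σ μ, Module.Free.ChooseBasisIndex ℂ (f.eigenspace μ)) =
      Fintype.card (Fin n) := by
    rw [← Module.finrank_eq_card_basis b']
    simp
  refine ⟨b'.reindex (Fintype.equivOfCardEq hc), fun j => ?_⟩
  rw [Module.Basis.reindex_apply]
  set x := (Fintype.equivOfCardEq hc).symm j
  refine ⟨x.1, ?_⟩
  rw [IsEigenvector, Module.End.hasEigenvector_iff]
  exact ⟨h3.collectedBasis_mem _ x, b'.ne_zero x⟩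

/-- In coordinates of an eigenbasis with eigenvalues νⱼ, the equations read wⱼ = (νⱼ - μ)vⱼ and (νⱼ
- μ)wⱼ = 0. Either the factor νⱼ - μ vanishes, and then wⱼ = 0 by the first equation, or wⱼ = 0 by
the second. -/
theorem IsDiagonalizable.ker_sq {n : ℕ} {A : Matrix (Fin n) (Fin n) ℂ} (h : IsDiagonalizable A)
    {μ : ℂ} {v w : Fin n → ℂ} (hv : A.mulVec v = μ • v + w) (hw : A.mulVec w = μ • w) : w = 0 := by
  obtain ⟨b, hb⟩ := h
  choose ν hν using hb
  have key (u : Fin n → ℂ) (j : Fin n) : b.repr (A.mulVec u) j = ν j * b.repr u j := by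
    have : b.coord j ∘ₗ Matrix.toLin' A = ν j • b.coord j := by
      refine b.ext fun i => ?_
      have h1 := (isEigenvector_iff.1 (hν i)).1
      simp only [LinearMap.comp_apply, Matrix.toLin'_apply, h1, map_smul, LinearMap.smul_apply,
        Module.Basis.coord_apply, Module.Basis.repr_self, smul_eq_mul]
      by_cases hij : i = j
      · subst hij; rfl
      · simp [hij]
    simpa using LinearMap.congr_fun this u
  have h0 : b.repr w = 0 := by
    ext j
    have h1 := key v j
    have h2 := key w j
    rw [hv] at h1
    rw [hw] at h2
    simp only [map_add, map_smul, Finsupp.add_apply, Finsupp.smul_apply, smul_eq_mul] at h1 h2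
    have h3 : b.repr w j = (ν j - μ) * b.repr v j := by linear_combination h1
    have h4 : (ν j - μ) * b.repr w j = 0 := by linear_combination -h2
    rcases mul_eq_zero.1 h4 with h5 | h5
    · rw [h3, h5, zero_mul]; rfl
    · simpa using h5
  simpa using h0

/-- An existential criterion for the failure of diagonalizability. Each column of L, V, W is an
independent attempt at a Jordan chain of length two, and one success is enough; n columns are used
only so that all quantified blocks are square. -/
theorem not_isDiagonalizable_iff {n : ℕ} {A : Matrix (Fin n) (Fin n) ℂ} :
    ¬ IsDiagonalizable A ↔ ∃ L V W : Matrix (Fin n) (Fin n) ℂ,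
      (∀ i j, (A * V) i j = L j j * V i j + W i j ∧ (A * W) i j = L j j * W i j) ∧ W ≠ 0 := by
  constructor
  · intro h
    by_contra h'
    refine h (isDiagonalizable_of_ker_sq fun μ v w hv hw => ?_)
    by_contra hw0
    -- All columns repeat the same pair (v, w), so any column index shows that w vanishes with W;
    -- below, the row index i is used.
    refine h' ⟨Matrix.diagonal fun _ => μ, Matrix.of fun i _ => v i, Matrix.of fun i _ => w i,
      fun i j => ⟨?_, ?_⟩, fun h0 => hw0 ?_⟩
    · simpa [Matrix.mul_apply, Matrix.mulVec, dotProduct] using congrFun hv i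
    · simpa [Matrix.mul_apply, Matrix.mulVec, dotProduct] using congrFun hw i
    · ext i
      exact congrFun (congrFun h0 i) i
  · rintro ⟨L, V, W, h, hW⟩ hA
    refine hW ?_
    ext i j
    refine congrFun (hA.ker_sq (μ := L j j) (v := V.col j) (w := W.col j) ?_ ?_) i
    · ext i
      simpa [Matrix.mul_apply, Matrix.mulVec, dotProduct] using (h i j).1
    · ext i
      simpa [Matrix.mul_apply, Matrix.mulVec, dotProduct] using (h i j).2

variable {Ω : Interp} {ρ : RVar → ℝ}

/-- The form in which the formula states BC = 1, with off-diagonal positions again enumerated by j <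
i. -/
theorem forall_and_lt_iff {n : ℕ} {M : Matrix (Fin n) (Fin n) ℂ} :
    M = 1 ↔ (∀ i, M i i = 1) ∧ ∀ i j, j < i → M i j = 0 ∧ M j i = 0 := by
  constructor
  · rintro rfl
    refine ⟨fun i => by simp, fun i j hij => ⟨by simp [hij.ne'], by simp [hij.ne]⟩⟩
  · rintro ⟨h1, h2⟩
    ext i j
    rcases lt_trichotomy i j with hij | rfl | hij
    · simpa [hij.ne] using (h2 j i hij).2
    · simpa using h1 i
    · simpa [hij.ne'] using (h2 i j hij).1

theorem forall_fin_lt {n : ℕ} {P : ℕ → ℕ → Prop} :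
    (∀ (i : Fin n) (j : Fin i), P i j) ↔ ∀ i j : Fin n, j < i → P i j :=
  ⟨fun h i j hij => h i ⟨j, hij⟩, fun h i j => h i ⟨j, j.2.trans i.2⟩ j.2⟩

theorem holds_eigBasisF {n : ℕ} :
    (eigBasisF n).Holds Ω ρ ↔
      IsOrthoEigenbasis (mat (.z (argBlk 0)) ρ n n) (mat (.z outBlk) ρ n n) := by
  rw [eigBasisF, holds_exs_blk, isOrthoEigenbasis_iff]
  have h1 : outBlk ≠ eigBlk₁ := by simp [outBlk, eigBlk₁]
  have h2 : outBlk ≠ eigBlk₂ := by simp [outBlk, eigBlk₂]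
  have h3 : eigBlk₁ ≠ eigBlk₂ := by simp [eigBlk₁, eigBlk₂]
  have h4 : argBlk 0 ≠ eigBlk₁ := by simp [argBlk, eigBlk₁]
  have h5 : argBlk 0 ≠ eigBlk₂ := by simp [argBlk, eigBlk₂]
  simp only [holds_exs_blk]
  refine exists_congr fun L => exists_congr fun C => ?_
  set ρ' := setBlk (setBlk ρ eigBlk₁ L) eigBlk₂ C with hρ'
  have g1 (i j : ℕ) : get (.z outBlk) ρ' i j = get (.z outBlk) ρ i j := by
    rw [get_setBlk_ne h2, get_setBlk_ne h1]
  have g2 (i j : ℕ) : get (.z (argBlk 0)) ρ' i j = get (.z (argBlk 0)) ρ i j := by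
    rw [get_setBlk_ne h5, get_setBlk_ne h4]
  have g3 (i j : Fin n) : get (.z eigBlk₁) ρ' i j = L i j := by
    rw [get_setBlk_ne h3, get_setBlk_self]
  have g4 (i j : Fin n) : get (.z eigBlk₂) ρ' i j = C i j := get_setBlk_self _ _ _ _
  have g5 : (∀ (i : Fin n) (j : Fin i), ((∑ k : Fin n, get (.z outBlk) ρ i k *
      get (.z eigBlk₂) ρ' k j = 0) ∧ (∑ k : Fin n, get (.z outBlk) ρ j k *
      get (.z eigBlk₂) ρ' k i = 0) ∧ (get (.z eigBlk₁) ρ' i i ≠ get (.z eigBlk₁) ρ' j j ∨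
        ∑ k : Fin n, star (get (.z outBlk) ρ k i) * get (.z outBlk) ρ k j = 0))) ↔ _ :=
    forall_fin_lt (P := fun i j => ((∑ k : Fin n, get (.z outBlk) ρ i k *
      get (.z eigBlk₂) ρ' k j = 0) ∧ (∑ k : Fin n, get (.z outBlk) ρ j k *
      get (.z eigBlk₂) ρ' k i = 0) ∧ (get (.z eigBlk₁) ρ' i i ≠ get (.z eigBlk₁) ρ' j j ∨
        ∑ k : Fin n, star (get (.z outBlk) ρ k i) * get (.z outBlk) ρ k j = 0)))
  simp only [holds_ands, forall_grid, forall_range_flatMap, forall_append, List.mem_singleton,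
    forall_eq, ExFormula.Holds, holds_ceq, holds_cne, value_sum, value_mul, value_conj, value_entry,
    value_one, value_zero, holds_verum, and_true, g1, g2, g5]
  simp only [g3, g4, forall_and_lt_iff, Matrix.mul_apply, dotProduct, Matrix.col_apply,
    Pi.star_apply, mat_apply, forall_and]
  tauto

theorem holds_eigDefectF {n : ℕ} :
    (eigDefectF n).Holds Ω ρ ↔
      ¬ IsDiagonalizable (mat (.z (argBlk 0)) ρ n n) ∧ mat (.z outBlk) ρ n n = 0 := by
  rw [eigDefectF, holds_exs_blk, not_isDiagonalizable_iff]
  have h1 : outBlk ≠ eigBlk₁ := by simp [outBlk, eigBlk₁]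
  have h2 : outBlk ≠ eigBlk₂ := by simp [outBlk, eigBlk₂]
  have h2' : outBlk ≠ eigBlk₃ := by simp [outBlk, eigBlk₃]
  have h3 : eigBlk₁ ≠ eigBlk₂ := by simp [eigBlk₁, eigBlk₂]
  have h3' : eigBlk₁ ≠ eigBlk₃ := by simp [eigBlk₁, eigBlk₃]
  have h3'' : eigBlk₂ ≠ eigBlk₃ := by simp [eigBlk₂, eigBlk₃]
  have h4 : argBlk 0 ≠ eigBlk₁ := by simp [argBlk, eigBlk₁]
  have h5 : argBlk 0 ≠ eigBlk₂ := by simp [argBlk, eigBlk₂]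
  have h6 : argBlk 0 ≠ eigBlk₃ := by simp [argBlk, eigBlk₃]
  simp only [holds_exs_blk]
  -- A sum of squares of absolute values replaces the disjunction over all entries of W.
  have key (L V W : Matrix (Fin n) (Fin n) ℂ) : (0 < ∑ i : Fin n, ∑ j : Fin n,
      ((W i j).re * (W i j).re + (W i j).im * (W i j).im)) ↔ W ≠ 0 := by
    have hnn (i j : Fin n) : 0 ≤ (W i j).re * (W i j).re + (W i j).im * (W i j).im := by
      nlinarith [mul_self_nonneg (W i j).re, mul_self_nonneg (W i j).im]
    rw [lt_iff_le_and_ne, and_iff_right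
      (Finset.sum_nonneg fun i _ => Finset.sum_nonneg fun j _ => hnn i j), not_iff_not, eq_comm,
      Finset.sum_eq_zero_iff_of_nonneg fun i _ => Finset.sum_nonneg fun j _ => hnn i j]
    simp only [Finset.sum_eq_zero_iff_of_nonneg fun j _ => hnn _ j, Finset.mem_univ, true_imp_iff]
    simp only [← Complex.normSq_apply, Complex.normSq_eq_zero, ← Matrix.ext_iff, Matrix.zero_apply]
  simp only [← exists_and_right]
  refine exists_congr fun L => exists_congr fun V => exists_congr fun W => ?_
  set ρ' := setBlk (setBlk (setBlk ρ eigBlk₁ L) eigBlk₂ V) eigBlk₃ W with hρ'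
  have g1 (i j : ℕ) : get (.z outBlk) ρ' i j = get (.z outBlk) ρ i j := by
    rw [get_setBlk_ne h2', get_setBlk_ne h2, get_setBlk_ne h1]
  have g2 (i j : ℕ) : get (.z (argBlk 0)) ρ' i j = get (.z (argBlk 0)) ρ i j := by
    rw [get_setBlk_ne h6, get_setBlk_ne h5, get_setBlk_ne h4]
  have g3 (i j : Fin n) : get (.z eigBlk₁) ρ' i j = L i j := by
    rw [get_setBlk_ne h3', get_setBlk_ne h3, get_setBlk_self]
  have g4 (i j : Fin n) : get (.z eigBlk₂) ρ' i j = V i j := by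
    rw [get_setBlk_ne h3'', get_setBlk_self]
  have g5 (i j : Fin n) : get (.z eigBlk₃) ρ' i j = W i j := get_setBlk_self _ _ _ _
  rw [holds_ands (ρ := ρ')]
  have g6 (i j : Fin n) : (normSqTerm (.entry (.z eigBlk₃) i j)).value Ω ρ' =
      (W i j).re * (W i j).re + (W i j).im * (W i j).im := by
    rw [← g5]; rfl
  simp only [forall_grid, forall_append, ExFormula.Holds, holds_ceq, value_sum, value_mul,
    value_add, value_entry, value_zero, g1, g2, g3, g4, g5, value_rsum, g6]
  rw [← Matrix.ext_iff, ← key L V W]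
  simp only [RTerm.value, Int.cast_zero, Matrix.mul_apply, mat_apply, forall_and,
    Matrix.zero_apply]
  tauto

/-- The first alternative need not assert diagonalizability, since the basis proves it; the second
one asserts the failure explicitly. -/
theorem Means.eigenF {env : Env} {n : ℕ} {φ : ExFormula} {e : Expr}
    (h : Means Ω env n n φ (e.results Ω)) :
    Means Ω env n n (eigenF n n (wrap 0 n n φ)) ((Expr.eigen e).results Ω) := by
  intro ρ
  rw [Matlang.eigenF, holds_exs_blk]
  simp only [ExFormula.Holds, h.holds_wrap, holds_eigBasisF, holds_eigDefectF, mat_setBlk_self,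
    mat_setBlk_ne (outBlk_ne_argBlk 0)]
  simp only [argBlk_eq 0, Env.inst_setBlk, Expr.results, Set.mem_ofPred_eq, Mat.mk.injEq,
    IsEigenResult]
  constructor
  · rintro ⟨A, h1, h2⟩
    exact ⟨n, A, _, h2, h1.imp_left fun h => ⟨h.isDiagonalizable, h⟩, rfl, rfl, HEq.rfl⟩
  · rintro ⟨m, A, B, h1, h2, rfl, -, h3⟩
    obtain rfl := eq_of_heq h3
    exact ⟨A, h2.imp_left fun h => h.2, h1⟩

/-! ### Correctness of the translation -/

/-- Soundness of typing. It supplies the conditions on dimensions in the cases where a dimension of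
a subexpression is lost in the result. -/
theorem results_dims {S : Name → Option Ty} {e : Expr} {τ : Ty} (h : HasType S e τ)
    {σ : Name → ℕ} {I : Inst} (hI : ∀ M τ A, S M = some τ → I M = some A →
      A.rows = τ.1.value σ ∧ A.cols = τ.2.value σ) :
    ∀ A ∈ e.results Ω I, A.rows = τ.1.value σ ∧ A.cols = τ.2.value σ := by
  induction h generalizing I with
  | var h => exact fun A hA => hI _ _ _ h hA
  | @letIn S M e₁ e₂ τ₁ τ₂ h₁ h₂ ih₁ ih₂ =>
    rintro B ⟨A, hA, hB⟩
    refine ih₂ (fun M' τ A' h h' => ?_) _ hB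
    by_cases hM : M' = M
    · subst hM
      simp only [Function.update_self, Option.some.injEq] at h h'
      subst h h'
      exact ih₁ hI _ hA
    · rw [Function.update_of_ne hM] at h h'
      exact hI _ _ _ h h'
  | transp h ih =>
    rintro _ ⟨m, n, A, hA, rfl⟩
    exact (ih hI _ hA).symm
  | ones h ih =>
    rintro _ ⟨m, n, A, hA, rfl⟩
    exact ⟨(ih hI _ hA).1, rfl⟩
  | diag h ih =>
    rintro _ ⟨m, A, hA, rfl⟩
    exact ⟨(ih hI _ hA).1, (ih hI _ hA).1⟩
  | mul h₁ h₂ ih₁ ih₂ =>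
    rintro _ ⟨m, n, p, A, B, hA, hB, rfl⟩
    exact ⟨(ih₁ hI _ hA).1, (ih₂ hI _ hB).2⟩
  | apply hn h ih =>
    rintro _ ⟨m, p, A, hA, rfl⟩
    exact ih ⟨0, hn⟩ hI ⟨m, p, A ⟨0, hn⟩⟩ (hA _)
  | eigen h ih =>
    rintro _ ⟨n, A, B, hA, -, rfl⟩
    exact ih hI ⟨n, n, A⟩ hA

theorem Env.Fits.inst_dims {env : Env} {S : Name → Option Ty} {σ : Name → ℕ} (hE : env.Fits S σ)
    (ρ : RVar → ℝ) : ∀ M τ A, S M = some τ → env.inst ρ M = some A →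
      A.rows = τ.1.value σ ∧ A.cols = τ.2.value σ := by
  intro M τ A h h'
  rw [Env.inst, hE, h] at h'
  simp only [Option.map_some, Option.some.injEq] at h'
  subst h'
  exact ⟨rfl, rfl⟩

theorem means_trans {S : Name → Option Ty} {e : Expr} {τ : Ty} (h : HasType S e τ)
    {σ : Name → ℕ} {env : Env} (hE : env.Fits S σ) :
    Means Ω env (τ.1.value σ) (τ.2.value σ) (trans env e) (e.results Ω) := by
  induction h generalizing env with
  | var h =>
    rw [trans, dims_eq (.var h) hE]
    exact means_varF (by rw [hE, h]; rfl)
  | letIn h₁ h₂ ih₁ ih₂ =>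
    rw [trans, dims_eq h₁ hE]
    exact (ih₁ hE).letF (ih₂ (hE.update _ _)) fun ρ => results_dims h₁ (hE.inst_dims ρ)
  | transp h ih =>
    rw [trans, dims_eq h hE]
    exact (ih hE).transpF
  | ones h ih =>
    rw [trans, dims_eq h hE]
    exact (ih hE).onesF fun ρ => results_dims h (hE.inst_dims ρ)
  | diag h ih =>
    rw [trans, dims_eq h hE]
    exact (ih hE).diagF
  | mul h₁ h₂ ih₁ ih₂ =>
    rw [trans, dims_eq h₁ hE, dims_eq h₂ hE]
    exact (ih₁ hE).mulF (ih₂ hE) fun ρ => results_dims h₁ (hE.inst_dims ρ)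
  | apply hn h ih =>
    rw [trans, dims_eq (.apply hn h) hE]
    simp only [dims_eq (h _) hE]
    exact Means.applyF (φ := fun k => trans env _) fun k => ih k hE
  | eigen h ih =>
    rw [trans, dims_eq h hE]
    exact (ih hE).eigenF

end Matlang

namespace Matlang

/-! ### Generators for formulas -/

/-- In prefix notation a right-nested fold is a mere concatenation of heads followed by the last
formula. Hence quantifier prefixes, conjunctions and sums can all be written by loops in front of
text that is already there. -/
theorem encFormula_exs (l : List RVar) (φ : ExFormula) :
    encFormula (exs l φ) = (l.flatMap fun v => .ex :: outVar v) ++ encFormula φ := by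
  induction l with
  | nil => rfl
  | cons v l ih =>
    change _ :: (outVar v ++ encFormula (exs l φ)) = _
    rw [ih]
    simp

theorem encFormula_ands (l : List ExFormula) (φ : ExFormula) :
    encFormula (ands l φ) = (l.flatMap fun ψ => .and :: encFormula ψ) ++ encFormula φ := by
  induction l with
  | nil => rfl
  | cons ψ l ih =>
    change _ :: (encFormula ψ ++ encFormula (ands l φ)) = _
    rw [ih]
    simp

theorem outTerm_rsum (n : ℕ) (t : ℕ → RTerm) :
    outTerm (rsum n t) = ((List.range n).flatMap fun k => .add :: outTerm (t k)) ++
      outTerm (.int 0) := by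
  have : ∀ l : List ℕ, outTerm (l.foldr (fun k u => RTerm.add (t k) u) (.int 0)) =
      (l.flatMap fun k => .add :: outTerm (t k)) ++ outTerm (.int 0) := by
    intro l
    induction l with
    | nil => rfl
    | cons k l ih =>
      change _ :: (outTerm (t k) ++ outTerm (l.foldr _ _)) = _
      rw [ih]
      simp
  exact this _

namespace Gen

/-- Names as contents of a stack. -/
def bits (w : Name) : List OutTok := w.map .bit

/-- A generator for the variables of a block, from generators for the row and the column. -/
abbrev BlkGen : Type := Gen → Gen → Part → Gen

/-- Generators for a complex term. -/
structure TermGen : Type where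
  re : Gen
  im : Gen

variable {s : Store}

@[simp] theorem length_ticks (n : ℕ) : (ticks n).length = n := List.length_replicate

/-- The generator `B` describes the block `b`. -/
def RepB (s : Store) (B : BlkGen) (b : Blk) : Prop :=
  ∀ (i j : Gen) (m n : ℕ) (p : Part), i.eval s = ticks m → j.eval s = ticks n →
    (B i j p).eval s = outVar (b m n p)

/-- The generator `g` describes the complex term `a`. -/
def RepC (s : Store) (g : TermGen) (a : CTerm) : Prop :=
  g.re.eval s = outTerm a.re ∧ g.im.eval s = outTerm a.im

/-- The generator `g` describes the conjuncts `l`. -/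
def RepL (s : Store) (g : Gen) (l : List ExFormula) : Prop :=
  g.eval s = l.flatMap fun ψ => .and :: encFormula ψ

/-- The generator `g` describes quantifiers for the variables `l`. -/
def RepV (s : Store) (g : Gen) (l : List RVar) : Prop :=
  g.eval s = l.flatMap fun v => .ex :: outVar v

def zB (w : Gen) : BlkGen := fun i j p =>
  const [.z] ++ w ++ const [.close] ++ i ++ const [.close] ++ j ++ const [.close, outPart p]

def xB (w : Gen) : BlkGen := fun i j p =>
  const [.x] ++ w ++ const [.close] ++ i ++ const [.close] ++ j ++ const [.close, outPart p]

def yB : BlkGen := fun i j p =>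
  const [.y] ++ i ++ const [.close] ++ j ++ const [.close, outPart p]

def constB (w : Name) : BlkGen := zB (const (bits w))

theorem repB_zB {w : Gen} {w' : Name} (h : w.eval s = bits w') : RepB s (zB w) (.z w') := by
  intro i j m n p hi hj
  simp [zB, eval, h, hi, hj, outVar, outName, outNat, ticks, bits]

theorem repB_xB {w : Gen} {w' : Name} (h : w.eval s = bits w') : RepB s (xB w) (.x w') := by
  intro i j m n p hi hj
  simp [xB, eval, h, hi, hj, outVar, outName, outNat, ticks, bits]

theorem repB_yB : RepB s yB .y := by
  intro i j m n p hi hj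
  simp [yB, eval, hi, hj, outVar, outNat, ticks]

theorem repB_constB (w : Name) : RepB s (constB w) (.z w) := repB_zB rfl

def entry (B : BlkGen) (i j : Gen) : TermGen := ⟨const [.var] ++ B i j .re, const [.var] ++ B i j
  .im⟩

theorem repC_entry {B : BlkGen} {b : Blk} (h : RepB s B b) {i j : Gen} {m n : ℕ}
    (hi : i.eval s = ticks m) (hj : j.eval s = ticks n) :
    RepC s (entry B i j) (.entry b m n) := by
  constructor <;> simp [entry, CTerm.entry, eval, outTerm, h i j m n _ hi hj]

/-- The integer `0`. -/
def int0 : Gen := const [.int, .bit false, .close]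

def int1 : Gen := const [.int, .bit false, .bit true, .close]

def intNeg1 : Gen := const [.int, .bit true, .bit true, .close]

theorem eval_int0 : int0.eval s = outTerm (.int 0) := rfl

theorem eval_int1 : int1.eval s = outTerm (.int 1) := by
  simp [int1, eval, outTerm, outInt, outName, Computability.encodeNat, Computability.encodeNum,
    Computability.encodePosNum]

theorem eval_intNeg1 : intNeg1.eval s = outTerm (.int (-1)) := by
  simp [intNeg1, eval, outTerm, outInt, outName, Computability.encodeNat, Computability.encodeNum,
    Computability.encodePosNum]

def zeroT : TermGen := ⟨int0, int0⟩

def oneT : TermGen := ⟨int1, int0⟩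

theorem repC_zero : RepC s zeroT .zero := ⟨eval_int0, eval_int0⟩

theorem repC_one : RepC s oneT .one := ⟨eval_int1, eval_int0⟩

def addG (g h : Gen) : Gen := const [.add] ++ g ++ h

def mulG (g h : Gen) : Gen := const [.mul] ++ g ++ h

theorem eval_addG {g h : Gen} {t u : RTerm} (hg : g.eval s = outTerm t) (hh : h.eval s = outTerm u)
    :
    (addG g h).eval s = outTerm (.add t u) := by
  simp [addG, eval, outTerm, hg, hh]

theorem eval_mulG {g h : Gen} {t u : RTerm} (hg : g.eval s = outTerm t) (hh : h.eval s = outTerm u)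
    :
    (mulG g h).eval s = outTerm (.mul t u) := by
  simp [mulG, eval, outTerm, hg, hh]

def addT (g h : TermGen) : TermGen := ⟨addG g.re h.re, addG g.im h.im⟩

def mulT (g h : TermGen) : TermGen :=
  ⟨addG (mulG g.re h.re) (mulG intNeg1 (mulG g.im h.im)),
    addG (mulG g.re h.im) (mulG g.im h.re)⟩

def conjT (g : TermGen) : TermGen := ⟨g.re, mulG intNeg1 g.im⟩

theorem repC_add {g h : TermGen} {a b : CTerm} (hg : RepC s g a) (hh : RepC s h b) :
    RepC s (addT g h) (a.add b) := ⟨eval_addG hg.1 hh.1, eval_addG hg.2 hh.2⟩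

theorem repC_mul {g h : TermGen} {a b : CTerm} (hg : RepC s g a) (hh : RepC s h b) :
    RepC s (mulT g h) (a.mul b) :=
  ⟨eval_addG (eval_mulG hg.1 hh.1) (eval_mulG eval_intNeg1 (eval_mulG hg.2 hh.2)),
    eval_addG (eval_mulG hg.1 hh.2) (eval_mulG hg.2 hh.1)⟩

theorem repC_conj {g : TermGen} {a : CTerm} (hg : RepC s g a) : RepC s (conjT g) a.conj :=
  ⟨hg.1, eval_mulG eval_intNeg1 hg.2⟩

def sumG (i r : Stk) (g : Gen) : Gen := each i r (const [.add] ++ g) ++ int0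

theorem eval_sumG {i r : Stk} {g : Gen} {n : ℕ} {t : ℕ → RTerm} (hr : (s r).length = n)
    (h : ∀ k, g.eval (Function.update s i (ticks k)) = outTerm (t k)) :
    (sumG i r g).eval s = outTerm (rsum n t) := by
  simp [sumG, eval, hr, h, outTerm_rsum, eval_int0]

def sumT (r : Stk) (g : TermGen) : TermGen := ⟨sumG .kx r g.re, sumG .kx r g.im⟩

theorem repC_sum {r : Stk} {g : TermGen} {n : ℕ} {t : ℕ → CTerm} (hr : (s r).length = n)
    (h : ∀ k, RepC (Function.update s .kx (ticks k)) g (t k)) :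
    RepC s (sumT r g) (.sum n t) :=
  ⟨eval_sumG hr fun k => (h k).1, eval_sumG hr fun k => (h k).2⟩

def ceqG (g h : TermGen) : Gen := const [.and, .eq] ++ g.re ++ h.re ++ const [.and, .eq] ++ g.im ++
  h.im

theorem repL_ceq {g h : TermGen} {a b : CTerm} (hg : RepC s g a) (hh : RepC s h b) :
    RepL s (ceqG g h) (ceq a b) := by
  simp [RepL, ceqG, eval, ceq, encFormula, hg.1, hg.2, hh.1, hh.2]

theorem repL_append {g h : Gen} {l l' : List ExFormula} (hg : RepL s g l) (hh : RepL s h l') :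
    RepL s (g ++ h) (l ++ l') := by
  rw [RepL] at hg hh
  simp [RepL, hg, hh]

theorem repL_each {i r : Stk} {g : Gen} {n : ℕ} {l : ℕ → List ExFormula} (hr : (s r).length = n)
    (h : ∀ m, RepL (Function.update s i (ticks m)) g (l m)) :
    RepL s (each i r g) ((List.range n).flatMap l) := by
  simp only [RepL] at h
  simp [RepL, eval, hr, h, List.flatMap_assoc]

/-- Conjuncts for all positions of a matrix. -/
def gridG (r c : Stk) (g : Gen) : Gen := each .ix r (each .jx c g)

theorem repL_grid {r c : Stk} {g : Gen} {m n : ℕ} {l : ℕ → ℕ → List ExFormula}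
    (hr : (s r).length = m) (hc : (s c).length = n) (hc' : c ≠ .ix)
    (h : ∀ i j, RepL (Function.update (Function.update s .ix (ticks i)) .jx (ticks j)) g (l i j)) :
    RepL s (gridG r c g) (grid m n l) :=
  repL_each hr fun i => repL_each (by simpa [hc'] using hc) fun j => h i j

/-- Quantifiers for the variables of a block. -/
def exBlk (B : BlkGen) (r c : Stk) : Gen :=
  each .ix r (each .jx c
    (const [.ex] ++ B (reg .ix) (reg .jx) .re ++ const [.ex] ++ B (reg .ix) (reg .jx) .im))

theorem repV_exBlk {B : BlkGen} {b : Blk} {r c : Stk} {m n : ℕ} (hr : (s r).length = m)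
    (hc : (s c).length = n) (hc' : c ≠ .ix)
    (h : ∀ i j, RepB (Function.update (Function.update s .ix (ticks i)) .jx (ticks j)) B b) :
    RepV s (exBlk B r c) (blkVars b m n) := by
  have h' (i j : ℕ) (p : Part) := h i j (reg .ix) (reg .jx) i j p (by simp [eval]) (by simp [eval])
  simp [RepV, exBlk, eval, hr, hc, hc', h', blkVars, List.flatMap_assoc]

theorem RepL.eval_append_enc {g : Gen} {l : List ExFormula} (h : RepL s g l) (φ : ExFormula) :
    g.eval s ++ encFormula φ = encFormula (ands l φ) := by
  rw [encFormula_ands, h]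

theorem RepV.eval_append_enc {g : Gen} {l : List RVar} (h : RepV s g l) (φ : ExFormula) :
    g.eval s ++ encFormula φ = encFormula (exs l φ) := by
  rw [encFormula_exs, h]

/-! ### The generators for the translation -/

def ixG : Gen := reg .ix

def jxG : Gen := reg .jx

def kxG : Gen := reg .kx

/-- The index `0`. -/
def ix0 : Gen := const []

/-- The block whose number is on the stack `r`. -/
def argB (r : Stk) : BlkGen := zB (const (bits (argBlk 0)) ++ regBits r)

/-- Block names for arguments are unary, so a counter with its ticks turned into bits, behind the
two bits of `argBlk 0`, is already the name. -/
theorem repB_argB {r : Stk} {k : ℕ} (h : s r = ticks k) : RepB s (argB r) (.z (argBlk k)) := by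
  refine repB_zB ?_
  rw [argBlk, Nat.add_comm, List.replicate_add]
  simp [eval, h, bits, ticks, toBit, argBlk]
  rfl

def verumG : Gen := const [.eq] ++ int0 ++ int0

theorem eval_verumG : verumG.eval s = encFormula verum := rfl

def wrapG : Gen :=
  exBlk (constB outBlk) .row .col ++ gridG .row .col (ceqG (entry (constB outBlk) ixG jxG) (entry
    (argB .arg) ixG jxG))

def varG : Gen :=
  gridG .row .col (ceqG (entry (constB outBlk) ixG jxG) (entry (zB (reg .name)) ixG jxG)) ++ verumG

def transpG : Gen :=
  exBlk (constB (argBlk 0)) .row .col ++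
    gridG .row .col (ceqG (entry (constB outBlk) jxG ixG) (conjT (entry (constB (argBlk 0)) ixG
      jxG)))

def onesG : Gen := exBlk (constB (argBlk 0)) .row .col ++ each .ix .row (ceqG (entry (constB
  outBlk) ixG ix0) oneT)

/-- The inner loop runs over j < i because the row counter itself is the register that holds i
ticks. -/
def diagG : Gen :=
  exBlk (constB (argBlk 0)) .row .col ++ each .ix .row (ceqG (entry (constB outBlk) ixG ixG) (entry
    (constB (argBlk 0)) ixG ix0) ++
    each .jx .ix (ceqG (entry (constB outBlk) ixG jxG) zeroT ++ ceqG (entry (constB outBlk) jxG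
      ixG) zeroT))

def mulOpG : Gen :=
  exBlk (constB (argBlk 0)) .row2 .row ++ (exBlk (constB (argBlk 1)) .row .col ++ (gridG .row2 .col
    (ceqG (entry (constB outBlk) ixG jxG)
      (sumT .row (mulT (entry (constB (argBlk 0)) ixG kxG) (entry (constB (argBlk 1)) kxG jxG)))) ++
    const [.and]))

def letG : Gen :=
  exBlk (constB (argBlk 0)) .row2 .col2 ++ (const [.and] ++ (exBlk (zB (reg .name)) .row2 .col2 ++
    gridG .row2 .col2 (ceqG (entry (zB (reg .name)) ixG jxG) (entry (constB (argBlk 0)) ixG jxG))))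

def applyTermG (p : Part) : Gen :=
  const [.fn] ++ (reg .fn ++ (const [.close, outPart p] ++ (reg .arg ++ (const [.close] ++
    each .kx .arg ((entry (argB .kx) ixG jxG).re ++ (entry (argB .kx) ixG jxG).im)))))

def applyG : Gen :=
  each .kx .arg (exBlk (argB .kx) .row .col) ++
    gridG .row .col (ceqG (entry (constB outBlk) ixG jxG) ⟨applyTermG .re, applyTermG .im⟩)

def dotG (r : Stk) (g h : TermGen) : TermGen := sumT r (mulT g h)

def cneG (g h : TermGen) : Gen :=
  const [.or, .or, .lt] ++ (g.re ++ (h.re ++ (const [.lt] ++ (h.re ++ (g.re ++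
    (const [.or, .lt] ++ (g.im ++ (h.im ++ (const [.lt] ++ (h.im ++ g.im))))))))))

def eigBasisG : Gen :=
  exBlk (constB eigBlk₁) .row .row ++ (exBlk (constB eigBlk₂) .row .row ++
    (gridG .row .row (ceqG (dotG .row (entry (constB (argBlk 0)) ixG kxG) (entry (constB outBlk)
      kxG jxG))
      (mulT (entry (constB eigBlk₁) jxG jxG) (entry (constB outBlk) ixG jxG))) ++
    (each .ix .row (ceqG (dotG .row (entry (constB outBlk) ixG kxG) (entry (constB eigBlk₂) kxG
      ixG)) oneT) ++
    (each .ix .row (each .jx .ix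
      (ceqG (dotG .row (entry (constB outBlk) ixG kxG) (entry (constB eigBlk₂) kxG jxG)) zeroT ++
      (ceqG (dotG .row (entry (constB outBlk) jxG kxG) (entry (constB eigBlk₂) kxG ixG)) zeroT ++
      (const [.and, .or] ++
        (cneG (entry (constB eigBlk₁) ixG ixG) (entry (constB eigBlk₁) jxG jxG) ++
        (ceqG (dotG .row (conjT (entry (constB outBlk) kxG ixG)) (entry (constB outBlk) kxG jxG))
          zeroT ++
          verumG)))))) ++ verumG))))

def normSqG (g : TermGen) : Gen := addG (mulG g.re g.re) (mulG g.im g.im)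

def eigDefectG : Gen :=
  exBlk (constB eigBlk₁) .row .row ++ (exBlk (constB eigBlk₂) .row .row ++
    (exBlk (constB eigBlk₃) .row .row ++ (gridG .row .row (ceqG (entry (constB outBlk) ixG jxG)
      zeroT ++
      (ceqG (dotG .row (entry (constB (argBlk 0)) ixG kxG) (entry (constB eigBlk₂) kxG jxG))
        (addT (mulT (entry (constB eigBlk₁) jxG jxG) (entry (constB eigBlk₂) ixG jxG))
          (entry (constB eigBlk₃) ixG jxG)) ++
      ceqG (dotG .row (entry (constB (argBlk 0)) ixG kxG) (entry (constB eigBlk₃) kxG jxG))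
        (mulT (entry (constB eigBlk₁) jxG jxG) (entry (constB eigBlk₃) ixG jxG)))) ++
      (const [.lt] ++ (int0 ++
        sumG .ix .row (sumG .jx .row (normSqG (entry (constB eigBlk₃) ixG jxG))))))))

def eigenG : Gen :=
  exBlk (constB (argBlk 0)) .row .col ++ (const [.and, .or] ++ (eigBasisG ++ eigDefectG))

/-- Quantifiers for the entries of a variable in scope. -/
def exVarG : Gen := exBlk (zB (reg .name)) .row2 .col2

/-- The variables for the entries of an input matrix. -/
def inputG : Gen :=
  gridG .row .col (ceqG (entry (zB (const [.bit false] ++ reg .name)) ixG jxG)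
    (entry (xB (reg .name)) ixG jxG))

/-- The variables for the entries of the output matrix. -/
def outputG : Gen :=
  exBlk (constB outBlk) .row .col ++
    (gridG .row .col (ceqG (entry (constB outBlk) ixG jxG) (entry yB ixG jxG)) ++ const [.and])

theorem eval_wrapG {r c k : ℕ} (hr : s .row = ticks r) (hc : s .col = ticks c)
    (hk : s .arg = ticks k) (φ : ExFormula) :
    wrapG.eval s ++ encFormula φ = encFormula (wrap k r c φ) := by
  rw [wrapG, eval_append, List.append_assoc, wrap, RepL.eval_append_enc
    (repL_grid (m := r) (n := c) (by simp [hr]) (by simp [hc]) (by simp) fun i j =>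
      repL_ceq (repC_entry (repB_constB _) ?_ ?_) (repC_entry (repB_argB ?_) ?_ ?_)),
    RepV.eval_append_enc (repV_exBlk (by rw [hr, length_ticks]) (by rw [hc, length_ticks]) (by simp)
      fun i j => repB_constB _)]
  all_goals simp [ixG, jxG, eval, hk]

theorem eval_varG {r c : ℕ} {w : Name} (hr : s .row = ticks r) (hc : s .col = ticks c)
    (hw : s .name = bits w) : varG.eval s = encFormula (varF w r c) := by
  rw [varG, eval_append, eval_verumG, varF, RepL.eval_append_enc
    (repL_grid (m := r) (n := c) (by simp [hr]) (by simp [hc]) (by simp) fun i j =>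
      repL_ceq (repC_entry (repB_constB _) ?_ ?_) (repC_entry (repB_zB ?_) ?_ ?_))]
  all_goals simp [ixG, jxG, eval, hw]

theorem eval_transpG {r c : ℕ} (hr : s .row = ticks r) (hc : s .col = ticks c) (φ : ExFormula) :
    transpG.eval s ++ encFormula φ = encFormula (transpF r c φ) := by
  rw [transpG, eval_append, List.append_assoc, transpF, RepL.eval_append_enc
    (repL_grid (m := r) (n := c) (by simp [hr]) (by simp [hc]) (by simp) fun i j =>
      repL_ceq (repC_entry (repB_constB _) ?_ ?_) (repC_conj (repC_entry (repB_constB _) ?_ ?_))),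
    RepV.eval_append_enc (repV_exBlk (by rw [hr, length_ticks]) (by rw [hc, length_ticks]) (by simp)
      fun i j => repB_constB _)]
  all_goals simp [ixG, jxG, eval]

theorem eval_onesG {r c : ℕ} (hr : s .row = ticks r) (hc : s .col = ticks c) (φ : ExFormula) :
    onesG.eval s ++ encFormula φ = encFormula (onesF r c φ) := by
  rw [onesG, eval_append, List.append_assoc, onesF, RepL.eval_append_enc
    (repL_each (n := r) (by simp [hr]) fun i =>
      repL_ceq (repC_entry (repB_constB _) ?_ ?_) repC_one),
    RepV.eval_append_enc (repV_exBlk (by rw [hr, length_ticks]) (by rw [hc, length_ticks]) (by simp)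
      fun i j => repB_constB _)]
  all_goals simp [ixG, ix0, eval, ticks]

theorem eval_diagG {r c : ℕ} (hr : s .row = ticks r) (hc : s .col = ticks c) (φ : ExFormula) :
    diagG.eval s ++ encFormula φ = encFormula (diagF r c φ) := by
  rw [diagG, eval_append, List.append_assoc, diagF, RepL.eval_append_enc
    (repL_each (n := r) (by simp [hr]) fun i => repL_append
      (repL_ceq (repC_entry (repB_constB _) ?_ ?_) (repC_entry (repB_constB _) ?_ ?_))
      (repL_each (n := i) (by simp) fun j => repL_append
        (repL_ceq (repC_entry (repB_constB _) ?_ ?_) repC_zero)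
        (repL_ceq (repC_entry (repB_constB _) ?_ ?_) repC_zero))),
    RepV.eval_append_enc (repV_exBlk (by rw [hr, length_ticks]) (by rw [hc, length_ticks]) (by simp)
      fun i j => repB_constB _)]
  all_goals simp [ixG, jxG, ix0, eval, ticks]

theorem eval_mulOpG {r m c : ℕ} (hr : s .row2 = ticks r) (hm : s .row = ticks m)
    (hc : s .col = ticks c) (φ₂ φ₁ : ExFormula) :
    mulOpG.eval s ++ (encFormula φ₂ ++ encFormula φ₁) = encFormula (mulF r m c φ₂ φ₁) := by
  have h : (const [.and]).eval s ++ (encFormula φ₂ ++ encFormula φ₁) =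
    encFormula (.and φ₂ φ₁) := rfl
  rw [mulOpG, eval_append, eval_append, eval_append, List.append_assoc, List.append_assoc,
    List.append_assoc, h, mulF, RepL.eval_append_enc
    (repL_grid (m := r) (n := c) (by simp [hr]) (by simp [hc]) (by simp) fun i j =>
      repL_ceq (repC_entry (repB_constB _) ?_ ?_) (repC_sum (n := m) (by simp [hm])
        fun k => repC_mul (repC_entry (repB_constB _) ?_ ?_) (repC_entry (repB_constB _) ?_ ?_))),
    RepV.eval_append_enc (repV_exBlk (by rw [hm, length_ticks]) (by rw [hc, length_ticks]) (by simp)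
      fun i j => repB_constB _), RepV.eval_append_enc (repV_exBlk (by rw [hr, length_ticks])
      (by rw [hm, length_ticks]) (by simp) fun i j => repB_constB _)]
  all_goals simp [ixG, jxG, kxG, eval]

theorem eval_letG {r c : ℕ} {w : Name} (hr : s .row2 = ticks r) (hc : s .col2 = ticks c)
    (hw : s .name = bits w) (φ₂ φ₁ : ExFormula) :
    letG.eval s ++ (encFormula φ₂ ++ encFormula φ₁) = encFormula (letF w r c φ₂ φ₁) := by
  have h (φ₂ : ExFormula) : (const [.and]).eval s ++ (encFormula φ₂ ++ encFormula φ₁) =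
    encFormula (.and φ₂ φ₁) := rfl
  rw [letG, eval_append, eval_append, eval_append, List.append_assoc, List.append_assoc,
    List.append_assoc, ← List.append_assoc (eval _ _) (encFormula φ₂), RepL.eval_append_enc
    (repL_grid (m := r) (n := c) (by simp [hr]) (by simp [hc]) (by simp) fun i j =>
      repL_ceq (repC_entry (repB_zB (w' := w) ?_) ?_ ?_) (repC_entry (repB_constB _) ?_ ?_)),
    ← List.append_assoc (eval _ _) (encFormula _), RepV.eval_append_enc
      (repV_exBlk (by rw [hr, length_ticks]) (by rw [hc, length_ticks]) (by simp)
      fun i j => repB_zB ?_), h, RepV.eval_append_enc (repV_exBlk (by rw [hr, length_ticks])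
      (by rw [hc, length_ticks]) (by simp) fun i j => repB_constB _), letF]
  all_goals simp [ixG, jxG, eval, hw]

theorem eval_applyTermG {f : Name} {n i j : ℕ} (hf : s .fn = bits f) (hn : s .arg = ticks n)
    (hi : s .ix = ticks i) (hj : s .jx = ticks j) (p : Part) :
    (applyTermG p).eval s = outTerm (applyTerm f p n i j) := by
  have h (k : ℕ) : RepC (Function.update s .kx (ticks k)) (entry (argB .kx) ixG jxG)
      (.entry (.z (argBlk k)) i j) :=
    repC_entry (repB_argB (by simp)) (by simp [ixG, eval, hi]) (by simp [jxG, eval, hj])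
  have h0 : (List.ofFn fun k : Fin n => outTerm (.var (.z (argBlk k) i j .re)) ++
      outTerm (.var (.z (argBlk k) i j .im))).flatten = (List.range n).flatMap fun k =>
        outTerm (.var (.z (argBlk k) i j .re)) ++ outTerm (.var (.z (argBlk k) i j .im)) := by
    rw [List.flatMap_def]
    congr 1
    exact List.ext_getElem (by simp) fun k h1 h2 => by simp
  rw [applyTerm, outTerm, h0]
  simp only [applyTermG, eval_append, eval, hf, hn, (h _).1, (h _).2, CTerm.entry]
  simp [outName, outNat, bits, ticks]

theorem eval_applyG {f : Name} {n r c : ℕ} (hr : s .row = ticks r) (hc : s .col = ticks c)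
    (hf : s .fn = bits f) (hn : s .arg = ticks n) (φ : ExFormula) :
    applyG.eval s ++ encFormula φ = encFormula (applyF f n r c φ) := by
  have h : RepV s (each .kx .arg (exBlk (argB .kx) .row .col))
      ((List.range n).flatMap fun k => blkVars (.z (argBlk k)) r c) := by
    have h' (k : ℕ) : RepV (Function.update s .kx (ticks k)) (exBlk (argB .kx) .row .col)
        (blkVars (.z (argBlk k)) r c) := repV_exBlk (by simp [hr])
      (by simp [hc]) (by simp) fun i j => repB_argB (by simp)
    simp only [RepV] at h'
    simp [RepV, eval, h', hn, List.flatMap_assoc]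
  rw [applyG, eval_append, List.append_assoc, applyF, RepL.eval_append_enc
    (repL_grid (m := r) (n := c) (by simp [hr]) (by simp [hc]) (by simp) fun i j =>
      repL_ceq (repC_entry (repB_constB _) ?_ ?_) (b := ⟨applyTerm f .re n i j,
        applyTerm f .im n i j⟩) ⟨eval_applyTermG (by simpa using hf) (by simpa using hn) (by simp)
          (by simp) _, eval_applyTermG (by simpa using hf) (by simpa using hn) (by simp)
          (by simp) _⟩),
    h.eval_append_enc]
  all_goals simp [ixG, jxG, eval]

theorem eval_cneG {g h : TermGen} {a b : CTerm} (hg : RepC s g a) (hh : RepC s h b) :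
    (cneG g h).eval s = encFormula (cne a b) := by
  simp [cneG, eval, cne, encFormula, hg.1, hg.2, hh.1, hh.2]

theorem repC_dot {r : Stk} {g h : TermGen} {n : ℕ} {t u : ℕ → CTerm} (hr : (s r).length = n)
    (hg : ∀ k, RepC (Function.update s .kx (ticks k)) g (t k))
    (hh : ∀ k, RepC (Function.update s .kx (ticks k)) h (u k)) :
    RepC s (dotG r g h) (.sum n fun k => .mul (t k) (u k)) :=
  repC_sum hr fun k => repC_mul (hg k) (hh k)

theorem eval_eigBasisG {n : ℕ} (hr : s .row = ticks n) :
    eigBasisG.eval s = encFormula (eigBasisF n) := by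
  have h1 (i j : ℕ) : RepL (Function.update (Function.update s .ix (ticks i)) .jx (ticks j))
      (const [.and, .or] ++
        (cneG (entry (constB eigBlk₁) ixG ixG) (entry (constB eigBlk₁) jxG jxG) ++
        (ceqG (dotG .row (conjT (entry (constB outBlk) kxG ixG)) (entry (constB outBlk) kxG jxG))
          zeroT ++ verumG)))
      [.or (cne (.entry (.z eigBlk₁) i i) (.entry (.z eigBlk₁) j j))
        (ands (ceq (.sum n fun k => .mul (.conj (.entry (.z outBlk) k i)) (.entry (.z outBlk) k j))
          .zero) verum)] := by
    rw [RepL, eval_append, eval_append, eval_append, eval_verumG, RepL.eval_append_enc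
      (repL_ceq (repC_dot (n := n) (by simp [hr])
        (fun k => repC_conj (repC_entry (repB_constB outBlk) (m := k) (n := i) ?_ ?_))
        (fun k => repC_entry (repB_constB outBlk) (m := k) (n := j) ?_ ?_)) repC_zero),
      eval_cneG (repC_entry (repB_constB _) (m := i) (n := i) ?_ ?_)
        (repC_entry (repB_constB _) (m := j) (n := j) ?_ ?_)]
    · simp [eval, encFormula]
    all_goals simp [ixG, jxG, kxG, eval]
  simp only [eigBasisG, eval_append, eval_verumG]
  rw [RepL.eval_append_enc (repL_each (n := n) (by simp [hr]) fun i =>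
    repL_each (n := i) (by simp) fun j => repL_append (repL_ceq (repC_dot (n := n)
      (by simp [hr])
      (fun k => repC_entry (repB_constB outBlk) (m := i) (n := k) ?_ ?_)
      (fun k => repC_entry (repB_constB eigBlk₂) (m := k) (n := j) ?_ ?_)) repC_zero)
      (repL_append (repL_ceq (repC_dot (n := n) (by simp [hr])
      (fun k => repC_entry (repB_constB outBlk) (m := j) (n := k) ?_ ?_)
      (fun k => repC_entry (repB_constB eigBlk₂) (m := k) (n := i) ?_ ?_)) repC_zero) (h1 i j))),
    RepL.eval_append_enc (repL_each (n := n) (by simp [hr]) fun i =>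
      repL_ceq (repC_dot (n := n) (by simp [hr])
      (fun k => repC_entry (repB_constB outBlk) (m := i) (n := k) ?_ ?_)
      (fun k => repC_entry (repB_constB eigBlk₂) (m := k) (n := i) ?_ ?_)) repC_one),
    RepL.eval_append_enc (repL_grid (m := n) (n := n) (by simp [hr]) (by simp [hr])
      (by simp) fun i j => repL_ceq (repC_dot (n := n) (by simp [hr])
      (fun k => repC_entry (repB_constB (argBlk 0)) (m := i) (n := k) ?_ ?_)
      (fun k => repC_entry (repB_constB outBlk) (m := k) (n := j) ?_ ?_))
      (repC_mul (repC_entry (repB_constB eigBlk₁) (m := j) (n := j) ?_ ?_)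
        (repC_entry (repB_constB outBlk) (m := i) (n := j) ?_ ?_))),
    RepV.eval_append_enc (repV_exBlk (by rw [hr, length_ticks]) (by rw [hr, length_ticks]) (by simp)
      fun i j => repB_constB _),
    RepV.eval_append_enc (repV_exBlk (by rw [hr, length_ticks]) (by rw [hr, length_ticks]) (by simp)
      fun i j => repB_constB _), eigBasisF]
  all_goals simp [ixG, jxG, kxG, eval]

theorem eval_eigDefectG {n : ℕ} (hr : s .row = ticks n) :
    eigDefectG.eval s = encFormula (eigDefectF n) := by
  have h1 : (const [.lt]).eval s ++ (int0.eval s ++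
      (sumG .ix .row (sumG .jx .row (normSqG (entry (constB eigBlk₃) ixG jxG)))).eval s) =
      encFormula (.lt (.int 0) (rsum n fun i => rsum n fun j =>
        normSqTerm (.entry (.z eigBlk₃) i j))) := by
    rw [encFormula, eval_int0, eval_sumG (n := n) (by simp [hr]) fun i =>
      eval_sumG (n := n) (by simp [hr]) fun j => ?_]
    · rfl
    have h2 : RepC (Function.update (Function.update s .ix (ticks i)) .jx (ticks j))
      (entry (constB eigBlk₃) ixG jxG) (.entry (.z eigBlk₃) i j) :=
      repC_entry (repB_constB _) (by simp [ixG, eval]) (by simp [jxG, eval])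
    exact eval_addG (eval_mulG h2.1 h2.1) (eval_mulG h2.2 h2.2)
  simp only [eigDefectG, eval_append, h1]
  rw [RepL.eval_append_enc (repL_grid (m := n) (n := n) (by simp [hr]) (by simp [hr])
      (by simp) fun i j => repL_append (repL_ceq (repC_entry (repB_constB _) (m := i) (n := j)
        ?_ ?_) repC_zero) (repL_append (repL_ceq (repC_dot (n := n) (by simp [hr])
      (fun k => repC_entry (repB_constB (argBlk 0)) (m := i) (n := k) ?_ ?_)
      (fun k => repC_entry (repB_constB eigBlk₂) (m := k) (n := j) ?_ ?_))
      (repC_add (repC_mul (repC_entry (repB_constB eigBlk₁) (m := j) (n := j) ?_ ?_)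
        (repC_entry (repB_constB eigBlk₂) (m := i) (n := j) ?_ ?_))
        (repC_entry (repB_constB eigBlk₃) (m := i) (n := j) ?_ ?_)))
      (repL_ceq (repC_dot (n := n) (by simp [hr])
      (fun k => repC_entry (repB_constB (argBlk 0)) (m := i) (n := k) ?_ ?_)
      (fun k => repC_entry (repB_constB eigBlk₃) (m := k) (n := j) ?_ ?_))
      (repC_mul (repC_entry (repB_constB eigBlk₁) (m := j) (n := j) ?_ ?_)
        (repC_entry (repB_constB eigBlk₃) (m := i) (n := j) ?_ ?_))))),
    RepV.eval_append_enc (repV_exBlk (by rw [hr, length_ticks]) (by rw [hr, length_ticks]) (by simp)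
      fun i j => repB_constB _),
    RepV.eval_append_enc (repV_exBlk (by rw [hr, length_ticks]) (by rw [hr, length_ticks]) (by simp)
      fun i j => repB_constB _),
    RepV.eval_append_enc (repV_exBlk (by rw [hr, length_ticks]) (by rw [hr, length_ticks]) (by simp)
      fun i j => repB_constB _), eigDefectF]
  all_goals simp [ixG, jxG, kxG, eval]

theorem eval_eigenG {r c : ℕ} (hr : s .row = ticks r) (hc : s .col = ticks c) (φ : ExFormula) :
    eigenG.eval s ++ encFormula φ = encFormula (eigenF r c φ) := by
  have h : (const [.and, .or]).eval s ++ (eigBasisG.eval s ++ (eigDefectG.eval s ++ encFormula φ)) =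
      encFormula (.and (.or (eigBasisF r) (eigDefectF r)) φ) := by
    rw [eval_eigBasisG hr, eval_eigDefectG hr]
    simp [eval, encFormula]
  rw [eigenG, eval_append, eval_append, eval_append, List.append_assoc, List.append_assoc,
    List.append_assoc, h, RepV.eval_append_enc (repV_exBlk (by rw [hr, length_ticks])
      (by rw [hc, length_ticks]) (by simp) fun i j => repB_constB _), eigenF]

theorem eval_exVarG {r c : ℕ} {w : Name} (hr : s .row2 = ticks r) (hc : s .col2 = ticks c)
    (hw : s .name = bits w) (φ : ExFormula) :
    exVarG.eval s ++ encFormula φ = encFormula (exs (blkVars (.z w) r c) φ) :=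
  RepV.eval_append_enc (repV_exBlk (by rw [hr, length_ticks]) (by rw [hc, length_ticks]) (by simp)
      fun i j => repB_zB (by simpa [eval] using hw)) _

theorem eval_inputG {r c : ℕ} {M : Name} (hr : s .row = ticks r) (hc : s .col = ticks c)
    (hw : s .name = bits M) (φ : ExFormula) :
    inputG.eval s ++ encFormula φ = encFormula (ands (grid r c fun i j =>
      ceq (.entry (.z (varBlk M)) i j) (.entry (.x M) i j)) φ) := by
  rw [inputG, RepL.eval_append_enc
    (repL_grid (m := r) (n := c) (by simp [hr]) (by simp [hc]) (by simp) fun i j =>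
      repL_ceq (repC_entry (repB_zB (w' := varBlk M) ?_) ?_ ?_)
        (repC_entry (repB_xB (w' := M) ?_) ?_ ?_))]
  all_goals simp [ixG, jxG, eval, hw, varBlk, bits]

theorem eval_outputG {r c : ℕ} (hr : s .row = ticks r) (hc : s .col = ticks c)
    (φ₂ φ₁ : ExFormula) :
    outputG.eval s ++ (encFormula φ₂ ++ encFormula φ₁) = encFormula (exs (blkVars (.z outBlk) r c)
      (ands (grid r c fun i j => ceq (.entry (.z outBlk) i j) (.entry .y i j)) (.and φ₂ φ₁))) := by
  have h : (const [.and]).eval s ++ (encFormula φ₂ ++ encFormula φ₁) =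
    encFormula (.and φ₂ φ₁) := rfl
  rw [outputG, eval_append, eval_append, List.append_assoc, List.append_assoc, h,
    RepL.eval_append_enc (repL_grid (m := r) (n := c) (by simp [hr]) (by simp [hc])
      (by simp) fun i j => repL_ceq (repC_entry (repB_constB _) ?_ ?_) (repC_entry repB_yB ?_ ?_)),
    RepV.eval_append_enc (repV_exBlk (by rw [hr, length_ticks]) (by rw [hc, length_ticks]) (by simp)
      fun i j => repB_constB _)]
  all_goals simp [ixG, jxG, eval]

end Gen

/-! ### Stores with named contents -/

/-- The contents of all work stacks. -/
structure Regs : Type where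
  out : List OutTok := []
  src : List OutTok := []
  spare : List OutTok := []
  kont : List OutTok := []
  env : List OutTok := []
  back : List OutTok := []
  tmp : List OutTok := []
  name : List OutTok := []
  name2 : List OutTok := []
  row : List OutTok := []
  col : List OutTok := []
  row2 : List OutTok := []
  col2 : List OutTok := []
  mid : List OutTok := []
  arg : List OutTok := []
  fn : List OutTok := []
  num : List OutTok := []
  flag : List OutTok := []
  ix : List OutTok := []
  jx : List OutTok := []
  kx : List OutTok := []

namespace Regs

def store (R : Regs) : Store
  | .out => R.out
  | .src => R.src
  | .spare => R.spare
  | .kont => R.kont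
  | .env => R.env
  | .back => R.back
  | .tmp => R.tmp
  | .name => R.name
  | .name2 => R.name2
  | .row => R.row
  | .col => R.col
  | .row2 => R.row2
  | .col2 => R.col2
  | .mid => R.mid
  | .arg => R.arg
  | .fn => R.fn
  | .num => R.num
  | .flag => R.flag
  | .ix => R.ix
  | .jx => R.jx
  | .kx => R.kx

def set (R : Regs) : Stk → List OutTok → Regs
  | .out, l => { R with out := l }
  | .src, l => { R with src := l }
  | .spare, l => { R with spare := l }
  | .kont, l => { R with kont := l }
  | .env, l => { R with env := l }
  | .back, l => { R with back := l }
  | .tmp, l => { R with tmp := l }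
  | .name, l => { R with name := l }
  | .name2, l => { R with name2 := l }
  | .row, l => { R with row := l }
  | .col, l => { R with col := l }
  | .row2, l => { R with row2 := l }
  | .col2, l => { R with col2 := l }
  | .mid, l => { R with mid := l }
  | .arg, l => { R with arg := l }
  | .fn, l => { R with fn := l }
  | .num, l => { R with num := l }
  | .flag, l => { R with flag := l }
  | .ix, l => { R with ix := l }
  | .jx, l => { R with jx := l }
  | .kx, l => { R with kx := l }

/-- Turns an update of a store into an update of a record field, so that chains of updates normalize
and final stores can be compared field by field. -/
theorem update_store (R : Regs) (k : Stk) (l : List OutTok) :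
    Function.update R.store k l = (R.set k l).store := by
  funext k'
  by_cases h : k' = k
  · subst h
    rw [Function.update_self]
    cases k' <;> rfl
  · rw [Function.update_of_ne h]
    cases k <;> cases k' <;> first | rfl | exact absurd rfl h

end Regs

namespace Prog

open Gen

/-! ### Execution rules with given contents -/

variable {a b : Stk} {s : Store} {x y : List OutTok}

theorem exec_push_of {t : OutTok} (ha : s a = x) :
    Exec (push a t) s (Function.update s a (t :: x)) 1 := ha ▸ exec_push a t s

theorem exec_move_of (hab : a ≠ b) (ha : s a = x) (hb : s b = y) :
    Exec (move a b) s (Function.update (Function.update s a []) b (x.reverse ++ y))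
      (2 * x.length + 1) := by
  subst ha hb
  exact exec_move hab s

theorem exec_moveField_of (hab : a ≠ b) {l r : List OutTok} (ha : s a = l ++ .close :: r)
    (hb : s b = y) (hl : OutTok.close ∉ l) :
    Exec (moveField a b) s (Function.update (Function.update s a r) b (l.reverse ++ y))
      (2 * l.length + 1) := by
  subst hb
  exact exec_moveField hab s l r ha hl

theorem exec_clear_of (ha : s a = x) :
    Exec (clear a) s (Function.update s a []) (2 * x.length + 1) := ha ▸ exec_clear a s

theorem Exec.case_of {f : Option OutTok → Prog} {s' : Store} {T : ℕ} (ha : s a = x)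
    (h : Exec (f x.head?) (Function.update s a x.tail) s' T) : Exec (.case a f) s s' (T + 1) := by
  subst ha
  exact .case h

/-- At the outermost level no loop is active, so all counters are empty and need no length bound. -/
theorem exec_gen {p : Gen} (h : p.ok []) {s : Store} {n : ℕ} {o o' : List OutTok}
    (hi : s .ix = [] ∧ s .jx = [] ∧ s .kx = [] ∧ s .tmp = [])
    (hn : (s .name).length ≤ n ∧ (s .row).length ≤ n ∧ (s .col).length ≤ n ∧
      (s .row2).length ≤ n ∧ (s .col2).length ≤ n ∧ (s .arg).length ≤ n ∧ (s .fn).length ≤ n)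
    (ho : s .out = o) (he : p.eval s ++ o = o') :
    Exec p.prog s (Function.update s .out o') (p.cost.eval n) := by
  subst ho he
  refine Gen.exec_prog h (fun i hi' _ => ?_) hi.2.2.2 fun r hr => ?_
  · cases i <;> simp_all [isIndex]
  · cases r <;> simp_all [isReg]

theorem close_notMem_bits (w : Name) : OutTok.close ∉ bits w := by simp [bits]

theorem close_notMem_ticks (n : ℕ) : OutTok.close ∉ ticks n := by simp [ticks]

@[simp] theorem reverse_ticks (n : ℕ) : (ticks n).reverse = ticks n := by simp [ticks]

@[simp] theorem length_bits (w : Name) : (bits w).length = w.length := by simp [bits]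

/-! ### The environment -/

/-- An entry of the environment stack. -/
def encEntry (q : Name × ℕ × ℕ) : List OutTok :=
  .and :: (bits q.1 ++ .close :: (ticks q.2.1 ++ .close :: (ticks q.2.2 ++ [.close])))

def encEnv (env : Env) : List OutTok := env.flatMap encEntry

theorem encEnv_cons (q : Name × ℕ × ℕ) (env : Env) : encEnv (q :: env) =
    .and :: (bits q.1 ++ .close :: (ticks q.2.1 ++ .close :: (ticks q.2.2 ++ .close ::
      encEnv env))) := by
  simp [encEnv, encEntry]

/-- Add the entry given by `name`, `row` and `col` to the environment. -/
def pushEntry : Prog :=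
  block [push .env .close, move .col .env, push .env .close, move .row .env, push .env .close,
    move .name .name2, move .name2 .env, push .env .and]

/-- The fields are pushed last one first. The name goes through `name2` to keep its order; for runs
of ticks a reversal does not matter. -/
theorem exec_pushEntry (R : Regs) (env : Env) (w : Name) (r c n : ℕ) (h1 : R.env = encEnv env)
    (h2 : R.name = bits w) (h3 : R.name2 = []) (h4 : R.row = ticks r) (h5 : R.col = ticks c)
    (hn : w.length + r + c ≤ n) :
    Exec pushEntry R.store
      { R with env := encEnv ((w, r, c) :: env), name := [], row := [], col := [] }.store
      (4 * n + 20) := by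
  obtain ⟨⟩ := R
  simp only at h1 h2 h3 h4 h5
  subst h1 h2 h3 h4 h5
  refine ((exec_push_of (x := encEnv env) rfl).seq <|
    (exec_move_of (x := ticks c) (y := .close :: encEnv env) (by decide) rfl ?_).seq <|
    (exec_push_of (x := ticks c ++ .close :: encEnv env) ?_).seq <|
    (exec_move_of (x := ticks r) (y := .close :: (ticks c ++ .close :: encEnv env))
      (by decide) ?_ ?_).seq <|
    (exec_push_of (x := ticks r ++ .close :: (ticks c ++ .close :: encEnv env)) ?_).seq <|
    (exec_move_of (x := bits w) (y := []) (by decide) ?_ ?_).seq <|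
    (exec_move_of (x := (bits w).reverse)
      (y := .close :: (ticks r ++ .close :: (ticks c ++ .close :: encEnv env)))
      (by decide) ?_ ?_).seq <|
    (exec_push_of (x := bits w ++
      .close :: (ticks r ++ .close :: (ticks c ++ .close :: encEnv env))) ?_)).of_eq ?_ ?_
  all_goals simp [Regs.update_store, Regs.set, Regs.store, encEnv_cons]
  omega

end Prog

namespace Prog

open Gen

/-- Remove an entry, without its first symbol, from the environment, and put it on `name`, `row2`
and `col2`. -/
def popEntry : Prog :=
  block [moveField .env .name2, move .name2 .name, moveField .env .row2, moveField .env .col2]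

theorem exec_popEntry (R : Regs) (w : Name) (r c n : ℕ) (l : List OutTok)
    (h1 : R.env = bits w ++ .close :: (ticks r ++ .close :: (ticks c ++ .close :: l)))
    (h2 : R.name = []) (h3 : R.name2 = []) (h4 : R.row2 = []) (h5 : R.col2 = [])
    (hn : w.length + r + c ≤ n) :
    Exec popEntry R.store
      { R with env := l, name := bits w, row2 := ticks r, col2 := ticks c }.store
      (4 * n + 20) := by
  obtain ⟨⟩ := R
  simp only at h1 h2 h3 h4 h5
  subst h1 h2 h3 h4 h5
  refine ((exec_moveField_of (l := bits w)
      (r := ticks r ++ .close :: (ticks c ++ .close :: l)) (y := []) (by decide) rfl ?_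
      (close_notMem_bits w)).seq <|
    (exec_move_of (x := (bits w).reverse) (y := []) (by decide) ?_ ?_).seq <|
    (exec_moveField_of (l := ticks r) (r := ticks c ++ .close :: l) (y := []) (by decide) ?_ ?_
      (close_notMem_ticks r)).seq <|
    exec_moveField_of (l := ticks c) (r := l) (y := []) (by decide) ?_ ?_
      (close_notMem_ticks c)).of_eq ?_ ?_
  all_goals simp [Regs.update_store, Regs.set, Regs.store]
  omega

/-- Move the symbols of `env` before the next `close` to `back`, and compare them with the symbols
of `name`, which are moved to `name2`. -/
def compareField : Prog := loop .env inField fun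
  | none => skip
  | some x => seq (push .back x) (case .name fun y =>
      seq (pushOpt .name2 y) (if y = some x then skip else push .flag .tick))

theorem exec_pushOpt_head {a : Stk} {s : Store} {x y : List OutTok} (ha : s a = y) :
    Exec (pushOpt a x.head?) s (Function.update s a ((x.take 1).reverse ++ y)) 1 := by
  subst ha
  cases x with
  | nil => exact (exec_skip s).of_eq (by simp) le_rfl
  | cons t x => exact exec_push a t s

/-- The flag collects a tick for every mismatch, including the case where `name` runs out first. It
stays empty iff the entry's name is a prefix of the one sought. Nothing is lost: the consumed
symbols lie on `back` and `name2`. -/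
theorem exec_compareField (l r ys : List OutTok) (hl : OutTok.close ∉ l) (R : Regs)
    (h1 : R.env = l ++ .close :: r) (h2 : R.name = ys) :
    ∃ f, (f = [] ↔ R.flag = [] ∧ l = ys.take l.length) ∧ f.length ≤ R.flag.length + l.length ∧
      Exec compareField R.store { R with
        env := r
        name := ys.drop l.length
        name2 := (ys.take l.length).reverse ++ R.name2
        back := l.reverse ++ R.back
        flag := f }.store (7 * l.length + 1) := by
  induction l generalizing R ys with
  | nil =>
    refine ⟨R.flag, by simp, by simp, (Exec.loop_stop ?_).of_eq ?_ ?_⟩ <;> obtain ⟨⟩ := R <;>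
      simp_all [Regs.update_store, Regs.set, Regs.store, inField]
  | cons x l ih =>
    simp only [List.mem_cons, not_or] at hl
    have h3 : ∃ f, (f = [] ↔ R.flag = [] ∧ ys.head? = some x) ∧ f.length ≤ R.flag.length + 1 ∧
        ∀ s : Store, s .flag = R.flag →
          Exec (if ys.head? = some x then skip else push .flag .tick) s
            (Function.update s .flag f) 1 := by
      split_ifs with h
      · refine ⟨R.flag, by simp [h], by simp, fun s hs => ?_⟩
        rw [← hs, Function.update_eq_self]
        exact exec_skip s
      · exact ⟨.tick :: R.flag, by simp [h], by simp, fun s hs => exec_push_of hs⟩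
    obtain ⟨f, hf, hf', hf''⟩ := h3
    obtain ⟨f₂, h4, h5, h6⟩ := ih ys.tail hl.2 { R with
      env := l ++ .close :: r
      back := x :: R.back
      name := ys.tail
      name2 := (ys.take 1).reverse ++ R.name2
      flag := f } rfl rfl
    refine ⟨f₂, ?_, ?_, (Exec.loop_step ?_ ?_ h6).of_eq (T := 6 + (7 * l.length + 1) + 1) ?_ ?_⟩
    · rw [h4, hf]
      cases ys <;> simp [eq_comm, and_assoc]
    · simp only [List.length_cons] at h5 ⊢; omega
    · simp [Regs.store, h1, inField, Ne.symm hl.1]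
    · have h7 : (R.store .env).head? = some x := by simp [Regs.store, h1]
      rw [h7]
      refine ((exec_push_of (x := R.back) ?_).seq (Exec.case_of (x := ys) ?_
        ((exec_pushOpt_head (y := R.name2) ?_).seq (hf'' _ ?_)))).of_eq ?_ ?_ <;>
        obtain ⟨⟩ := R <;>
        simp_all [Regs.update_store, Regs.set, Regs.store]
    · obtain ⟨⟩ := R
      cases ys <;> simp
    · simp only [List.length_cons]; omega

/-- Move the symbols of `env` before the next `close` to `back` and, without that `close`, to `b`.
-/
def copyField (b : Stk) : Prog := seq (loop .env inField fun
  | none => skip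
  | some x => seq (push b x) (push .back x)) (push .back .close)

theorem exec_copyField {b : Stk} (hb : b ≠ .env) (hb' : b ≠ .back) (l r x y : List OutTok)
    (hl : OutTok.close ∉ l) (s : Store) (h1 : s .env = l ++ .close :: r) (h2 : s b = x)
    (h3 : s .back = y) :
    Exec (copyField b) s (Function.update (Function.update (Function.update s .env r) b
      (l.reverse ++ x)) .back (.close :: (l.reverse ++ y))) (4 * l.length + 3) := by
  have key : Exec (loop .env inField fun
      | none => skip
      | some x => seq (push b x) (push .back x)) s
      (Function.update (Function.update (Function.update s .env r) b
        (l.reverse ++ x)) .back (l.reverse ++ y)) (4 * l.length + 1) := by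
    induction l generalizing s x y with
    | nil =>
      refine (Exec.loop_stop (by simp [h1, inField])).of_eq ?_ (by simp)
      funext k
      by_cases hk : k = .back
      · subst hk; simp [h3]
      · by_cases hk' : k = b
        · subst hk'; simp [hk, hb, h2]
        · simp [h1, hk, hk']
    | cons t l ih =>
      simp only [List.mem_cons, not_or] at hl
      refine (Exec.loop_step (by simp [h1, inField, Ne.symm hl.1]) (T := 3)
        (s' := Function.update (Function.update (Function.update s .env (l ++ .close :: r)) b
          (t :: x)) .back (t :: y)) ?_ (ih (t :: x) (t :: y) hl.2 _ ?_ ?_ ?_)).of_eq ?_ ?_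
      · rw [h1]
        refine ((exec_push_of (x := x) ?_).seq (exec_push_of (x := y) ?_)).of_eq ?_ le_rfl
        · simp [hb, h2]
        · simp [hb'.symm, h3]
        · simp
      · simp [hb.symm]
      · simp [hb']
      · simp
      · funext k
        by_cases hk : k = .back
        · subst hk; simp
        · by_cases hk' : k = b
          · subst hk'; simp [hk]
          · by_cases hk'' : k = .env
            · subst hk''; simp [hk']
            · simp [hk, hk', hk'']
      · simp only [List.length_cons]; omega
  exact (key.seq (exec_push_of (x := l.reverse ++ y) (by simp))).of_eq (by simp) (by omega)

/-- Compare the next entry of the environment with `name`. -/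
def checkEntry : Prog :=
  block [push .back .and, compareField, push .back .close,
    case .name fun
      | none => skip
      | some y => seq (push .flag .tick) (push .name y),
    move .name2 .name, copyField .row, copyField .col,
    case .flag fun
      | none => push .env .close
      | some _ => block [clear .flag, clear .row, clear .col]]

/-- On a match a `close` is put on the rest of the environment; it is not the start symbol of an
entry, so the search loop stops there and consumes it. The dimensions are copied before the outcome
is inspected and erased again on a mismatch. -/
theorem exec_checkEntry (R : Regs) (w w' : Name) (r c n : ℕ) (l : List OutTok)
    (h1 : R.env = bits w' ++ .close :: (ticks r ++ .close :: (ticks c ++ .close :: l)))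
    (h2 : R.name = bits w) (h3 : R.name2 = []) (h4 : R.row = []) (h5 : R.col = [])
    (h6 : R.flag = []) (hn : w'.length + r + c ≤ n) (hn' : w.length ≤ n) :
    Exec checkEntry R.store (if w' = w then
      { R with
        env := .close :: l
        back := (encEntry (w', r, c)).reverse ++ R.back
        row := ticks r
        col := ticks c }
      else { R with env := l, back := (encEntry (w', r, c)).reverse ++ R.back }).store
      (30 * n + 60) := by
  obtain ⟨f, hf, hf', hC⟩ := exec_compareField (bits w')
    (ticks r ++ .close :: (ticks c ++ .close :: l)) (bits w) (close_notMem_bits _)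
    { R with back := .and :: R.back } h1 h2
  -- If symbols of the name sought are left over, the entry's name is shorter, which counts as a
  -- mismatch too; the popped symbol is put back.
  have hC2 : ∃ f', (f' = [] ↔ w' = w) ∧ f'.length ≤ n + 1 ∧ ∀ s : Store, s .flag = f →
      s .name = (bits w).drop (bits w').length → Exec (case .name fun
      | none => skip
      | some y => seq (push .flag .tick) (push .name y)) s (Function.update s .flag f') 4 := by
    have hb : bits w' = bits w ↔ w' = w := by
      refine (List.map_injective_iff.2 fun a b h => ?_).eq_iff
      injection h
    cases hd : (bits w).drop (bits w').length with
    | nil =>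
      refine ⟨f, ?_, ?_, fun s hs hs' => ?_⟩
      · rw [hf, List.take_of_length_le (List.drop_eq_nil_iff.1 hd), hb]
        exact and_iff_right h6
      · simp only [h6, List.length_nil, length_bits] at hf'; omega
      · have h1 := Function.update_eq_self Stk.flag s
        have h2 := Function.update_eq_self Stk.name s
        rw [hs] at h1
        rw [hs'] at h2
        exact (Exec.case_of hs' (exec_skip _)).of_eq (h2.trans h1.symm) (by omega)
    | cons y z =>
      refine ⟨.tick :: f, ?_, ?_, fun s hs hs' => ?_⟩
      · simp only [reduceCtorEq, false_iff, ← hb]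
        intro h
        rw [h, List.drop_length] at hd
        cases hd
      · simp only [h6, List.length_nil, length_bits, List.length_cons] at hf' ⊢; omega
      · refine (Exec.case_of hs' ((exec_push_of (x := f) (by simpa using hs)).seq
          (exec_push_of (x := z) (by simp)))).of_eq ?_ (by omega)
        funext k
        by_cases hk : k = .name
        · subst hk; simp [hs']
        · by_cases hk' : k = .flag
          · subst hk'; simp
          · simp [hk, hk']
  obtain ⟨f', hf1, hf2, hC2⟩ := hC2
  have hlen : ((bits w).take (bits w').length).length ≤ n := by simp; omega
  clear hf hf'
  generalize hq : (bits w).take (bits w').length = q at *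
  generalize hd : (bits w).drop (bits w').length = d at *
  have hqd : bits w = q ++ d := by rw [← hq, ← hd, List.take_append_drop]
  clear hq hd
  generalize hS : Regs.store (if w' = w then _ else _) = S
  obtain ⟨⟩ := R
  simp only at h1 h2 h3 h4 h5 h6
  subst h1 h2 h3 h4 h5 h6
  rename_i back _ _ _ _ _ _ _ _ _ _
  refine (((exec_push_of (x := back) rfl).of_eq (Regs.update_store _ _ _) le_rfl).seq <| hC.seq <|
    (exec_push_of (x := (bits w').reverse ++ .and :: back) rfl).seq <|
    (hC2 _ ?_ ?_).seq <|
    (exec_move_of (x := q.reverse) (y := d) (by decide) ?_ ?_).seq <|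
    (exec_copyField (by decide) (by decide) (ticks r) (ticks c ++ .close :: l) []
      (.close :: ((bits w').reverse ++ .and :: back)) (close_notMem_ticks _) _ ?_ ?_ ?_).seq <|
    (exec_copyField (by decide) (by decide) (ticks c) l []
      (.close :: (ticks r ++ .close :: ((bits w').reverse ++ .and :: back)))
      (close_notMem_ticks _) _ ?_ ?_ ?_).seq <|
    Exec.case_of (x := f') ?_ (T := 2 * n + 2 * r + 2 * c + 10) (s' := S) ?_).of_eq rfl ?_
  rotate_right 2
  · split_ifs at hS with hw
    · obtain rfl := hf1.2 hw
      subst hw hS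
      refine (exec_push_of (x := l) ?_).of_eq ?_ (by omega)
      all_goals simp [Regs.update_store, Regs.set, Regs.store, encEntry, hqd]
    · obtain ⟨t, f', rfl⟩ := List.exists_cons_of_ne_nil (fun h => hw (hf1.1 h))
      subst hS
      refine ((exec_clear_of (x := f') ?_).seq <| (exec_clear_of (x := ticks r) ?_).seq
        (exec_clear_of (x := ticks c) ?_)).of_eq ?_ ?_
      rotate_right 1
      · simp at hf2 ⊢; omega
      all_goals simp [Regs.update_store, Regs.set, Regs.store, encEntry, hqd]
  · simp at hlen ⊢; omega
  all_goals simp [Regs.update_store, Regs.set, Regs.store]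

/-- Put the dimensions of the variable with the given `name` on `row` and `col`. -/
def lookup : Prog := seq (loop .env (· == some .and) fun _ => checkEntry) (move .back .env)

/-- The scanned part x of the environment ends up reversed on `back`, and the unscanned part y
remains. The topmost match is found, so inner variables hide outer ones as in `List.lookup`. -/
theorem exec_lookup_loop (w : Name) (r c n : ℕ) (env : Env) (R : Regs)
    (h : env.lookup w = some (r, c)) (h1 : R.env = encEnv env) (h2 : R.name = bits w)
    (h3 : R.name2 = []) (h4 : R.row = []) (h5 : R.col = []) (h6 : R.flag = [])
    (hn : (encEnv env).length ≤ n) (hn' : w.length ≤ n) :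
    ∃ x y, x.reverse ++ y = encEnv env ∧
    Exec (loop .env (· == some .and) fun _ => checkEntry) R.store
      { R with env := y, back := x ++ R.back, row := ticks r, col := ticks c }.store
      (env.length * (30 * n + 61) + 1) := by
  induction env generalizing R with
  | nil => simp at h
  | cons q env ih =>
    obtain ⟨w', r', c'⟩ := q
    rw [encEnv_cons] at h1 hn
    simp only [List.length_cons, List.length_append, length_bits, length_ticks] at hn
    have h7 := exec_checkEntry (R.set .env (R.store .env).tail) w w' r' c' n (encEnv env)
      (by simp [Regs.store, Regs.set, h1]) h2 h3 h4 h5 h6 (by omega) hn'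
    rw [← Regs.update_store] at h7
    have h8 : (R.store .env).head? = some .and := by simp [Regs.store, h1]
    rw [List.lookup_cons] at h
    by_cases hw : w' = w
    · subst hw
      simp only [beq_self_eq_true, Option.some.injEq, Prod.mk.injEq] at h
      obtain ⟨rfl, rfl⟩ := h
      refine ⟨(encEntry (w', r', c')).reverse, encEnv env, by simp [encEnv], ?_⟩
      rw [if_pos rfl] at h7
      refine (Exec.loop_step (by rw [h8]; rfl) h7 (Exec.loop_stop ?_)).of_eq ?_ ?_
      · simp [Regs.store]
      · obtain ⟨⟩ := R
        simp [Regs.update_store, Regs.set, Regs.store]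
      · simp only [List.length_cons, Nat.add_mul]
        omega
    · rw [if_neg hw] at h7
      have : (w == w') = false := by simpa using Ne.symm hw
      simp only [this] at h
      obtain ⟨x, y, hxy, h9⟩ := ih { R with
        env := encEnv env
        back := (encEntry (w', r', c')).reverse ++ R.back } h rfl h2 h3 h4 h5 h6 (by omega)
      refine ⟨x ++ (encEntry (w', r', c')).reverse, y, ?_,
        (Exec.loop_step (by rw [h8]; rfl) h7 h9).of_eq ?_ ?_⟩
      · rw [List.reverse_append, List.append_assoc, hxy]
        simp [encEnv]
      · obtain ⟨⟩ := R
        simp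
      · simp only [List.length_cons, Nat.add_mul]
        omega

theorem exec_lookup (w : Name) (r c n : ℕ) (env : Env) (R : Regs)
    (h : env.lookup w = some (r, c)) (h1 : R.env = encEnv env) (h2 : R.name = bits w)
    (h3 : R.name2 = []) (h4 : R.row = []) (h5 : R.col = []) (h6 : R.flag = []) (h7 : R.back = [])
    (hn : (encEnv env).length ≤ n) (hn' : w.length ≤ n) :
    Exec lookup R.store { R with row := ticks r, col := ticks c }.store
      (n * (30 * n + 61) + 2 * n + 3) := by
  obtain ⟨x, y, hxy, h8⟩ := exec_lookup_loop w r c n env R h h1 h2 h3 h4 h5 h6 hn hn'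
  refine (h8.seq (exec_move_of (x := x) (y := y) (by decide) ?_ rfl)).of_eq ?_ ?_
  · simp [Regs.store, h7]
  · rw [hxy, ← h1]
    obtain ⟨⟩ := R
    simp only at h7
    subst h7
    simp [Regs.update_store, Regs.set]
  · have h9 : ∀ env : Env, env.length ≤ (encEnv env).length := by
      intro env
      induction env with
      | nil => simp
      | cons q env ih => rw [encEnv_cons]; simp; omega
    have h10 : x.length ≤ (encEnv env).length := by rw [← hxy]; simp
    have h11 := Nat.mul_le_mul_right (30 * n + 61) ((h9 env).trans hn)
    omega

end Prog

/-! ### The single steps of the translation of expressions -/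

namespace Prog

open Gen

/-- The stores between the steps of the translation of expressions. -/
abbrev stage (o i k : List OutTok) (env : Env) (r c : ℕ) : Store :=
  Regs.store { out := o, src := i, kont := k, env := encEnv env, row := ticks r, col := ticks c }

/-- A bound for the running time of each step of the translation. -/
noncomputable def stepCost : Polynomial ℕ :=
  varG.cost + wrapG.cost + transpG.cost + onesG.cost + diagG.cost + mulOpG.cost + letG.cost +
    applyG.cost + eigenG.cost + exVarG.cost + inputG.cost + outputG.cost + verumG.cost +
    Polynomial.X * (30 * Polynomial.X + 61) + 100 * Polynomial.X + 200

theorem eval_stepCost (n : ℕ) : stepCost.eval n =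
    varG.cost.eval n + wrapG.cost.eval n + transpG.cost.eval n + onesG.cost.eval n +
    diagG.cost.eval n + mulOpG.cost.eval n + letG.cost.eval n +
    applyG.cost.eval n + eigenG.cost.eval n + exVarG.cost.eval n + inputG.cost.eval n +
    outputG.cost.eval n + verumG.cost.eval n + n * (30 * n + 61) + 100 * n + 200 := by
  simp [stepCost]

/-- The translation of a variable. -/
def evalVar : Prog :=
  block [moveField .src .name2, move .name2 .name, push .name (.bit false), lookup, varG.prog,
    clear .name]

theorem exec_evalVar {o i k : List OutTok} {env : Env} {M : Name} {r c n : ℕ}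
    (h : env.lookup (varBlk M) = some (r, c)) (hn : (encEnv env).length ≤ n) (hM : M.length < n)
    (hr : r ≤ n) (hc : c ≤ n) :
    Exec evalVar (stage o (bits M ++ .close :: i) k env 0 0)
      (stage (encFormula (varF (varBlk M) r c) ++ o) i k env r c) (stepCost.eval n) := by
  refine ((exec_moveField_of (l := bits M) (r := i) (y := []) (by decide) rfl rfl
      (close_notMem_bits M)).seq <|
    (exec_move_of (x := (bits M).reverse) (y := []) (by decide) ?_ ?_).seq <|
    ((exec_push_of (x := bits M) ?_).of_eq (s'' := Regs.store
      { out := o, src := i, kont := k, env := encEnv env, name := bits (varBlk M) }) ?_ le_rfl).seq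
    <| (exec_lookup (varBlk M) r c n env _ h rfl rfl rfl rfl rfl rfl rfl hn
      (by simpa [varBlk] using hM)).seq <|
    (exec_gen (n := n) (p := varG) rfl (o := o) (o' := encFormula (varF (varBlk M) r c) ++ o)
      ?_ ?_ ?_ (congrArg (· ++ o) (eval_varG rfl rfl rfl))).seq <|
    exec_clear_of (x := bits (varBlk M)) ?_).of_eq ?_ ?_
  rotate_right 1
  · rw [eval_stepCost]; simp [varBlk]; omega
  all_goals simp [Regs.update_store, Regs.set, Regs.store, hr, hc, varBlk]
  · rfl
  · omega

/-- The end of the translation of a unary operation. -/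
def unaryEnd (g : Gen) (p : Prog) : Prog := block [wrapG.prog, g.prog, p]

theorem exec_unaryEnd {o i k : List OutTok} {env : Env} {r c r' c' n T : ℕ} {g : Gen} {p : Prog}
    {φ ψ : ExFormula} (hr : r ≤ n) (hc : c ≤ n) (hg : g.ok [])
    (hψ : ∀ s : Store, s .row = ticks r → s .col = ticks c →
      g.eval s ++ encFormula (wrap 0 r c φ) = encFormula ψ)
    (hp : Exec p (stage (encFormula ψ ++ o) i k env r c)
      (stage (encFormula ψ ++ o) i k env r' c') T) :
    Exec (unaryEnd g p) (stage (encFormula φ ++ o) i k env r c)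
      (stage (encFormula ψ ++ o) i k env r' c')
      (wrapG.cost.eval n + g.cost.eval n + T + 2) := by
  refine ((exec_gen (n := n) (p := wrapG) rfl (o := encFormula φ ++ o)
    (o' := encFormula (wrap 0 r c φ) ++ o) ?_ ?_ rfl ?_).seq <|
    ((exec_gen (n := n) hg (o := encFormula (wrap 0 r c φ) ++ o)
    (o' := encFormula ψ ++ o) ?_ ?_ ?_ ?_).of_eq ?_ le_rfl).seq hp).of_eq rfl (by omega)
  · simp [Regs.store]
  · simp [Regs.store, hr, hc]
  · rw [← List.append_assoc, eval_wrapG (r := r) (c := c) (k := 0) rfl rfl rfl]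
  · simp [Regs.store]
  · simp [Regs.store, hr, hc]
  · simp
  · rw [← List.append_assoc, hψ _ (by simp [Regs.store]) (by simp [Regs.store])]
  · simp [Regs.update_store, Regs.set]

def transpEnd : Prog :=
  unaryEnd transpG (block [move .row .row2, move .col .row, move .row2 .col])

theorem exec_transpEnd {o i k : List OutTok} {env : Env} {r c n : ℕ} {φ : ExFormula} (hr : r ≤ n)
    (hc : c ≤ n) : Exec transpEnd (stage (encFormula φ ++ o) i k env r c)
      (stage (encFormula (transpF r c (wrap 0 r c φ)) ++ o) i k env c r) (stepCost.eval n) := by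
  refine (exec_unaryEnd hr hc rfl (fun s h h' => eval_transpG h h' _)
    (((exec_move_of (x := ticks r) (y := []) (by decide) rfl rfl).seq <|
    (exec_move_of (x := ticks c) (y := []) (by decide) ?_ ?_).seq <|
    (exec_move_of (x := ticks r) (y := []) (by decide) ?_ ?_)).of_eq ?_ le_rfl)).of_eq rfl ?_
  rotate_right 1
  · rw [eval_stepCost]; simp; omega
  all_goals simp [Regs.update_store, Regs.set, Regs.store]

def onesEnd : Prog := unaryEnd onesG (block [clear .col, push .col .tick])

theorem exec_onesEnd {o i k : List OutTok} {env : Env} {r c n : ℕ} {φ : ExFormula} (hr : r ≤ n)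
    (hc : c ≤ n) : Exec onesEnd (stage (encFormula φ ++ o) i k env r c)
      (stage (encFormula (onesF r c (wrap 0 r c φ)) ++ o) i k env r 1) (stepCost.eval n) := by
  refine (exec_unaryEnd hr hc rfl (fun s h h' => eval_onesG h h' _)
    (((exec_clear_of (x := ticks c) rfl).seq <|
    (exec_push_of (x := []) ?_)).of_eq ?_ le_rfl)).of_eq rfl ?_
  rotate_right 1
  · rw [eval_stepCost]; simp; omega
  all_goals simp [Regs.update_store, Regs.set]
  rfl

def diagEnd : Prog := unaryEnd diagG (block [clear .col, copy .row .col id])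

theorem exec_diagEnd {o i k : List OutTok} {env : Env} {r c n : ℕ} {φ : ExFormula} (hr : r ≤ n)
    (hc : c ≤ n) : Exec diagEnd (stage (encFormula φ ++ o) i k env r c)
      (stage (encFormula (diagF r c (wrap 0 r c φ)) ++ o) i k env r r) (stepCost.eval n) := by
  refine (exec_unaryEnd hr hc rfl (fun s h h' => eval_diagG h h' _)
    (((exec_clear_of (x := ticks c) rfl).seq <|
    (exec_copy (a := .row) (b := .col) id (by decide) (by decide) (by decide) _ ?_)).of_eq (U := 8
      * n + 10) ?_ ?_)).of_eq
      rfl ?_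
  rotate_right 1
  · rw [eval_stepCost]; omega
  all_goals simp [Regs.update_store, Regs.set, Regs.store]
  omega

def eigenEnd : Prog := unaryEnd eigenG skip

theorem exec_eigenEnd {o i k : List OutTok} {env : Env} {r c n : ℕ} {φ : ExFormula} (hr : r ≤ n)
    (hc : c ≤ n) : Exec eigenEnd (stage (encFormula φ ++ o) i k env r c)
      (stage (encFormula (eigenF r c (wrap 0 r c φ)) ++ o) i k env r c) (stepCost.eval n) := by
  refine (exec_unaryEnd hr hc rfl (fun s h h' => eval_eigenG h h' _) (exec_skip _)).of_eq rfl ?_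
  rw [eval_stepCost]; omega

/-- The part of the translation of a product between the factors. -/
def mulMid : Prog :=
  block [wrapG.prog, push .kont .close, move .row .kont, clear .col, push .kont .add,
    push .kont .var]

/-- The number of rows of the first factor is saved on the task stack, below the task that will need
it; its number of columns is dropped. -/
theorem exec_mulMid {o i k : List OutTok} {env : Env} {r c n : ℕ} {φ : ExFormula} (hr : r ≤ n)
    (hc : c ≤ n) : Exec mulMid (stage (encFormula φ ++ o) i k env r c)
      (stage (encFormula (wrap 0 r c φ) ++ o) i (.var :: .add :: (ticks r ++ .close :: k)) env 0 0)
      (stepCost.eval n) := by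
  refine ((exec_gen (n := n) (p := wrapG) rfl (o := encFormula φ ++ o)
    (o' := encFormula (wrap 0 r c φ) ++ o) ?_ ?_ rfl ?_).seq <|
    (exec_push_of (x := k) ?_).seq <|
    (exec_move_of (x := ticks r) (y := .close :: k) (by decide) ?_ ?_).seq <|
    (exec_clear_of (x := ticks c) ?_).seq <|
    (exec_push_of (x := ticks r ++ .close :: k) ?_).seq <|
    (exec_push_of (x := .add :: (ticks r ++ .close :: k)) ?_)).of_eq ?_ ?_
  rotate_right 1
  · rw [eval_stepCost]; simp; omega
  rotate_left 2
  · rw [← List.append_assoc, eval_wrapG (r := r) (c := c) (k := 0) rfl rfl rfl]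
  all_goals simp [Regs.update_store, Regs.set, Regs.store, hr, hc]
  rfl

/-- The inner dimension is read off as the number of rows of the second factor, and `mulF` in
`trans` is given this same number. The tick on `arg` selects argument block 1. -/
def mulEnd : Prog :=
  block [moveField .kont .row2, push .arg .tick, wrapG.prog, mulOpG.prog, clear .arg, clear .row,
    move .row2 .row]

theorem exec_mulEnd {o i k : List OutTok} {env : Env} {r m c n : ℕ} {φ₁ φ₂ : ExFormula}
    (hr : r ≤ n) (hm : m ≤ n) (hc : c ≤ n) (h0 : 0 < n) :
    Exec mulEnd (stage (encFormula φ₂ ++ (encFormula φ₁ ++ o)) i (ticks r ++ .close :: k) env m c)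
      (stage (encFormula (mulF r m c (wrap 1 m c φ₂) φ₁) ++ o) i k env r c)
      (stepCost.eval n) := by
  refine ((exec_moveField_of (l := ticks r) (r := k) (y := []) (by decide) rfl rfl
      (close_notMem_ticks r)).seq <|
    (exec_push_of (x := []) ?_).seq <|
    (exec_gen (n := n) (p := wrapG) rfl (o := encFormula φ₂ ++ (encFormula φ₁ ++ o))
    (o' := encFormula (wrap 1 m c φ₂) ++ (encFormula φ₁ ++ o)) ?_ ?_ ?_ ?_).seq <|
    (exec_gen (n := n) (p := mulOpG) rfl (o := encFormula (wrap 1 m c φ₂) ++ (encFormula φ₁ ++ o))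
    (o' := encFormula (mulF r m c (wrap 1 m c φ₂) φ₁) ++ o) ?_ ?_ ?_ ?_).seq <|
    (exec_clear_of (x := ticks 1) ?_).seq <|
    (exec_clear_of (x := ticks m) ?_).seq <|
    (exec_move_of (x := ticks r) (y := []) (by decide) ?_ ?_)).of_eq ?_ ?_
  rotate_right 1
  · rw [eval_stepCost]; simp; omega
  rotate_left 4
  · rw [← List.append_assoc, eval_wrapG (r := m) (c := c) (k := 1)]
    all_goals simp [Regs.update_store, Regs.set, Regs.store]
    rfl
  rotate_left 3
  · rw [← List.append_assoc, ← List.append_assoc, List.append_assoc (eval _ _),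
      eval_mulOpG (r := r) (m := m) (c := c)] <;>
      simp [Regs.update_store, Regs.set, Regs.store]
  all_goals simp [Regs.update_store, Regs.set, Regs.store, hr, hc, hm, Nat.succ_le_of_lt h0]
  all_goals rfl

/-- The part of the translation of a `let` between the two subexpressions. -/
def letMid : Prog :=
  block [wrapG.prog, moveField .kont .name, push .name (.bit false), pushEntry, push .kont .or,
    push .kont .var]

theorem exec_letMid {o i k : List OutTok} {env : Env} {M : Name} {r c n : ℕ} {φ : ExFormula}
    (hr : r ≤ n) (hc : c ≤ n) (hM : M.length < n) :
    Exec letMid (stage (encFormula φ ++ o) i ((bits M).reverse ++ .close :: k) env r c)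
      (stage (encFormula (wrap 0 r c φ) ++ o) i (.var :: .or :: k) ((varBlk M, r, c) :: env) 0 0)
      (stepCost.eval n) := by
  refine ((exec_gen (n := n) (p := wrapG) rfl (o := encFormula φ ++ o)
    (o' := encFormula (wrap 0 r c φ) ++ o) ?_ ?_ rfl ?_).seq <|
    (exec_moveField_of (l := (bits M).reverse) (r := k) (y := []) (by decide) ?_ ?_
      (by simpa using close_notMem_bits M)).seq <|
    ((exec_push_of (x := bits M) ?_).of_eq (s'' := Regs.store
      { out := encFormula (wrap 0 r c φ) ++ o, src := i, kont := k, env := encEnv env,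
        name := bits (varBlk M), row := ticks r, col := ticks c }) ?_ le_rfl).seq <|
    (exec_pushEntry _ env (varBlk M) r c (3 * n) rfl rfl rfl rfl rfl ?_).seq <|
    (exec_push_of (x := k) ?_).seq <|
    (exec_push_of (x := .or :: k) ?_)).of_eq ?_ ?_
  rotate_right 1
  · rw [eval_stepCost]; simp; omega
  rotate_left 2
  · rw [← List.append_assoc, eval_wrapG (r := r) (c := c) (k := 0) rfl rfl rfl]
  all_goals simp [Regs.update_store, Regs.set, Regs.store, hr, hc, varBlk]
  · rfl
  · omega
  · rfl

/-- The name and the dimensions of the bound variable are recovered from the top entry of the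
environment, which is removed in the same move; the first `case` drops its start symbol. -/
def letEnd : Prog :=
  block [case .env fun _ => skip, popEntry, letG.prog, clear .name, clear .row2, clear .col2]

theorem exec_letEnd {o i k : List OutTok} {env : Env} {w : Name} {r c r' c' n : ℕ}
    {φ₁ φ₂ : ExFormula} (hr : r ≤ n) (hc : c ≤ n) (hr' : r' ≤ n) (hc' : c' ≤ n)
    (hw : w.length ≤ n) :
    Exec letEnd (stage (encFormula φ₂ ++ (encFormula φ₁ ++ o)) i k ((w, r, c) :: env) r' c')
      (stage (encFormula (letF w r c φ₂ φ₁) ++ o) i k env r' c') (stepCost.eval n) := by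
  refine (((Exec.case_of (x := encEnv ((w, r, c) :: env)) rfl (exec_skip _)).of_eq
    (s'' := Regs.store
      { out := encFormula φ₂ ++ (encFormula φ₁ ++ o), src := i, kont := k,
        env := (encEnv ((w, r, c) :: env)).tail, row := ticks r', col := ticks c' })
      ?_ le_rfl).seq <|
    (exec_popEntry _ w r c (3 * n) (encEnv env) ?_ rfl rfl rfl rfl (by omega)).seq <|
    (exec_gen (n := n) (p := letG) rfl (o := encFormula φ₂ ++ (encFormula φ₁ ++ o))
    (o' := encFormula (letF w r c φ₂ φ₁) ++ o) ?_ ?_ ?_ ?_).seq <|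
    (exec_clear_of (x := bits w) ?_).seq <| (exec_clear_of (x := ticks r) ?_).seq <|
    (exec_clear_of (x := ticks c) ?_)).of_eq ?_ ?_
  rotate_right 1
  · rw [eval_stepCost]; simp; omega
  rotate_left 5
  · rw [← List.append_assoc, ← List.append_assoc, List.append_assoc (eval _ _),
      eval_letG (w := w) (r := r) (c := c)] <;> rfl
  all_goals simp [Regs.update_store, Regs.set, Regs.store, hr, hc, hr', hc', hw, encEnv_cons]

/-- The frame for an argument of a pointwise function, where `k` is the number of the argument and
`m` is the number of the arguments after it. -/
def argFrame (f : Name) (k m : ℕ) (l : List OutTok) : List OutTok :=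
  bits f ++ .close :: (ticks k ++ .close :: (ticks m ++ .close :: l))

/-- The arity is lowered by one to count the arguments after the first. The two adjacent `close`
symbols enclose the empty unary number 0 of the first argument, and the valid formula is the empty
conjunction to which the arguments' formulas are prefixed. -/
def applyStart : Prog :=
  block [moveField .src .name2, moveField .src .num, case .num fun _ => skip, verumG.prog,
    push .kont .close, move .num .kont, push .kont .close, push .kont .close, move .name2 .kont,
    push .kont .fn, push .kont .var]

theorem exec_applyStart {o i k : List OutTok} {env : Env} {f : Name} {m n : ℕ}
    (hm : m ≤ n) (hf : f.length ≤ n) :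
    Exec applyStart (stage o (bits f ++ .close :: (ticks (m + 1) ++ .close :: i)) k env 0 0)
      (stage (encFormula verum ++ o) i (.var :: .fn :: argFrame f 0 m k) env 0 0)
      (stepCost.eval n) := by
  refine ((exec_moveField_of (l := bits f) (r := ticks (m + 1) ++ .close :: i) (y := [])
      (by decide) rfl rfl (close_notMem_bits f)).seq <|
    (exec_moveField_of (l := ticks (m + 1)) (r := i) (y := []) (by decide) ?_ ?_
      (close_notMem_ticks _)).seq <|
    (Exec.case_of (x := ticks (m + 1)) ?_ (exec_skip _)).seq <|
    (exec_gen (n := n) (p := verumG) rfl (o := o) (o' := encFormula verum ++ o) ?_ ?_ ?_ ?_).seq <|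
    (exec_push_of (x := k) ?_).seq <|
    (exec_move_of (x := ticks m) (y := .close :: k) (by decide) ?_ ?_).seq <|
    (exec_push_of (x := ticks m ++ .close :: k) ?_).seq <|
    (exec_push_of (x := .close :: (ticks m ++ .close :: k)) ?_).seq <|
    (exec_move_of (x := (bits f).reverse) (y := .close :: .close :: (ticks m ++ .close :: k))
      (by decide) ?_ ?_).seq <|
    (exec_push_of (x := argFrame f 0 m k) ?_).seq <|
    (exec_push_of (x := .fn :: argFrame f 0 m k) ?_)).of_eq ?_ ?_
  rotate_right 1
  · rw [eval_stepCost]; simp; omega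
  rotate_left 6
  · rw [eval_verumG]
  all_goals simp [Regs.update_store, Regs.set, Regs.store, argFrame]
  all_goals rfl

/-- What follows the translation of an argument of a pointwise function. -/
def argEnd : Prog :=
  block [moveField .kont .name2, move .name2 .fn, moveField .kont .arg, moveField .kont .num,
    wrapG.prog, push .out .and,
    case .num fun
      | none => block [push .arg .tick, applyG.prog, clear .arg, clear .fn]
      | some _ => block [push .kont .close, move .num .kont, push .kont .close, push .arg .tick,
          move .arg .kont, push .kont .close, move .fn .name2, move .name2 .kont, push .kont .fn,
          clear .row, clear .col, push .kont .var]]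

/-- Further arguments remain: popping one tick of their number both tests this and lowers it, and
the frame is written back with the next argument number. -/
theorem exec_argEnd_step {o i k : List OutTok} {env : Env} {f : Name} {j m r c n : ℕ}
    {φ χ : ExFormula} (hr : r ≤ n) (hc : c ≤ n) (hj : j + m ≤ n) (hf : f.length ≤ n) :
    Exec argEnd (stage (encFormula φ ++ (encFormula χ ++ o)) i (argFrame f j (m + 1) k) env r c)
      (stage (encFormula (.and (wrap j r c φ) χ) ++ o) i (.var :: .fn :: argFrame f (j + 1) m k)
        env 0 0) (stepCost.eval n) := by
  refine ((exec_moveField_of (l := bits f) (r := ticks j ++ .close :: (ticks (m + 1) ++ .close ::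
    k))
      (y := []) (by decide) rfl rfl (close_notMem_bits f)).seq <|
    (exec_move_of (x := (bits f).reverse) (y := []) (by decide) ?_ ?_).seq <|
    (exec_moveField_of (l := ticks j) (r := ticks (m + 1) ++ .close :: k) (y := []) (by decide) ?_
      ?_
      (close_notMem_ticks _)).seq <|
    (exec_moveField_of (l := ticks (m + 1)) (r := k) (y := []) (by decide) ?_ ?_
      (close_notMem_ticks _)).seq <|
    (exec_gen (n := n) (p := wrapG) rfl (o := encFormula φ ++ (encFormula χ ++ o))
    (o' := encFormula (wrap j r c φ) ++ (encFormula χ ++ o)) ?_ ?_ ?_ ?_).seq <|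
    (exec_push_of (x := encFormula (wrap j r c φ) ++ (encFormula χ ++ o)) ?_).seq <|
    (Exec.case_of (x := ticks (m + 1)) ?_ (
    (exec_push_of (x := k) ?_).seq <|
    (exec_move_of (x := ticks m) (y := .close :: k) (by decide) ?_ ?_).seq <|
    (exec_push_of (x := ticks m ++ .close :: k) ?_).seq <|
    (exec_push_of (x := ticks j) ?_).seq <|
    (exec_move_of (x := ticks (j + 1)) (y := .close :: (ticks m ++ .close :: k))
      (by decide) ?_ ?_).seq <|
    (exec_push_of (x := ticks (j + 1) ++ .close :: (ticks m ++ .close :: k)) ?_).seq <|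
    (exec_move_of (x := bits f) (y := []) (by decide) ?_ ?_).seq <|
    (exec_move_of (x := (bits f).reverse)
      (y := .close :: (ticks (j + 1) ++ .close :: (ticks m ++ .close :: k)))
      (by decide) ?_ ?_).seq <|
    (exec_push_of (x := argFrame f (j + 1) m k) ?_).seq <|
    (exec_clear_of (x := ticks r) ?_).seq <| (exec_clear_of (x := ticks c) ?_).seq <|
    (exec_push_of (x := .fn :: argFrame f (j + 1) m k) ?_)))).of_eq ?_ ?_
  rotate_right 1
  · rw [eval_stepCost]; simp; omega
  rotate_left 9
  · rw [← List.append_assoc, eval_wrapG (r := r) (c := c) (k := j)] <;>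
      simp [Regs.update_store, Regs.set, Regs.store]
  all_goals simp [Regs.update_store, Regs.set, Regs.store, argFrame, hr, hc, hf, encFormula]
  all_goals first | rfl | omega

/-- At the last argument, one tick more than its number is the arity, and `row` and `col` still hold
the dimensions common to all arguments. -/
theorem exec_argEnd_last {o i k : List OutTok} {env : Env} {f : Name} {j r c n : ℕ}
    {φ χ : ExFormula} (hr : r ≤ n) (hc : c ≤ n) (hj : j < n) (hf : f.length ≤ n) :
    Exec argEnd (stage (encFormula φ ++ (encFormula χ ++ o)) i (argFrame f j 0 k) env r c)
      (stage (encFormula (applyF f (j + 1) r c (.and (wrap j r c φ) χ)) ++ o) i k env r c)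
      (stepCost.eval n) := by
  refine ((exec_moveField_of (l := bits f) (r := ticks j ++ .close :: (ticks 0 ++ .close :: k))
      (y := []) (by decide) rfl rfl (close_notMem_bits f)).seq <|
    (exec_move_of (x := (bits f).reverse) (y := []) (by decide) ?_ ?_).seq <|
    (exec_moveField_of (l := ticks j) (r := ticks 0 ++ .close :: k) (y := []) (by decide) ?_ ?_
      (close_notMem_ticks _)).seq <|
    (exec_moveField_of (l := ticks 0) (r := k) (y := []) (by decide) ?_ ?_
      (close_notMem_ticks _)).seq <|
    (exec_gen (n := n) (p := wrapG) rfl (o := encFormula φ ++ (encFormula χ ++ o))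
    (o' := encFormula (wrap j r c φ) ++ (encFormula χ ++ o)) ?_ ?_ ?_ ?_).seq <|
    (exec_push_of (x := encFormula (wrap j r c φ) ++ (encFormula χ ++ o)) ?_).seq <|
    (Exec.case_of (x := ticks 0) ?_ (
    (exec_push_of (x := ticks j) ?_).seq <|
    (exec_gen (n := n) (p := applyG) rfl (o := encFormula (.and (wrap j r c φ) χ) ++ o)
    (o' := encFormula (applyF f (j + 1) r c (.and (wrap j r c φ) χ)) ++ o) ?_ ?_ ?_ ?_).seq <|
    (exec_clear_of (x := ticks (j + 1)) ?_).seq <| (exec_clear_of (x := bits f) ?_)))).of_eq ?_ ?_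
  rotate_right 1
  · rw [eval_stepCost]; simp; omega
  rotate_left 9
  · rw [← List.append_assoc, eval_wrapG (r := r) (c := c) (k := j)] <;>
      simp [Regs.update_store, Regs.set, Regs.store]
  rotate_left 6
  · rw [← List.append_assoc, eval_applyG (r := r) (c := c) (f := f) (n := j + 1)]
    all_goals simp [Regs.update_store, Regs.set, Regs.store]
    rfl
  all_goals simp [Regs.update_store, Regs.set, Regs.store, argFrame, hr, hc, hf, encFormula, hj.le]
  all_goals first | rfl | omega

end Prog

/-- The work symbols for the input symbols. -/
def conv : InTok → OutTok
  | .bit b => .bit b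
  | .tick => .tick
  | .close => .close
  | .item => .and
  | .one => .int
  | .sym => .x
  | .var => .var
  | .letIn => .ex
  | .transp => .re
  | .ones => .im
  | .diag => .y
  | .mul => .mul
  | .apply => .fn
  | .eigen => .z

/-! ### The loop over pending tasks -/

namespace Prog

open Gen

@[simp] theorem map_conv_encName (w : Name) : (encName w).map conv = bits w ++ [.close] := by
  simp [encName, conv, bits]

@[simp] theorem map_conv_encNat (n : ℕ) : (encNat n).map conv = ticks n ++ [.close] := by
  simp [encNat, conv, ticks]

@[simp] theorem length_encName (w : Name) : (encName w).length = w.length + 1 := by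
  simp [encName]

@[simp] theorem length_encNat (n : ℕ) : (encNat n).length = n + 1 := by
  simp [encNat]

/-- Start the translation of the expression on `src`. -/
def startExpr : Prog := case .src fun
  | none => skip
  | some .var => evalVar
  | some .ex => block [push .kont .close, moveField .src .kont, push .kont .ex, push .kont .var]
  | some .fn => applyStart
  -- For the remaining operators the symbol itself is the task that goes on after the first operand,
  -- below a task `var` for that operand.
  | some t => block [push .kont t, push .kont .var]

/-- Perform a task. -/
def dispatch : Option OutTok → Prog
  | some .var => startExpr
  | some .re => transpEnd
  | some .im => onesEnd
  | some .y => diagEnd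
  | some .z => eigenEnd
  | some .mul => mulMid
  | some .add => mulEnd
  | some .ex => letMid
  | some .or => letEnd
  | some .fn => argEnd
  | _ => skip

/-- Perform all tasks on the stack `kont`. -/
def mainLoop : Prog := loop .kont Option.isSome dispatch

theorem reach_task {o i k : List OutTok} {t : OutTok} {env : Env} {r c T : ℕ} {s : Store}
    {l : List Prog} (h : Exec (dispatch (some t)) (stage o i k env r c) s T) :
    Reach (mainLoop :: l, stage o i (t :: k) env r c) (mainLoop :: l, s) (T + 1) := by
  refine reach_loop_step rfl ?_
  rw [Regs.update_store]
  exact h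

theorem reach_startExpr {o i k : List OutTok} {t : OutTok} {env : Env} {T : ℕ} {s : Store}
    {l : List Prog} (h : Exec (match some t with
      | none => skip
      | some .var => evalVar
      | some .ex => block [push .kont .close, moveField .src .kont, push .kont .ex, push .kont .var]
      | some .fn => applyStart
      | some t => block [push .kont t, push .kont .var]) (stage o i k env 0 0) s T) :
    Reach (mainLoop :: l, stage o (t :: i) (.var :: k) env 0 0) (mainLoop :: l, s) (T + 2) := by
  refine reach_task (Exec.case ?_)
  rw [Regs.update_store]
  exact h

theorem exec_startUnary {o i k : List OutTok} {t : OutTok} {env : Env} :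
    Exec (block [push .kont t, push .kont .var]) (stage o i k env 0 0)
      (stage o i (.var :: t :: k) env 0 0) 3 := by
  refine ((exec_push_of (x := k) rfl).seq (exec_push_of (x := t :: k) ?_)).of_eq ?_ le_rfl
  all_goals simp [Regs.update_store, Regs.set]

theorem exec_startLet {o i k : List OutTok} {env : Env} {M : Name} :
    Exec (block [push .kont .close, moveField .src .kont, push .kont .ex, push .kont .var])
      (stage o (bits M ++ .close :: i) k env 0 0)
      (stage o i (.var :: .ex :: ((bits M).reverse ++ .close :: k)) env 0 0)
      (2 * M.length + 7) := by
  refine ((exec_push_of (x := k) rfl).seq <|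
    (exec_moveField_of (l := bits M) (r := i) (y := .close :: k) (by decide) ?_ ?_
      (close_notMem_bits M)).seq <|
    (exec_push_of (x := (bits M).reverse ++ .close :: k) ?_).seq
    (exec_push_of (x := .ex :: ((bits M).reverse ++ .close :: k)) ?_)).of_eq ?_ ?_
  rotate_right 1
  · simp; omega
  all_goals simp [Regs.update_store, Regs.set, Regs.store]

theorem lookup_mem {env : Env} {w : Name} {p : ℕ × ℕ} (h : env.lookup w = some p) :
    (w, p) ∈ env := by
  induction env with
  | nil => simp at h
  | cons q env ih =>
    obtain ⟨w', p'⟩ := q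
    rw [List.lookup_cons] at h
    by_cases hw : w = w'
    · subst hw; simp at h; simp [h]
    · have : (w == w') = false := by simpa using hw
      simp only [this] at h
      exact List.mem_cons_of_mem _ (ih h)

/-- No operation creates a dimension that is not already in the environment, except for the single
column of `ones`. -/
theorem dims_le {env : Env} {d : ℕ} (e : Expr) (h : ∀ q ∈ env, q.2.1 ≤ d ∧ q.2.2 ≤ d)
    (hd : 1 ≤ d) : (dims env e).1 ≤ d ∧ (dims env e).2 ≤ d := by
  induction e generalizing env with
  | var M =>
    rw [dims]
    cases hM : env.lookup (varBlk M) with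
    | none => simp
    | some p => exact h _ (lookup_mem hM)
  | letIn M e₁ e₂ ih₁ ih₂ =>
    rw [dims]
    refine ih₂ ?_
    simp only [List.mem_cons, forall_eq_or_imp]
    exact ⟨ih₁ h, h⟩
  | transp e ih => exact (ih h).symm
  | ones e ih => exact ⟨(ih h).1, hd⟩
  | diag e ih => exact ⟨(ih h).1, (ih h).1⟩
  | mul e₁ e₂ ih₁ ih₂ => exact ⟨(ih₁ h).1, (ih₂ h).2⟩
  | apply f n args ih =>
    rw [dims]
    split_ifs
    · exact ih _ h
    · simp
  | eigen e ih => exact ih h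

theorem accum_congr {X Y : ℕ → ExFormula} {n : ℕ} (h : ∀ k < n, X k = Y k) :
    accum X n = accum Y n := by
  induction n with
  | zero => rfl
  | succ n ih =>
    rw [accum, accum, h n (by omega), ih fun k hk => h k (by omega)]

/-- Induction on the number m of arguments after the current one j. The conjunction grows at its
front, which explains why `accum` puts the last argument first. -/
theorem reach_args {k : List OutTok} {env : Env} {f : Name} {r c n N B : ℕ} {l : List Prog}
    {φ : ℕ → ExFormula} {a : ℕ → List InTok} (hr : r ≤ n) (hc : c ≤ n) (hN : N ≤ n)
    (hf : f.length ≤ n)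
    (h : ∀ j < N, ∀ o i k, Reach (mainLoop :: l, stage o ((a j).map conv ++ i) (.var :: k) env 0 0)
      (mainLoop :: l, stage (encFormula (φ j) ++ o) i k env r c) ((a j).length * B))
    (o i : List OutTok) (m j : ℕ) (hj : j + m + 1 = N) :
    Reach (mainLoop :: l, stage (encFormula (accum (fun j => wrap j r c (φ j)) j) ++ o)
        (((List.range' j (m + 1)).flatMap a).map conv ++ i) (.var :: .fn :: argFrame f j m k) env
        0 0)
      (mainLoop :: l,
        stage (encFormula (applyF f N r c (accum (fun j => wrap j r c (φ j)) N)) ++ o) i k env r c)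
      (((List.range' j (m + 1)).flatMap a).length * B + (m + 1) * (stepCost.eval n + 1)) := by
  induction m generalizing j with
  | zero =>
    obtain rfl : N = j + 1 := by omega
    have h1 := h j (by omega) (encFormula (accum (fun j => wrap j r c (φ j)) j) ++ o) i
      (.fn :: argFrame f j 0 k)
    have h2 := h1.trans (reach_task (exec_argEnd_last (f := f) hr hc hN hf))
    simp only [Nat.zero_add, List.range'_one, List.flatMap_cons, List.flatMap_nil, List.append_nil]
    exact h2.mono (by omega)
  | succ m ih =>
    have h1 := h j (by omega) (encFormula (accum (fun j => wrap j r c (φ j)) j) ++ o)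
      (((List.range' (j + 1) (m + 1)).flatMap a).map conv ++ i) (.fn :: argFrame f j (m + 1) k)
    have h2 := (h1.trans (reach_task (exec_argEnd_step (f := f) hr hc (by omega) hf))).trans
      (ih (j + 1) (by omega))
    rw [List.range'_succ, List.flatMap_cons, List.map_append, List.append_assoc, List.length_append]
    refine h2.mono ?_
    simp only [Nat.add_mul]
    omega

/-- Time: every operator causes at most three tasks, except `apply`, whose tasks are paid for by its
unary arity; hence the factor 3 per symbol. Space: the environment grows only at a `let`, by at most
the length of the name plus 2d + 5, and this is charged to the symbols of the `let` at a rate of 2d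
+ 5 each. So one number n bounds all registers throughout the recursion. -/
theorem reach_translation {S : Name → Option Ty} {e : Expr} {τ : Ty} (h : HasType S e τ)
    {σ : Name → ℕ} {env : Env} (hE : env.Fits S σ) {d n : ℕ} (hd : 1 ≤ d)
    (hdE : ∀ q ∈ env, q.2.1 ≤ d ∧ q.2.2 ≤ d)
    (hn : (encEnv env).length + (2 * d + 5) * (encExpr e).length ≤ n) (l : List Prog)
    (o i k : List OutTok) :
    Reach (mainLoop :: l, stage o ((encExpr e).map conv ++ i) (.var :: k) env 0 0)
      (mainLoop :: l,
        stage (encFormula (trans env e) ++ o) i k env (dims env e).1 (dims env e).2)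
      ((encExpr e).length * (3 * (stepCost.eval n + 2))) := by
  have hP : 2 * n + 10 ≤ stepCost.eval n := by rw [eval_stepCost]; omega
  generalize hB : 3 * (stepCost.eval n + 2) = B
  induction h generalizing env o i k with
  | @var S M τ hM =>
    have h1 := hE M
    rw [hM, Option.map_some] at h1
    simp only [encExpr, List.length_cons, length_encName] at hn
    have h2 : (2 * d + 5) * (M.length + 1 + 1) = 2 * (d * (M.length + 2)) + 5 * (M.length + 2) := by
      ring
    have h3 : d ≤ d * (M.length + 2) := Nat.le_mul_of_pos_right _ (by omega)
    have h4 := dims_le (.var M) hdE hd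
    rw [dims, h1, Option.getD_some] at h4
    have h5 := reach_startExpr (l := l) (t := .var) (exec_evalVar (o := o) (i := i) (k := k) (n :=
      n) h1
      (by omega) (by omega) (h4.1.trans (by omega)) (h4.2.trans (by omega)))
    rw [encExpr, trans, dims, h1, Option.getD_some, List.map_cons, map_conv_encName]
    simp only [List.cons_append, List.append_assoc, List.nil_append, List.length_cons,
      Nat.add_mul]
    refine h5.mono ?_
    omega
  | @letIn S M e₁ e₂ τ₁ τ₂ h₁ h₂ ih₁ ih₂ =>
    simp only [encExpr, List.length_cons, List.length_append, length_encName, Nat.mul_add] at hn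
    have h3 : M.length ≤ (2 * d + 5) * M.length := Nat.le_mul_of_pos_left _ (by omega)
    have h4 := dims_le e₁ hdE hd
    have h8 : Env.Fits ((varBlk M, dims env e₁) :: env) (Function.update S M (some τ₁)) σ := by
      rw [dims_eq h₁ hE]
      exact hE.update M τ₁
    have h9 : ∀ q ∈ (varBlk M, dims env e₁) :: env, q.2.1 ≤ d ∧ q.2.2 ≤ d := by
      simp only [List.mem_cons, forall_eq_or_imp]
      exact ⟨h4, hdE⟩
    have h4' := dims_le e₂ h9 hd
    have h5 := reach_startExpr (l := l) (t := .ex) (exec_startLet (o := o) (M := M)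
      (i := (encExpr e₁).map conv ++ ((encExpr e₂).map conv ++ i)) (k := k) (env := env))
    have h6 := (h5.trans (ih₁ hE hdE (by omega) _ _ _)).trans
      (reach_task (exec_letMid (n := n) (M := M) (h4.1.trans (by omega)) (h4.2.trans (by omega))
        (by omega)))
    -- The new entry consists of the name with one more bit, both dimensions and four separators;
    -- the symbols of the `let` outside e₂ pay for it.
    have h7 := (h6.trans (ih₂ h8 h9 (by
      rw [encEnv_cons]
      simp only [List.length_cons, List.length_append, length_bits, length_ticks, varBlk]
      omega) _ _ _)).trans
      (reach_task (exec_letEnd (n := n) (h4.1.trans (by omega)) (h4.2.trans (by omega))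
        (h4'.1.trans (by omega)) (h4'.2.trans (by omega))
        (by rw [varBlk, List.length_cons]; omega)))
    rw [encExpr, List.map_cons, List.map_append, List.map_append, map_conv_encName,
      List.cons_append, List.append_assoc, List.append_assoc, List.append_assoc, List.append_assoc]
    refine h7.mono ?_
    simp only [List.length_cons, List.length_append, length_encName, Nat.add_mul]
    omega
  | @transp S e s₁ s₂ h ih =>
    simp only [encExpr, List.length_cons, Nat.mul_add] at hn
    have h4 := dims_le e hdE hd
    have h5 := reach_startExpr (l := l) (t := .re) (exec_startUnary (o := o)
      (i := (encExpr e).map conv ++ i) (k := k) (env := env))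
    have h6 := (h5.trans (ih hE hdE (by omega) _ _ _)).trans
      (reach_task (exec_transpEnd (n := n) (h4.1.trans (by omega)) (h4.2.trans (by omega))))
    refine h6.mono ?_
    simp only [encExpr, List.length_cons, Nat.add_mul]
    omega
  | @ones S e s₁ s₂ h ih =>
    simp only [encExpr, List.length_cons, Nat.mul_add] at hn
    have h4 := dims_le e hdE hd
    have h5 := reach_startExpr (l := l) (t := .im) (exec_startUnary (o := o)
      (i := (encExpr e).map conv ++ i) (k := k) (env := env))
    have h6 := (h5.trans (ih hE hdE (by omega) _ _ _)).trans
      (reach_task (exec_onesEnd (n := n) (h4.1.trans (by omega)) (h4.2.trans (by omega))))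
    refine h6.mono ?_
    simp only [encExpr, List.length_cons, Nat.add_mul]
    omega
  | @diag S e s h ih =>
    simp only [encExpr, List.length_cons, Nat.mul_add] at hn
    have h4 := dims_le e hdE hd
    have h5 := reach_startExpr (l := l) (t := .y) (exec_startUnary (o := o)
      (i := (encExpr e).map conv ++ i) (k := k) (env := env))
    have h6 := (h5.trans (ih hE hdE (by omega) _ _ _)).trans
      (reach_task (exec_diagEnd (n := n) (h4.1.trans (by omega)) (h4.2.trans (by omega))))
    refine h6.mono ?_
    simp only [encExpr, List.length_cons, Nat.add_mul]
    omega
  | @mul S e₁ e₂ s₁ s₂ s₃ h₁ h₂ ih₁ ih₂ =>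
    simp only [encExpr, List.length_cons, List.length_append, Nat.mul_add] at hn
    have h4 := dims_le e₁ hdE hd
    have h4' := dims_le e₂ hdE hd
    have h5 := reach_startExpr (l := l) (t := .mul) (exec_startUnary (o := o)
      (i := (encExpr e₁).map conv ++ ((encExpr e₂).map conv ++ i)) (k := k) (env := env))
    have h6 := (h5.trans (ih₁ hE hdE (by omega) _ _ _)).trans
      (reach_task (exec_mulMid (n := n) (h4.1.trans (by omega)) (h4.2.trans (by omega))))
    have h7 := (h6.trans (ih₂ hE hdE (by omega) _ _ _)).trans
      (reach_task (exec_mulEnd (n := n) (h4.1.trans (by omega)) (h4'.1.trans (by omega))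
        (h4'.2.trans (by omega)) (by omega)))
    rw [encExpr, List.map_cons, List.map_append, List.cons_append, List.append_assoc]
    refine h7.mono ?_
    simp only [List.length_cons, List.length_append, Nat.add_mul]
    omega
  | @apply S f N args τ hN h ih =>
    obtain ⟨m, rfl⟩ : ∃ m, N = m + 1 := ⟨N - 1, by omega⟩
    let a : ℕ → List InTok := fun j => if h : j < m + 1 then encExpr (args ⟨j, h⟩) else []
    let φ : ℕ → ExFormula := fun j => if h : j < m + 1 then trans env (args ⟨j, h⟩) else verum
    have haj (j : ℕ) (h : j < m + 1) : a j = encExpr (args ⟨j, h⟩) := dif_pos h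
    have hφj (j : ℕ) (h : j < m + 1) : φ j = trans env (args ⟨j, h⟩) := dif_pos h
    have ha : (List.ofFn fun j => encExpr (args j)).flatten = (List.range' 0 (m + 1)).flatMap a :=
      by
      rw [List.flatMap_def]
      congr 1
      refine List.ext_getElem (by simp) fun j h1 h2 => ?_
      rw [List.length_ofFn] at h1
      rw [List.getElem_ofFn, List.getElem_map, List.getElem_range', ← haj j h1]
      simp
    have ha' (j : Fin (m + 1)) : (encExpr (args j)).length ≤
        ((List.range' 0 (m + 1)).flatMap a).length := by
      rw [← ha]
      have : encExpr (args j) ∈ List.ofFn fun j => encExpr (args j) := List.mem_ofFn.2 ⟨j, rfl⟩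
      exact (List.sublist_flatten_of_mem this).length_le
    simp only [encExpr, List.length_cons, List.length_append, length_encName, length_encNat, ha]
      at hn ⊢
    generalize hL : ((List.range' 0 (m + 1)).flatMap a).length = L at *
    have h3 := Nat.le_mul_of_pos_left (f.length + 1 + (m + 1 + 1) + L + 1)
      (show 0 < 2 * d + 5 by omega)
    have hdims := dims_eq (.apply (f := f) hN h) hE
    have hargs (j : Fin (m + 1)) := dims_eq (h j) hE
    have h4 := dims_le (.apply f (m + 1) args) hdE hd
    rw [hdims] at h4
    have h9 : 2 * d + 5 ≤ (2 * d + 5) * (f.length + 1 + (m + 1 + 1) + L + 1) :=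
      Nat.le_mul_of_pos_right _ (by omega)
    have h5 := reach_startExpr (l := l) (t := .fn) (exec_applyStart (o := o) (m := m) (f := f)
      (i := ((List.range' 0 (m + 1)).flatMap a).map conv ++ i) (k := k) (env := env) (n := n)
      (by omega) (by omega))
    have h6 := h5.trans (reach_args (k := k) (l := l) (r := τ.1.value σ) (c := τ.2.value σ) (φ := φ)
      (a := a) (f := f) (N := m + 1) (n := n) (B := B) (h4.1.trans (by omega))
      (h4.2.trans (by omega)) (by omega) (by omega) (fun j hj o i k => by
        have h10 := ih ⟨j, hj⟩ hE hdE (by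
          have := Nat.mul_le_mul_left (2 * d + 5) ((ha' ⟨j, hj⟩).trans
            (show L ≤ f.length + 1 + (m + 1 + 1) + L + 1 by omega))
          omega) o i k
        rw [hargs, ← haj j hj, ← hφj j hj] at h10
        exact h10) o i m 0 (by omega))
    rw [List.map_cons, List.map_append, List.map_append, map_conv_encName, map_conv_encNat,
      List.cons_append, List.append_assoc, List.append_assoc, List.append_assoc, List.append_assoc,
      trans, hdims, accum_congr (Y := fun j => wrap j (τ.1.value σ) (τ.2.value σ) (φ j))
        fun j hj => by rw [dif_pos hj, hφj j hj, hargs]]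
    refine h6.mono ?_
    rw [hL]
    -- The m + 1 ticks of the arity pay for the m + 1 tasks that end an argument.
    have h11 : (m + 1) * (stepCost.eval n + 1) ≤ (m + 1) * B := Nat.mul_le_mul_left _ (by omega)
    simp only [Nat.add_mul] at h11 ⊢
    omega
  | @eigen S e s h ih =>
    simp only [encExpr, List.length_cons, Nat.mul_add] at hn
    have h4 := dims_le e hdE hd
    have h5 := reach_startExpr (l := l) (t := .z) (exec_startUnary (o := o)
      (i := (encExpr e).map conv ++ i) (k := k) (env := env))
    have h6 := (h5.trans (ih hE hdE (by omega) _ _ _)).trans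
      (reach_task (exec_eigenEnd (n := n) (h4.1.trans (by omega)) (h4.2.trans (by omega))))
    refine h6.mono ?_
    simp only [encExpr, List.length_cons, Nat.add_mul]
    omega

end Prog

namespace Prog

open Gen

/-! ### Reading the schema and the sizes -/

theorem Exec.congr_left {p : Prog} {s s' s₀ : Store} {T : ℕ} (h : Exec p s s' T) (hs : s₀ = s) :
    Exec p s₀ s' T := hs ▸ h

/-- A size term on a stack. -/
def termSyms (t : SizeTerm) : List OutTok := (encSizeTerm t).map conv

/-- An entry of a schema on a stack. -/
def schemaSyms (q : Name × Ty) : List OutTok :=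
  .and :: (bits q.1 ++ .close :: (termSyms q.2.1 ++ termSyms q.2.2))

/-- An entry of a size assignment on a stack. -/
def sizeSyms (q : Name × ℕ) : List OutTok :=
  .and :: (bits q.1 ++ .close :: (ticks q.2 ++ [.close]))

theorem map_conv_encSchema (l : List (Name × Ty)) :
    (encSchema l).map conv = l.flatMap schemaSyms ++ [.close] := by
  induction l with
  | nil => rfl
  | cons q l ih => simp [encSchema, ih, schemaSyms, termSyms, encTy, conv]

theorem map_conv_encSizes (l : List (Name × ℕ)) :
    (encSizes l).map conv = l.flatMap sizeSyms ++ [.close] := by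
  induction l with
  | nil => rfl
  | cons q l ih => simp [encSizes, ih, sizeSyms, conv]

/-- Move a size term to `spare`. -/
def copyTerm : Prog := case .src fun
  | some .x => block [push .spare .x, moveField .src .spare, push .spare .close]
  | _ => push .spare .int

theorem exec_copyTerm (t : SizeTerm) (i y : List OutTok) :
    Exec copyTerm (Regs.store { src := termSyms t ++ i, spare := y })
      (Regs.store { src := i, spare := (termSyms t).reverse ++ y })
      (2 * (termSyms t).length + 6) := by
  cases t with
  | one =>
    refine (Exec.case_of (x := .int :: i) rfl (exec_push_of (x := y) ?_)).of_eq ?_ (by omega)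
    all_goals simp [Regs.update_store, Regs.set, Regs.store, termSyms, encSizeTerm, conv]
  | sym α =>
    refine (Exec.case_of (x := .x :: (bits α ++ .close :: i)) ?_
      ((exec_push_of (x := y) ?_).seq <| (exec_moveField_of (l := bits α) (r := i) (y := .x :: y)
        (by decide) ?_ ?_ (close_notMem_bits α)).seq
        (exec_push_of (x := (bits α).reverse ++ .x :: y) ?_))).of_eq ?_ ?_
    rotate_right 1
    · simp [termSyms, encSizeTerm]; omega
    all_goals simp [Regs.update_store, Regs.set, Regs.store, termSyms, encSizeTerm, conv]

/-- Move the schema from `src` to `spare`. -/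
def copySchema : Prog := seq (loop .src (· == some .and) fun _ =>
    block [push .spare .and, moveField .src .spare, push .spare .close, copyTerm, copyTerm])
  (push .spare .close)

/-- The schema precedes the sizes in the input but can only be evaluated when they are known, so it
is set aside first. -/
theorem exec_copySchema (l : List (Name × Ty)) (i y : List OutTok) :
    Exec copySchema (Regs.store { src := l.flatMap schemaSyms ++ .close :: i, spare := y })
      (Regs.store { src := i, spare := .close :: ((l.flatMap schemaSyms).reverse ++ y) })
      (30 * (l.flatMap schemaSyms).length + 3) := by
  refine (Exec.seq (T := 30 * (l.flatMap schemaSyms).length + 1)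
    (s' := Regs.store { src := i, spare := (l.flatMap schemaSyms).reverse ++ y }) ?_
    (exec_push_of rfl)).of_eq ?_ (by omega)
  · induction l generalizing y with
    | nil =>
      refine (Exec.loop_stop (by simp [Regs.store])).of_eq ?_ (by simp)
      simp [Regs.update_store, Regs.set, Regs.store]
    | cons q l ih =>
      refine (Exec.loop_step (by simp [Regs.store, schemaSyms]) (
        (exec_push_of (x := y) ?_).seq <|
        (exec_moveField_of (l := bits q.1) (r := termSyms q.2.1 ++ (termSyms q.2.2 ++
          (l.flatMap schemaSyms ++ .close :: i))) (y := .and :: y) (by decide) ?_ ?_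
          (close_notMem_bits _)).seq <|
        ((exec_push_of (x := (bits q.1).reverse ++ .and :: y) ?_).of_eq ?_ le_rfl).seq <|
        (exec_copyTerm q.2.1 _ (.close :: ((bits q.1).reverse ++ .and :: y))).seq
        (exec_copyTerm q.2.2 _ _))
        (ih _)).of_eq ?_ ?_
      rotate_right 1
      · simp [schemaSyms]; omega
      all_goals simp [Regs.update_store, Regs.set, Regs.store, schemaSyms]
  · simp [Regs.update_store, Regs.set, Regs.store]

/-- Move the sizes from `src` to the environment. -/
def readSizes : Prog := loop .src (· == some .and) fun _ =>
  block [moveField .src .name2, move .name2 .name, push .name (.bit true), moveField .src .row,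
    pushEntry]

/-- The entry of the environment for an entry of a size assignment. -/
def sizeEntry (q : Name × ℕ) : Name × ℕ × ℕ := (true :: q.1, q.2, 0)

/-- Sizes are kept in the environment as well, under names marked by the bit `true` and with 0
columns, so that one search routine serves both purposes. The second part continues the accounting
of the environment's length at 2d + 5 per input symbol. -/
theorem exec_readSizes {d n : ℕ} (l : List (Name × ℕ)) (i m : List OutTok) (env : Env)
    (hn : (encEnv env).length + (2 * d + 5) * (l.flatMap sizeSyms).length ≤ n) :
    Exec readSizes (Regs.store
      { src := l.flatMap sizeSyms ++ .close :: i, mid := m, env := encEnv env })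
      (Regs.store
        { src := i, mid := m
          env := encEnv ((l.map sizeEntry).reverse ++ env) })
      (l.length * (10 * n + 40) + 1) ∧
      (encEnv ((l.map sizeEntry).reverse ++ env)).length ≤
        (encEnv env).length + (2 * d + 5) * (l.flatMap sizeSyms).length := by
  induction l generalizing env with
  | nil =>
    refine ⟨(Exec.loop_stop (by simp [Regs.store])).of_eq ?_ (by simp), by simp⟩
    simp [Regs.update_store, Regs.set, Regs.store]
  | cons q l ih =>
    obtain ⟨w, v⟩ := q
    have h1 : 5 * (w.length + v + 3) ≤ (2 * d + 5) * (w.length + v + 3) :=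
      Nat.mul_le_mul_right _ (by omega)
    have h2 : ((((w, v) :: l).flatMap sizeSyms)).length =
        (w.length + v + 3) + (l.flatMap sizeSyms).length := by
      simp [sizeSyms]; omega
    have h3 : (encEnv ((true :: w, v, 0) :: env)).length = (encEnv env).length + w.length + v + 5 :=
      by simp [encEnv_cons]; omega
    rw [h2, Nat.mul_add (2 * d + 5)] at hn ⊢
    have h4 := ih ((true :: w, v, 0) :: env) (by omega)
    refine ⟨(Exec.loop_step (by simp [Regs.store, sizeSyms]) (
        (exec_moveField_of (l := bits w) (r := ticks v ++ .close :: (l.flatMap sizeSyms ++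
          .close :: i)) (y := []) (by decide) ?_ ?_ (close_notMem_bits _)).seq <|
        (exec_move_of (x := (bits w).reverse) (y := []) (by decide) ?_ ?_).seq <|
        (exec_push_of (x := bits w) ?_).seq <|
        ((exec_moveField_of (l := ticks v) (r := l.flatMap sizeSyms ++ .close :: i) (y := [])
          (by decide) ?_ ?_ (close_notMem_ticks _)).of_eq (s'' := Regs.store
          { src := l.flatMap sizeSyms ++ .close :: i, mid := m, env := encEnv env,
            name := bits (true :: w), row := ticks v }) ?_ le_rfl).seq <|
        (exec_pushEntry _ env (true :: w) v 0 n rfl rfl rfl rfl rfl ?_))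
        h4.1).of_eq ?_ ?_, ?_⟩
    rotate_right 2
    · simp only [List.length_cons, List.length_reverse, length_bits, length_ticks, Nat.add_mul]
      omega
    · have := h4.2
      simp only [List.map_cons, List.reverse_cons, List.append_assoc, List.cons_append,
        List.nil_append]
      change (encEnv (_ ++ (true :: w, v, 0) :: env)).length ≤ _
      omega
    rotate_right 2
    · simp only [List.length_cons]; omega
    · simp [sizeEntry]
    all_goals simp [Regs.update_store, Regs.set, Regs.store, sizeSyms]
    rfl

/-- Read a size term from `mid`, and put its value on `b`. -/
def readTerm (b : Stk) : Prog := case .mid fun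
  | some .x => block [moveField .mid .name2, move .name2 .name, push .name (.bit true), lookup,
      clear .name, move .row b]
  | _ => push b .tick

theorem exec_readTerm {b : Stk} (hb : b = .row2 ∨ b = .col2) {t : SizeTerm} {σ : Name → ℕ} {n : ℕ}
    {env : Env} {x : List OutTok} (R : Regs) (h1 : R.mid = termSyms t ++ x)
    (h2 : R.env = encEnv env) (h3 : R.name = []) (h4 : R.name2 = []) (h5 : R.row = [])
    (h6 : R.col = []) (h7 : R.flag = []) (h8 : R.back = []) (h9 : R.store b = [])
    (ht : ∀ α, t = .sym α → env.lookup (true :: α) = some (σ α, 0))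
    (hn : (encEnv env).length ≤ n) (hn' : (termSyms t).length ≤ n) (hn'' : t.value σ ≤ n) :
    Exec (readTerm b) R.store (({ R with mid := x }).set b (ticks (t.value σ))).store
      (n * (30 * n + 61) + 20 * n + 20) := by
  obtain ⟨⟩ := R
  simp only at h1 h2 h3 h4 h5 h6 h7 h8
  subst h1 h2 h3 h4 h5 h6 h7 h8
  cases t with
  | one =>
    refine (Exec.case_of (x := .int :: x) rfl (exec_push_of (x := []) ?_)).of_eq ?_ (by omega)
    all_goals obtain rfl | rfl := hb
    all_goals simp_all [Regs.update_store, Regs.set, Regs.store, SizeTerm.value]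
    all_goals rfl
  | sym α =>
    have h11 : α.length < n := by simp [termSyms, encSizeTerm] at hn'; omega
    rename_i o src spare kont tmp row2 col2 arg fn num ix jx kx
    refine (Exec.case_of (x := .x :: (bits α ++ .close :: x)) ?_ (
      (exec_moveField_of (l := bits α) (r := x) (y := []) (by decide) ?_ ?_
        (close_notMem_bits α)).seq <|
      (exec_move_of (x := (bits α).reverse) (y := []) (by decide) ?_ ?_).seq <|
      ((exec_push_of (x := bits α) ?_).of_eq (s'' := Regs.store
        { out := o, src := src, spare := spare, kont := kont, env := encEnv env, tmp := tmp,
          name := bits (true :: α), row2 := row2, col2 := col2, mid := x, arg := arg, fn := fn,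
          num := num, ix := ix, jx := jx, kx := kx }) ?_ le_rfl).seq <|
      (exec_lookup (true :: α) (σ α) 0 n env _ (ht α rfl) rfl rfl rfl rfl rfl rfl rfl hn h11).seq <|
      (exec_clear_of (x := bits (true :: α)) ?_).seq <|
      (exec_move_of (x := ticks (σ α)) (y := []) ?_ ?_ ?_))).of_eq ?_ ?_
    rotate_right 1
    · simp only [SizeTerm.value] at hn''
      simp; omega
    all_goals try obtain rfl | rfl := hb
    all_goals simp_all [Regs.update_store, Regs.set, Regs.store, SizeTerm.value, termSyms,
      encSizeTerm, conv]
    all_goals rfl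

/-- Add the next entry of the schema on `mid` to the environment. -/
def declare : Prog :=
  block [moveField .mid .name2, move .name2 .fn, readTerm .row2, readTerm .col2, move .fn .name2,
    move .name2 .name, move .row2 .row, move .col2 .col, inputG.prog, push .name (.bit false),
    pushEntry]

/-- The condition that the input block for a variable has the values of the `x`-variables. -/
def inputF (M : Name) (r c : ℕ) (φ : ExFormula) : ExFormula :=
  ands (grid r c fun i j => ceq (.entry (.z (varBlk M)) i j) (.entry (.x M) i j)) φ

/-- Evaluating a type may take two searches of the environment, one per size term, while `stepCost`
allows for one; hence the factor 2. -/
theorem exec_declare {q : Name × Ty} {σ : Name → ℕ} {n : ℕ} {env : Env} {o i x : List OutTok}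
    {φ : ExFormula}
    (ht : ∀ α, (q.2.1 = .sym α ∨ q.2.2 = .sym α) → env.lookup (true :: α) = some (σ α, 0))
    (hn : (encEnv env).length ≤ n) (hn' : (schemaSyms q).length ≤ n) (hr : q.2.1.value σ ≤ n)
    (hc : q.2.2.value σ ≤ n) :
    Exec declare (Regs.store
      { out := encFormula φ ++ o, src := i, env := encEnv env, mid := (schemaSyms q).tail ++ x })
      (Regs.store
        { out := encFormula (inputF q.1 (q.2.1.value σ) (q.2.2.value σ) φ) ++ o, src := i, mid := x
          env := encEnv ((varBlk q.1, q.2.1.value σ, q.2.2.value σ) :: env) })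
      (2 * stepCost.eval n) := by
  obtain ⟨M, t₁, t₂⟩ := q
  simp only at ht hr hc
  simp only [schemaSyms, List.length_cons, List.length_append, length_bits] at hn'
  generalize hr' : t₁.value σ = r at *
  generalize hc' : t₂.value σ = c at *
  have h1 := exec_readTerm (b := .row2) (t := t₁) (σ := σ) (.inl rfl)
    { out := encFormula φ ++ o, src := i, env := encEnv env, fn := bits M,
      mid := termSyms t₁ ++ (termSyms t₂ ++ x) } rfl rfl rfl rfl rfl rfl rfl rfl rfl
      (fun α h => ht α (.inl h)) hn (by omega) (by omega)
  have h2 := exec_readTerm (b := .col2) (t := t₂) (σ := σ) (.inr rfl)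
    { out := encFormula φ ++ o, src := i, env := encEnv env, fn := bits M,
      mid := termSyms t₂ ++ x, row2 := ticks r } rfl rfl rfl rfl rfl rfl rfl rfl rfl
      (fun α h => ht α (.inr h)) hn (by omega) (by omega)
  rw [hr'] at h1
  rw [hc'] at h2
  refine ((exec_moveField_of (l := bits M) (r := termSyms t₁ ++ (termSyms t₂ ++ x)) (y := [])
      (by decide) ?_ ?_ (close_notMem_bits M)).seq <|
    ((exec_move_of (x := (bits M).reverse) (y := []) (by decide) ?_ ?_).of_eq ?_ le_rfl).seq <|
    h1.seq <| h2.seq <|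
    (exec_move_of (x := bits M) (y := []) (by decide) ?_ ?_).seq <|
    (exec_move_of (x := (bits M).reverse) (y := []) (by decide) ?_ ?_).seq <|
    (exec_move_of (x := ticks r) (y := []) (by decide) ?_ ?_).seq <|
    (exec_move_of (x := ticks c) (y := []) (by decide) ?_ ?_).seq <|
    (exec_gen (n := n) (p := inputG) rfl (o := encFormula φ ++ o)
    (o' := encFormula (inputF M r c φ) ++ o) ?_ ?_ ?_ ?_).seq <|
    ((exec_push_of (x := bits M) ?_).of_eq (s'' := Regs.store
      { out := encFormula (inputF M r c φ) ++ o, src := i, env := encEnv env, mid := x,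
        name := bits (varBlk M), row := ticks r, col := ticks c }) ?_ le_rfl).seq <|
    (exec_pushEntry _ env (varBlk M) r c (3 * n) rfl rfl rfl rfl rfl ?_)).of_eq ?_ ?_
  rotate_right 3
  · rw [varBlk, List.length_cons]; omega
  rotate_left 1
  · rw [eval_stepCost]; simp; omega
  rotate_left 16
  · rw [← List.append_assoc, eval_inputG (r := r) (c := c) (M := M), inputF]
    all_goals simp [Regs.update_store, Regs.set, Regs.store]
  all_goals simp [Regs.update_store, Regs.set, Regs.store, schemaSyms, hr, hc, varBlk,
    show M.length ≤ n by omega]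
  all_goals rfl

/-- Add the schema on `mid` to the environment. -/
def readSchema : Prog := loop .mid (· == some .and) fun _ => declare

/-- The conditions that the input blocks have the values of the `x`-variables. -/
def inputsF (σ : Name → ℕ) (l : List (Name × Ty)) (φ : ExFormula) : ExFormula :=
  l.foldl (fun φ q => inputF q.1 (q.2.1.value σ) (q.2.2.value σ) φ) φ

/-- The entry of the environment for an entry of a schema. -/
def schemaEntry (σ : Name → ℕ) (q : Name × Ty) : Name × ℕ × ℕ :=
  (varBlk q.1, q.2.1.value σ, q.2.2.value σ)

theorem exec_readSchema {σ : Name → ℕ} {d n : ℕ} (l : List (Name × Ty)) (i : List OutTok)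
    (env : Env) (φ : ExFormula)
    (ht : ∀ q ∈ l, ∀ α, (q.2.1 = .sym α ∨ q.2.2 = .sym α) →
      env.lookup (true :: α) = some (σ α, 0))
    (hd : ∀ q ∈ l, q.2.1.value σ ≤ d ∧ q.2.2.value σ ≤ d)
    (hn : (encEnv env).length + (2 * d + 5) * (l.flatMap schemaSyms).length ≤ n) :
    Exec readSchema (Regs.store
      { out := encFormula φ, src := i, mid := l.flatMap schemaSyms ++ [.close], env := encEnv env })
      (Regs.store
        { out := encFormula (inputsF σ l φ), src := i
          env := encEnv ((l.map (schemaEntry σ)).reverse ++ env) })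
      (l.length * (2 * stepCost.eval n + 2) + 1) ∧
      (encEnv ((l.map (schemaEntry σ)).reverse ++ env)).length ≤
        (encEnv env).length + (2 * d + 5) * (l.flatMap schemaSyms).length := by
  induction l generalizing env φ with
  | nil =>
    refine ⟨(Exec.loop_stop (by simp [Regs.store])).of_eq ?_ (by simp), by simp⟩
    simp [Regs.update_store, Regs.set, Regs.store, inputsF]
  | cons q l ih =>
    have hq := hd q List.mem_cons_self
    have h1 := Nat.le_mul_of_pos_left (schemaSyms q).length (show 0 < 2 * d + 5 by omega)
    have h5 : q.1.length + 2 ≤ (schemaSyms q).length := by simp [schemaSyms]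
    have h6 := Nat.mul_le_mul_left (2 * d + 5) h5
    have h7 := Nat.le_mul_of_pos_left q.1.length (show 0 < 2 * d + 5 by omega)
    rw [Nat.mul_add] at h6
    have h2 : ((q :: l).flatMap schemaSyms).length =
        (schemaSyms q).length + (l.flatMap schemaSyms).length := by simp
    have h3 : (encEnv (schemaEntry σ q :: env)).length =
        (encEnv env).length + q.1.length + q.2.1.value σ + q.2.2.value σ + 5 := by
      simp [encEnv_cons, schemaEntry, varBlk]; omega
    rw [h2, Nat.mul_add (2 * d + 5)] at hn ⊢
    have h4 := ih (schemaEntry σ q :: env) (inputF q.1 (q.2.1.value σ) (q.2.2.value σ) φ)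
      -- The new entry is marked by the bit `false`, so it does not hide the entry of a size symbol.
      (fun q' hq' α h => by
        rw [List.lookup_cons, ← ht q' (List.mem_cons_of_mem _ hq') α h]
        rfl)
      (fun q' hq' => hd q' (List.mem_cons_of_mem _ hq')) (by omega)
    have h8 := exec_declare (q := q) (σ := σ) (n := n) (env := env) (o := []) (i := i)
      (x := l.flatMap schemaSyms ++ [.close]) (φ := φ) (ht q List.mem_cons_self) (by omega)
      (by omega) (by omega) (by omega)
    rw [List.append_nil, List.append_nil] at h8
    refine ⟨(Exec.loop_step ?_ (h8.congr_left ?_) h4.1).of_eq ?_ ?_, ?_⟩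
    · simp [Regs.store, schemaSyms]
    · simp [Regs.update_store, Regs.set, Regs.store, schemaSyms]
    · simp [inputsF]
    · rw [List.length_cons, Nat.succ_mul l.length]; omega
    · have := h4.2
      simp only [List.map_cons, List.reverse_cons, List.append_assoc, List.cons_append,
        List.nil_append]
      omega

/-! ### The end of the translation -/

/-- Quantify the variables of the environment. -/
def closeEnv : Prog := loop .env (· == some .and) fun _ =>
  block [popEntry, exVarG.prog, clear .name, clear .row2, clear .col2]

/-- `φ` with quantifiers for the variables of the environment. -/
def exEnv (env : Env) (φ : ExFormula) : ExFormula :=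
  env.foldl (fun φ q => exs (blkVars (.z q.1) q.2.1 q.2.2) φ) φ

/-- Everything left in the environment is quantified. For the entries of size symbols this adds
nothing, as blocks with 0 columns have no variables. -/
theorem exec_closeEnv {n : ℕ} (env : Env) (φ : ExFormula) (hn : (encEnv env).length ≤ n) :
    Exec closeEnv (Regs.store { out := encFormula φ, env := encEnv env })
      (Regs.store { out := encFormula (exEnv env φ) })
      (env.length * (stepCost.eval n + 1) + 1) := by
  induction env generalizing φ with
  | nil =>
    refine (Exec.loop_stop (by simp [Regs.store, encEnv])).of_eq ?_ (by simp)
    simp [Regs.update_store, Regs.set, Regs.store, exEnv, encEnv]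
  | cons q env ih =>
    obtain ⟨w, r, c⟩ := q
    rw [encEnv_cons] at hn ⊢
    simp only [List.length_cons, List.length_append, length_bits, length_ticks] at hn
    have h : Exec (block [popEntry, exVarG.prog, clear .name, clear .row2, clear .col2])
        (Regs.store { out := encFormula φ, env := (encEnv ((w, r, c) :: env)).tail })
        (Regs.store { out := encFormula (exs (blkVars (.z w) r c) φ), env := encEnv env })
        (stepCost.eval n) := by
      refine ((exec_popEntry _ w r c n (encEnv env) ?_ rfl rfl rfl rfl (by omega)).seq <|
        (exec_gen (n := n) (p := exVarG) rfl (o := encFormula φ)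
        (o' := encFormula (exs (blkVars (.z w) r c) φ)) ?_ ?_ ?_ ?_).seq <|
        (exec_clear_of (x := bits w) ?_).seq <| (exec_clear_of (x := ticks r) ?_).seq
        (exec_clear_of (x := ticks c) ?_)).of_eq ?_ ?_
      rotate_right 1
      · rw [eval_stepCost]; simp; omega
      rotate_left 4
      · exact eval_exVarG rfl rfl rfl _
      all_goals simp [Regs.update_store, Regs.set, Regs.store, encEnv_cons,
        show w.length ≤ n by omega, show r ≤ n by omega, show c ≤ n by omega]
    refine (Exec.loop_step ?_ (h.congr_left ?_) (ih (exs (blkVars (.z w) r c) φ)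
      (by omega))).of_eq ?_ ?_
    · simp [Regs.store]
    · rw [encEnv_cons, Regs.update_store]
      rfl
    · simp [exEnv]
    · rw [List.length_cons, Nat.succ_mul]; omega

end Prog

/-! ### The translation of input-sized expressions -/

/-- The variables of an input-sized expression. -/
def inputEnv (E : InputSized) : Env :=
  (E.schema.map (Prog.schemaEntry E.size)).reverse ++ ((E.sizes.map Prog.sizeEntry).reverse ++ [])

/-- The formula for an input-sized expression. -/
def translation (E : InputSized) : ExFormula :=
  Prog.exEnv (inputEnv E) (exs (blkVars (.z outBlk) E.outRows E.outCols)
    (ands (grid E.outRows E.outCols fun i j => ceq (.entry (.z outBlk) i j) (.entry .y i j))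
      (.and (trans (inputEnv E) E.expr) (Prog.inputsF E.size E.schema verum))))

/-- Reading a list onto a stack reverses it; with distinct keys this does not affect lookups. -/
theorem lookup_reverse {β : Type} (l : List (Name × β)) (h : (l.map Prod.fst).Nodup) (w : Name) :
    l.reverse.lookup w = l.lookup w := by
  induction l with
  | nil => rfl
  | cons q l ih =>
    simp only [List.map_cons, List.nodup_cons] at h
    rw [List.reverse_cons, List.lookup_append, ih h.2, List.lookup_cons, List.lookup_cons]
    by_cases hw : w = q.1
    · subst hw
      have : l.lookup q.1 = none := by
        rw [List.lookup_eq_none_iff]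
        intro p hp
        refine bne_iff_ne.2 fun hp' => h.1 (List.mem_map.2 ⟨p, hp, hp'.symm⟩)
      simp [this]
    · have : (w == q.1) = false := by simpa using hw
      simp [this]

theorem lookup_map_cons {β γ : Type} (b : Bool) (f : β → γ) (l : List (Name × β)) (w : Name) :
    (l.map fun q => (b :: q.1, f q.2)).lookup (b :: w) = (l.lookup w).map f := by
  induction l with
  | nil => rfl
  | cons q l ih =>
    rw [List.map_cons, List.lookup_cons, List.lookup_cons, ih]
    by_cases hw : w = q.1
    · subst hw; simp
    · have h1 : (w == q.1) = false := by simpa using hw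
      have h2 : (b :: w == b :: q.1) = false := by simpa using hw
      rw [h1, h2]

theorem lookup_sizeEntries (E : InputSized) {q : Name × Ty} (hq : q ∈ E.schema) {α : Name}
    (h : q.2.1 = .sym α ∨ q.2.2 = .sym α) :
    ((E.sizes.map Prog.sizeEntry).reverse ++ []).lookup (true :: α) = some (E.size α, 0) := by
  have h1 := E.sizes_defined q hq α h
  have h2 : ((E.sizes.map Prog.sizeEntry).map Prod.fst).Nodup := by
    have := E.sizes_nodup.map (f := List.cons true) (fun a b h => by simpa using h)
    simpa [Prog.sizeEntry, Function.comp_def] using this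
  rw [List.append_nil, lookup_reverse _ h2]
  have h3 := lookup_map_cons true (fun v : ℕ => (v, 0)) E.sizes α
  refine h3.trans ?_
  cases h4 : E.sizes.lookup α with
  | none =>
    rw [List.lookup_eq_none_iff] at h4
    obtain ⟨p, hp, rfl⟩ := List.mem_map.1 h1
    simpa using h4 p hp
  | some v => simp [InputSized.size, h4]

/-- The marking bits keep the size entries, which lie below, from answering for matrix variables
outside the schema. -/
theorem inputEnv_fits (E : InputSized) : (inputEnv E).Fits E.schemaFn E.size := by
  intro M
  have h2 : ((E.schema.map (Prog.schemaEntry E.size)).map Prod.fst).Nodup := by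
    have := E.schema_nodup.map (f := List.cons false) (fun a b h => by simpa using h)
    simpa [Prog.schemaEntry, varBlk, Function.comp_def] using this
  have h3 := lookup_map_cons false (fun τ : Ty => (τ.1.value E.size, τ.2.value E.size)) E.schema M
  have h4 : ((E.sizes.map Prog.sizeEntry).reverse ++ []).lookup (varBlk M) = none := by
    rw [List.lookup_eq_none_iff]
    intro p hp
    simp only [List.append_nil, List.mem_reverse, List.mem_map] at hp
    obtain ⟨q, -, rfl⟩ := hp
    rfl
  rw [inputEnv, List.lookup_append, h4, Option.or_none, lookup_reverse _ h2]
  exact h3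

/-! ### The complete program and its running time -/

namespace Prog

open Gen

/-- The program of the translation. -/
def translator : Prog :=
  block [move .src .tmp, move .tmp .back, move .back .src, copySchema, move .spare .mid, readSizes,
    verumG.prog, readSchema, push .kont .var, mainLoop, outputG.prog, clear .row, clear .col,
    closeEnv]

/-- A bound for the running time of the translation. -/
noncomputable def translatorCost : Polynomial ℕ :=
  20 * (Polynomial.X + 1) * (stepCost.comp ((2 * Polynomial.X + 5) * Polynomial.X) + 20)

/-- The place where the unary notation of sizes enters: every dimension is bounded by the length of
the input. -/
theorem lookup_le {l : List (Name × ℕ)} (α : Name) :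
    (l.lookup α).getD 0 ≤ (l.flatMap sizeSyms).length := by
  induction l with
  | nil => simp
  | cons q l ih =>
    rw [List.lookup_cons, List.flatMap_cons, List.length_append]
    split
    · simp [sizeSyms]; omega
    · omega

theorem length_le_length_flatMap {α β : Type} {l : List α} {f : α → List β}
    (h : ∀ q, 0 < (f q).length) : l.length ≤ (l.flatMap f).length := by
  induction l with
  | nil => simp
  | cons q l ih =>
    have := h q
    simp only [List.length_cons, List.flatMap_cons, List.length_append]
    omega

theorem exec_translator (E : InputSized) :
    Exec translator (Regs.store { src := ((encInput E).map conv).reverse })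
      (Regs.store { out := encFormula (translation E) })
      (translatorCost.eval (encInput E).length) := by
  have h1 : (encInput E).map conv = E.schema.flatMap schemaSyms ++ .close ::
      (E.sizes.flatMap sizeSyms ++ .close :: ((encExpr E.expr).map conv ++ [])) := by
    simp [encInput, map_conv_encSchema, map_conv_encSizes]
  have h2 : (encInput E).length = (E.schema.flatMap schemaSyms).length + 1 +
      ((E.sizes.flatMap sizeSyms).length + 1 + (encExpr E.expr).length) := by
    rw [← List.length_map (f := conv), h1]
    simp; omega
  have hlen : ((encInput E).map conv).length = (encInput E).length := List.length_map _
  generalize (encInput E).map conv = x at h1 hlen ⊢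
  generalize (encInput E).length = L at h2 hlen ⊢
  -- With L as bound for all dimensions, the budget of 2L + 5 per input symbol covers the entries
  -- made by the sizes, by the schema and by the expression together.
  obtain ⟨n, hn⟩ : ∃ n, n = (2 * L + 5) * L := ⟨_, rfl⟩
  have hT : translatorCost.eval L = 20 * (L * stepCost.eval n + 20 * L + stepCost.eval n + 20) := by
    simp only [translatorCost, Polynomial.eval_mul, Polynomial.eval_add, Polynomial.eval_ofNat,
      Polynomial.eval_X, Polynomial.eval_one, Polynomial.eval_comp, ← hn]
    ring
  have hP : 20 * n + 100 ≤ stepCost.eval n := by rw [eval_stepCost]; omega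
  rw [hT]
  have hL : L ≤ n := hn ▸ Nat.le_mul_of_pos_left _ (by omega)
  have hsz (α : Name) : E.size α ≤ L := (lookup_le α).trans (by omega)
  have hv (t : SizeTerm) : t.value E.size ≤ L := by
    cases t with
    | one => simp only [SizeTerm.value]; omega
    | sym α => exact hsz α
  have hn' : n = (2 * L + 5) * ((E.schema.flatMap schemaSyms).length + 1 +
      ((E.sizes.flatMap sizeSyms).length + 1 + (encExpr E.expr).length)) := by
    rw [← h2]; exact hn
  simp only [Nat.mul_add (2 * L + 5)] at hn'
  obtain ⟨h3, h4⟩ := exec_readSizes (d := L) (n := n) E.sizes ((encExpr E.expr).map conv ++ [])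
    (E.schema.flatMap schemaSyms ++ [.close]) []
    (by
      have : (encEnv []).length = 0 := rfl
      omega)
  obtain ⟨h5, h6⟩ := exec_readSchema (σ := E.size) (d := L) (n := n) E.schema
    ((encExpr E.expr).map conv ++ []) ((E.sizes.map sizeEntry).reverse ++ []) verum
    (fun q hq α h => lookup_sizeEntries E hq h) (fun q _ => ⟨hv _, hv _⟩) (by
      have : (encEnv []).length = 0 := rfl
      omega)
  have h7 : (encEnv (inputEnv E)).length + (2 * L + 5) * (encExpr E.expr).length ≤ n := by
    have : (encEnv []).length = 0 := rfl
    change (encEnv (inputEnv E)).length ≤ _ at h6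
    omega
  have hfit := inputEnv_fits E
  have hdims : dims (inputEnv E) E.expr = (E.outRows, E.outCols) := dims_eq E.hasType hfit
  have hdE : ∀ q ∈ inputEnv E, q.2.1 ≤ L ∧ q.2.2 ≤ L := by
    intro q hq
    simp only [inputEnv, List.append_nil, List.mem_append, List.mem_reverse, List.mem_map] at hq
    obtain ⟨q, -, rfl⟩ | ⟨q, hq, rfl⟩ := hq
    · exact ⟨hv _, hv _⟩
    · refine ⟨?_, Nat.zero_le _⟩
      have h8 : (sizeSyms q).length ≤ (E.sizes.flatMap sizeSyms).length :=
        (List.sublist_flatten_of_mem (List.mem_map_of_mem hq)).length_le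
      have h9 : q.2 ≤ (sizeSyms q).length := by simp [sizeSyms]; omega
      exact h9.trans (h8.trans (by omega))
  have h8 : Exec mainLoop (stage (encFormula (inputsF E.size E.schema verum))
      ((encExpr E.expr).map conv ++ []) [.var] (inputEnv E) 0 0)
      (stage (encFormula (trans (inputEnv E) E.expr) ++
        encFormula (inputsF E.size E.schema verum)) [] [] (inputEnv E) E.outRows E.outCols)
      ((encExpr E.expr).length * (3 * (stepCost.eval n + 2)) + 1) := by
    intro l
    have h9 := reach_translation E.hasType hfit (d := L) (by omega) hdE h7 l
      (encFormula (inputsF E.size E.schema verum)) [] []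
    rw [hdims] at h9
    refine h9.trans (((Exec.loop_stop rfl).of_eq ?_ le_rfl) l)
    simp [Regs.update_store, Regs.set, Regs.store]
  generalize hψ : exs (blkVars (.z outBlk) E.outRows E.outCols)
    (ands (grid E.outRows E.outCols fun i j => ceq (.entry (.z outBlk) i j) (.entry .y i j))
      (.and (trans (inputEnv E) E.expr) (inputsF E.size E.schema verum))) = ψ
  have h9 := exec_closeEnv (n := n) (inputEnv E) ψ (by omega)
  have hr : E.outRows ≤ n := (hv _).trans hL
  have hc : E.outCols ≤ n := (hv _).trans hL
  -- The input arrives reversed; three moves, an odd number, bring it back to the same stack in the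
  -- right order.
  refine ((exec_move_of (x := x.reverse) (y := []) (by decide) rfl rfl).seq <|
    (exec_move_of (x := x) (y := []) (by decide) ?_ ?_).seq <|
    ((exec_move_of (x := x.reverse) (y := []) (by decide) ?_ ?_).of_eq ?_ le_rfl).seq <|
    (exec_copySchema E.schema (E.sizes.flatMap sizeSyms ++ .close ::
      ((encExpr E.expr).map conv ++ [])) []).seq <|
    ((exec_move_of (x := .close :: ((E.schema.flatMap schemaSyms).reverse ++ [])) (y := [])
      (by decide) ?_ ?_).of_eq ?_ le_rfl).seq <|
    h3.seq <|
    ((exec_gen (n := n) (p := verumG) rfl (o := []) (o' := encFormula verum) ?_ ?_ ?_ ?_).of_eq ?_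
      le_rfl).seq <|
    h5.seq <|
    ((exec_push_of (x := []) ?_).of_eq ?_ le_rfl).seq <|
    h8.seq <|
    (exec_gen (n := n) (p := outputG) rfl (o' := encFormula ψ) ?_ ?_ rfl ?_).seq <|
    (exec_clear_of (x := ticks E.outRows) ?_).seq <|
    ((exec_clear_of (x := ticks E.outCols) ?_).of_eq ?_ le_rfl).seq h9).of_eq ?_ ?_
  rotate_right 1
  · have e1 : E.schema.length ≤ L :=
      (length_le_length_flatMap fun q => by simp [schemaSyms]).trans
        (show (E.schema.flatMap schemaSyms).length ≤ L by omega)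
    have e2 : E.sizes.length ≤ L :=
      (length_le_length_flatMap fun q => by simp [sizeSyms]).trans
        (show (E.sizes.flatMap sizeSyms).length ≤ L by omega)
    have e3 : (encExpr E.expr).length ≤ L := by omega
    have e4 : (inputEnv E).length = E.schema.length + E.sizes.length := by simp [inputEnv]
    have e5 := (Nat.mul_le_mul_right (10 * n + 40) e2).trans
      (Nat.mul_le_mul_left L (show 10 * n + 40 ≤ stepCost.eval n by omega))
    have e6 := Nat.mul_le_mul_right (2 * stepCost.eval n + 2) e1
    have e7 := Nat.mul_le_mul_right (3 * (stepCost.eval n + 2)) e3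
    have e8 := Nat.mul_le_mul_right (stepCost.eval n + 1) (show (inputEnv E).length ≤ 2 * L by
      omega)
    have e9 : verumG.cost.eval n + outputG.cost.eval n ≤ stepCost.eval n := by
      rw [eval_stepCost]; omega
    -- All products are reduced to the single term L * `stepCost.eval n`, which makes the remaining
    -- comparison linear.
    have e10 : L * (2 * stepCost.eval n + 2) = 2 * (L * stepCost.eval n) + 2 * L := by ring
    have e11 : L * (3 * (stepCost.eval n + 2)) = 3 * (L * stepCost.eval n) + 6 * L := by ring
    have e12 : 2 * L * (stepCost.eval n + 1) = 2 * (L * stepCost.eval n) + 2 * L := by ring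
    simp only [List.length_append, List.length_cons, List.length_reverse, List.length_nil,
      length_ticks, hlen]
    omega
  all_goals try simp [Regs.update_store, Regs.set, Regs.store, hr, hc]
  · rw [h1, List.append_nil]
  · rfl
  · exact eval_verumG
  · simp only [inputEnv, List.append_nil]
    rfl
  · rw [← hψ]
    exact eval_outputG (r := E.outRows) (c := E.outCols) rfl rfl _ _
  · rw [← hψ]
    rfl

end Prog

/-! ### Correctness of the translation -/

theorem computable_translation :
    Nonempty (Turing.TM2ComputableInPolyTime encInput encFormula translation) := by
  refine Prog.nonempty_tm2ComputableInPolyTime conv Prog.translator Prog.translatorCost fun E => ?_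
  have h (k : Stk) (l : List OutTok) :
      Function.update (fun _ => []) k l = (Regs.set {} k l).store := by
    rw [← Regs.update_store]
    congr 1
    funext k
    cases k <;> rfl
  rw [h, h]
  exact Prog.exec_translator E []

theorem exEnv_eq (env : Env) (φ : ExFormula) : Prog.exEnv env φ =
    exs (env.reverse.flatMap fun q => blkVars (.z q.1) q.2.1 q.2.2) φ := by
  induction env generalizing φ with
  | nil => rfl
  | cons q env ih =>
    refine (ih _).trans ?_
    simp [exs]

theorem inputsF_eq (σ : Name → ℕ) (l : List (Name × Ty)) (φ : ExFormula) : Prog.inputsF σ l φ =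
    ands (l.reverse.flatMap fun q => grid (q.2.1.value σ) (q.2.2.value σ) fun i j =>
      ceq (.entry (.z (varBlk q.1)) i j) (.entry (.x q.1) i j)) φ := by
  induction l generalizing φ with
  | nil => rfl
  | cons q l ih =>
    refine (ih _).trans ?_
    simp [ands, Prog.inputF]

theorem symbols_translation (E : InputSized) : (translation E).symbols ⊆ E.expr.symbols := by
  have h (b b' : Blk) (r c : ℕ) : ⋃ χ ∈ grid r c fun i j =>
      ceq (.entry b i j) (.entry b' i j), χ.symbols ⊆ E.expr.symbols :=
    symbols_grid _ _ _ _ (by simp [ceq, ExFormula.symbols, RTerm.symbols, CTerm.entry])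
  simp only [translation, exEnv_eq, inputsF_eq, symbols_exs, symbols_ands, ExFormula.symbols]
  refine Set.union_subset (h _ _ _ _) (Set.union_subset (symbols_trans _ _) (Set.union_subset ?_
    ?_))
  · simp only [List.mem_flatMap, Set.iUnion_subset_iff]
    rintro χ ⟨q, -, hχ⟩
    exact (Set.subset_iUnion₂ (s := fun χ _ => ExFormula.symbols χ) χ hχ).trans (h _ _ _ _)
  · simp [verum, ExFormula.symbols, RTerm.symbols]

theorem mem_schema_iff (E : InputSized) (M : Name) (τ : Ty) :
    (M, τ) ∈ E.schema ↔ E.schemaFn M = some τ := by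
  rw [InputSized.schemaFn]
  have h := E.schema_nodup
  generalize E.schema = l at h
  induction l with
  | nil => simp
  | cons q l ih =>
    obtain ⟨M', τ'⟩ := q
    simp only [List.map_cons, List.nodup_cons] at h
    rw [List.lookup_cons]
    by_cases hM : M = M'
    · subst hM
      have : (M, τ) ∉ l := fun h' => h.1 (List.mem_map_of_mem (f := Prod.fst) h')
      simp [this, eq_comm]
    · have h' : (M == M') = false := by simpa using hM
      simp [h', hM, ih h.2]

/-- An exact description, not only an inclusion: it shows that every x- and y-variable really
occurs. -/
theorem exists_grid_ceq {b b' : Blk} {r c : ℕ} {v : RVar} :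
    (∃ χ ∈ grid r c fun i j => ceq (.entry b i j) (.entry b' i j), v ∈ χ.freeVars) ↔
      v ∈ blkVars b r c ∨ v ∈ blkVars b' r c := by
  have h (b : Blk) (i j : ℕ) : v ∈ (CTerm.entry b i j).vars ↔ ∃ p, v = b i j p := by
    constructor
    · rintro (h | h)
      exacts [⟨_, h⟩, ⟨_, h⟩]
    · rintro ⟨_ | _, h⟩
      exacts [.inl h, .inr h]
  simp only [grid, List.mem_flatMap, List.mem_range, mem_blkVars]
  constructor
  · rintro ⟨χ, ⟨i, hi, j, hj, hχ⟩, hv⟩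
    obtain h' | h' := mem_freeVars_ceq.1 ⟨χ, hχ, hv⟩
    · exact .inl ⟨i, hi, j, hj, (h _ _ _).1 h'⟩
    · exact .inr ⟨i, hi, j, hj, (h _ _ _).1 h'⟩
  · rintro (⟨i, hi, j, hj, h'⟩ | ⟨i, hi, j, hj, h'⟩)
    · obtain ⟨χ, hχ, hv⟩ := mem_freeVars_ceq.2 (.inl ((h _ _ _).2 h') :
        v ∈ (CTerm.entry b i j).vars ∨ v ∈ (CTerm.entry b' i j).vars)
      exact ⟨χ, ⟨i, hi, j, hj, hχ⟩, hv⟩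
    · obtain ⟨χ, hχ, hv⟩ := mem_freeVars_ceq.2 (.inr ((h _ _ _).2 h') :
        v ∈ (CTerm.entry b i j).vars ∨ v ∈ (CTerm.entry b' i j).vars)
      exact ⟨χ, ⟨i, hi, j, hj, hχ⟩, hv⟩

/-- The equations for the inputs run over the whole schema, so the x-variables of a matrix variable
occur even if the expression does not mention it. All auxiliary variables are bound by the outer
quantifiers. -/
theorem freeVars_translation (E : InputSized) : (translation E).freeVars = E.FV := by
  have hfit := inputEnv_fits E
  have hverum : verum.freeVars = ∅ := Set.subset_empty_iff.1 (freeVars_verum _)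
  ext v
  simp only [translation, exEnv_eq, inputsF_eq, freeVars_exs, freeVars_ands, ExFormula.freeVars,
    Set.mem_sdiff, Set.mem_union, Set.mem_ofPred_eq, exists_grid_ceq, List.mem_flatMap,
    List.mem_reverse, hverum, Set.mem_empty_iff_false, or_false]
  constructor
  · rintro ⟨⟨(hv | hv) | hv | ⟨χ, ⟨⟨M, τ⟩, hq, hχ⟩, hv⟩, h1⟩, h2⟩
    · exact absurd hv h1
    · obtain ⟨i, hi, j, hj, p, rfl⟩ := mem_blkVars.1 hv
      exact .inr ⟨i, j, p, hi, hj, rfl⟩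
    · obtain hv | ⟨M, r, c, h, hv⟩ := freeVars_trans_subset E.hasType hfit hv
      · exact absurd hv h1
      · exact absurd ⟨_, Prog.lookup_mem h, hv⟩ h2
    · have h3 := (mem_schema_iff E M τ).1 hq
      obtain hv | hv := exists_grid_ceq.1 ⟨χ, hχ, hv⟩
      · refine absurd ⟨_, Prog.lookup_mem (w := varBlk M)
          (p := (τ.1.value E.size, τ.2.value E.size)) ?_, hv⟩ h2
        rw [hfit, h3]
        rfl
      · obtain ⟨i, hi, j, hj, p, rfl⟩ := mem_blkVars.1 hv
        exact .inl ⟨M, τ, i, j, p, h3, hi, hj, rfl⟩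
  · rintro (⟨M, τ, i, j, p, h, hi, hj, rfl⟩ | ⟨i, j, p, hi, hj, rfl⟩)
    · refine ⟨⟨.inr (.inr ?_), ?_⟩, ?_⟩
      · obtain ⟨χ, hχ, hv⟩ := exists_grid_ceq.2
          (.inr (mem_blkVars.2 ⟨i, hi, j, hj, p, rfl⟩) :
            RVar.x M i j p ∈ blkVars (.z (varBlk M)) _ _ ∨ _ ∈ blkVars (.x M) _ _)
        exact ⟨χ, ⟨_, (mem_schema_iff E M τ).2 h, hχ⟩, hv⟩
      · simp [mem_blkVars]
      · simp [mem_blkVars]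
    · refine ⟨⟨.inl (.inr (mem_blkVars.2 ⟨i, hi, j, hj, p, rfl⟩)), ?_⟩, ?_⟩
      · simp [mem_blkVars]
      · simp [mem_blkVars]

theorem conformsBy_instanceOf (E : InputSized) (ρ : RVar → ℝ) :
    ConformsBy (E.instanceOf ρ) E.schemaFn E.size := by
  refine ⟨fun M => by simp [InputSized.instanceOf], fun M τ A h h' => ?_⟩
  simp only [InputSized.instanceOf, h, Option.map_some, Option.some.injEq] at h'
  subst h'
  exact ⟨rfl, rfl⟩

theorem inst_inputEnv (E : InputSized) {ρ ρ' : RVar → ℝ}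
    (h : ∀ M τ, E.schemaFn M = some τ → ∀ (i : Fin (τ.1.value E.size)) (j : Fin (τ.2.value E.size)),
      get (.z (varBlk M)) ρ' i j = get (.x M) ρ i j) :
    (inputEnv E).inst ρ' = E.instanceOf ρ := by
  funext M
  rw [Env.inst, inputEnv_fits E, InputSized.instanceOf]
  cases hM : E.schemaFn M with
  | none => rfl
  | some τ =>
    simp only [Option.map_some, Option.some.injEq, Mat.mk.injEq, heq_eq_eq, true_and]
    ext i j
    exact h M τ hM i j

open Classical in
/-- Give the input blocks the values of the `x`-variables. -/
def InputSized.setInputs (E : InputSized) (ρ : RVar → ℝ) : RVar → ℝ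
  | .z (false :: M) i j p => if ∃ τ, E.schemaFn M = some τ ∧ i < τ.1.value E.size ∧
      j < τ.2.value E.size then ρ (.x M i j p) else ρ (.z (false :: M) i j p)
  | v => ρ v

/-- The equations force the input blocks and the result block to carry the matrices specified by ρ,
and then `means_trans` applies. -/
theorem holds_translation (E : InputSized) (Ω : Interp) (ρ : RVar → ℝ) :
    (translation E).Holds Ω ρ ↔ E.outputOf ρ ∈ E.expr.results Ω (E.instanceOf ρ) := by
  have hfit := inputEnv_fits E
  have hmean := means_trans (Ω := Ω) E.hasType hfit
  have hin (ρ : RVar → ℝ) : (∀ χ ∈ E.schema.reverse.flatMap fun q =>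
      grid (q.2.1.value E.size) (q.2.2.value E.size) fun i j =>
        ceq (.entry (.z (varBlk q.1)) i j) (.entry (.x q.1) i j), χ.Holds Ω ρ) ↔
      ∀ M τ, E.schemaFn M = some τ → ∀ (i : Fin (τ.1.value E.size)) (j : Fin (τ.2.value E.size)),
        get (.z (varBlk M)) ρ i j = get (.x M) ρ i j := by
    simp only [← mem_schema_iff, List.mem_flatMap, List.mem_reverse]
    constructor
    · intro h M τ hM i j
      exact holds_ceq.1 (forall_grid.1 (fun χ hχ => h χ ⟨_, hM, hχ⟩) i j)
    · rintro h χ ⟨⟨M, τ⟩, hM, hχ⟩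
      exact forall_grid.2 (fun i j => by rw [holds_ceq]; exact h M τ hM i j) χ hχ
  rw [translation, exEnv_eq, holds_exs]
  simp only [inputsF_eq, holds_exs_blk, holds_ands,
    ExFormula.Holds, forall_grid, holds_ceq, value_entry, hin, holds_verum, and_true, hmean _]
  constructor
  · rintro ⟨ρ', h1, A, h2, h3, h4⟩
    -- Only z-variables are quantified, so ρ' still has the x- and y-values of ρ.
    have hx (M : Name) (i j : ℕ) : get (.x M) (setBlk ρ' outBlk A) i j = get (.x M) ρ i j := by
      simp [get, setBlk, h1, mem_blkVars]
    rw [inst_inputEnv E (ρ := ρ) fun M τ h i j => (h4 M τ h i j).trans (hx _ _ _)] at h3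
    convert h3 using 1
    rw [InputSized.outputOf, Mat.mk.injEq]
    refine ⟨rfl, rfl, heq_of_eq ?_⟩
    ext i j
    refine Eq.trans ?_ (h2 i j).symm
    simp [get, setBlk, h1, mem_blkVars]
  · intro h
    have hx (A : Matrix (Fin E.outRows) (Fin E.outCols) ℂ) (M : Name) (i j : ℕ) :
        get (.x M) (setBlk (E.setInputs ρ) outBlk A) i j = get (.x M) ρ i j := rfl
    have hz (A : Matrix (Fin E.outRows) (Fin E.outCols) ℂ) : ∀ M τ, E.schemaFn M = some τ →
        ∀ (i : Fin (τ.1.value E.size)) (j : Fin (τ.2.value E.size)),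
        get (.z (varBlk M)) (setBlk (E.setInputs ρ) outBlk A) i j = get (.x M) ρ i j := by
      intro M τ hM i j
      rw [get_setBlk_ne (by simp [varBlk, outBlk])]
      simp [get, varBlk, InputSized.setInputs, hM]
    -- The witnesses are forced: the input blocks copy the x-variables, and the result block copies
    -- the y-variables. Positions outside the blocks of the schema keep the values of ρ, as the
    -- quantifiers do not reach them.
    refine ⟨E.setInputs ρ, ?_, mat .y ρ E.outRows E.outCols, fun i j => ?_, ?_, fun M τ hM i j =>
      ?_⟩
    · intro v hv
      unfold InputSized.setInputs
      split
      · rw [if_neg]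
        rintro ⟨τ, hM, hi, hj⟩
        refine hv (List.mem_flatMap.2 ⟨_, List.mem_reverse.2
          (Prog.lookup_mem (w := varBlk _) (p := (τ.1.value E.size, τ.2.value E.size)) ?_),
          mem_blkVars.2 ⟨_, hi, _, hj, _, rfl⟩⟩)
        rw [hfit, hM]
        rfl
      · rfl
    · exact get_setBlk_self _ _ i j
    · rw [inst_inputEnv E (hz _)]
      convert h using 1
      rw [InputSized.outputOf, Mat.mk.injEq]
      exact ⟨rfl, rfl, heq_of_eq (mat_setBlk_self _ _)⟩
    · rw [hx]
      exact hz _ M τ hM i j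

end Matlang

theorem mainTheorem4 :
    ∃ T : Matlang.InputSized → Matlang.ExFormula,
      Nonempty (Turing.TM2ComputableInPolyTime Matlang.encInput Matlang.encFormula T) ∧
      ∀ E : Matlang.InputSized,
        (T E).symbols ⊆ E.expr.symbols ∧
        (T E).freeVars = E.FV ∧
        (∀ ρ : Matlang.RVar → ℝ, Matlang.ConformsBy (E.instanceOf ρ) E.schemaFn E.size) ∧
        ∀ (Ω : Matlang.Interp) (ρ : Matlang.RVar → ℝ),
          (T E).Holds Ω ρ ↔ E.outputOf ρ ∈ E.expr.results Ω (E.instanceOf ρ) :=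
  ⟨Matlang.translation, Matlang.computable_translation, fun E =>
    ⟨Matlang.symbols_translation E, Matlang.freeVars_translation E,
      Matlang.conformsBy_instanceOf E, Matlang.holds_translation E⟩⟩
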